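/- **Game.** There are $N\ge 1$ players. Player $i$ chooses $x_i\in\mathcal X_i\subseteq\mathbb R^{n_i}$ and minimizes $\mathbb J_i(x_i;x_{-i})=\mathbb E[J_i(x_i;x_{-i},\xi_i)]$ subject to the shared constraint $Ax=\sum_jA_jx_j\le c$ in $\mathbb R^m$. Put $n=\sum_i n_i$, $\mathcal X=\prod_i\mathcal X_i$ and $\tilde{\mathcal X}=\{x\in\mathcal X: Ax\le c\}$. A *v-SGNE* is a point $x^*\in\tilde{\mathcal X}$ for which some $g^*\in\prod_i\partial_{x_i}\mathbb J_i(x_i^*;x_{-i}^*)$ satisfies $(x-x^*)^Tg^*\ge0$ for all $x\in\tilde{\mathcal X}$. Assume: 1. $J_i$ is real-valued with finite expectation; for every fixed sample it is continuous in $x$ and convex in $x_i$. 2. Each $\mathcal X_i$ is nonempty, compact and convex, $\tilde{\mathcal X}\neq\varnothing$, and the Mangasarian–Fromovitz constraint qualification holds (at each $x\in\tilde{\mathcal X}$ some tangent direction $d$ of $\mathcal X$ has $(Ad)_r<0$ for all active constraints $r$). 3. A v-SGNE exists. 4. The communication graph, with directed edges $(j,i)\in\mathcal E_g$ (tail $j$,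 head $i$), has no self-loops, and its underlying undirected graph is connected. $B$ is its incidence matrix ($+1$ at the head, $-1$ at the tail), $L=BB^T$, $B_q=B\otimes I_q$ and $L_q=L\otimes I_q$. **Operators.** Player $i$ keeps $y_i=[y_i^j]_j\in\mathbb R^n$ (its decision $y_i^i$ and estimates $y_i^j$, $j\ne i$) and $\lambda_i\in\mathbb R^m$; each edge $e$ keeps $\mu_e\in\mathbb R^n$ and $z_e\in\mathbb R^m$; $\psi=[\mathbf y;\boldsymbol\lambda;\boldsymbol\mu;\mathbf z]$ is the stack. Let $\mathbb F(x)=\prod_i\partial_{x_i}\mathbb J_i(x_i;x_{-i})$, $\mathbf F(\mathbf y)=\prod_i\partial_{x_i}\mathbb J_i(y_i^i;y_i^{-i})$, $\mathcal R\mathbf y=[y_i^i]_i$, $\Lambda=\mathrm{blkd}(A_1,\dots,A_N)$, $\sum_ic_i=c$, $\mathbf c=[c_i]_i$, $\rho_\mu,\rho_z\ge0$. Let $\mathcal X_i^B\supseteq\mathcal X_i$ be bounded closed boxes, $\hat{\mathcal X}_i=\{y_i\in\mathbb R^n: y_i^i\in\mathcal X_i\}$, $\hat{\mathcal X}=\prod_i\hat{\mathcal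 X}_i$, and $\hat{\mathcal X}^B$ likewise with $\mathcal X_i^B$. Define $$D=\begin{bmatrix}\frac{\rho_\mu}2L_n&\frac12(\Lambda\mathcal R)^T&\frac12B_n&0\\-\frac12\Lambda\mathcal R&\frac{\rho_z}2L_m&0&\frac12B_m\\-\frac12B_n^T&0&0&0\\0&-\frac12B_m^T&0&0\end{bmatrix},$$ $$\Phi=\begin{bmatrix}\boldsymbol\tau_1^{-1}-\frac{\rho_\mu}2L_n&-\frac12(\Lambda\mathcal R)^T&-\frac12B_n&0\\-\frac12\Lambda\mathcal R&\boldsymbol\tau_2^{-1}-\frac{\rho_z}2L_m&0&-\frac12B_m\\-\frac12B_n^T&0&\boldsymbol\tau_3^{-1}&0\\0&-\frac12B_m^T&0&\boldsymbol\tau_4^{-1}\end{bmatrix},$$ where $\boldsymbol\tau_1,\boldsymbol\tau_2$ (resp. $\boldsymbol\tau_3,\boldsymbol\tau_4$) are block-diagonal with positive scalars $\tau_{1i},\tau_{2i}$ per player (resp. $\tau_{3e},\tau_{4e}$ per edge), and $$\mathbb A\psi=D\psi+[\mathcal R^T\mathbf F(\mathbf y)+N_{\hat{\mathcal X}^B}(\mathbf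 y);\ \mathbf c;\ 0;\ 0],\qquad \mathbb B\psi=D\psi+[N_{\hat{\mathcal X}}(\mathbf y);\ N_{\mathbb R_+^{mN}}(\boldsymbol\lambda);\ 0;\ 0].$$ Assume: 5. Either (i) $\mathcal R^T\mathbf F+\frac{\rho_\mu}2L_n$ is maximally monotone; or (ii) $\mathbb F$ is $\eta$-strongly monotone and $\theta_1$-Lipschitz, $\mathbf F$ is $\theta_2$-Lipschitz ($\eta,\theta_1,\theta_2>0$), and $\rho_\mu\ge\frac2{\sigma_1}\big(\frac{(\theta_1+\theta_2)^2}{4\eta}+\theta_2\big)$, with $\sigma_1$ the smallest positive eigenvalue of $L$ (this last requirement being void if $N=1$). 6. $\Phi$ is positive definite. Write $\|\psi\|_{\mathcal K}=(\psi^T\Phi\psi)^{1/2}$, $J_T=(I+T)^{-1}$, $R_T=2J_T-I$, $\bar A=\Phi^{-1}\mathbb A$, $\bar B=\Phi^{-1}\mathbb B$ and $\mathscr R_*=R_{\bar B}\circ R_{\bar A}$. **Algorithm.** For a family $v$ on players let $v_{iL}=\sum_{(j,i)\in\mathcal E_g}(v_i-v_j)+\sum_{(i,j)\in\mathcal E_g}(v_i-v_j)$;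 for a family $u$ on edges let $u_{iB}=\sum_{(j,i)\in\mathcal E_g}u_{ji}-\sum_{(i,j)\in\mathcal E_g}u_{ij}$. Start from a random $\tilde\psi^{(0)}$. Iteration $k$ computes the following from $\tilde\psi=\tilde\psi^{(k)}$. * *Inexact step $\psi=\psi^{(k+1)}$.* First $y_i^{-i}=\tilde y_i^{-i}-\frac{\tau_{1i}}2(\rho_\mu\tilde y^{-i}_{iL}+\tilde\mu^{-i}_{iB})$. Then $y_i^i=y_{i,T_i^{(k)}}$, where $y_{i,0}=\tilde y_i^i$ and $y_{i,t+1}=\mathrm{P}_{\mathcal X_i^B}\big[y_{i,t}-\frac{2\tau_{1i}}{t+2}g_{i,t}^{(k)}\big]$ for $0\le t<T_i^{(k)}$, with $T_i^{(k)}\ge1$. Then $\lambda_i=\tilde\lambda_i+\tau_{2i}\big(A_i(y_i^i-\frac12\tilde y_i^i)-\frac{\rho_z}2\tilde\lambda_{iL}-\frac12\tilde z_{iB}-c_i\big)$. With $\hat{\mathbf y}=2\mathbf y-\tilde{\mathbf y}$ and $\hat{\boldsymbol\lambda}=2\boldsymbol\lambda-\tilde{\boldsymbol\lambda}$, each edge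 $e=(j,i)$ sets $\mu_e=\tilde\mu_e+\frac{\tau_{3e}}2(\hat y_i-\hat y_j)$ and $z_e=\tilde z_e+\frac{\tau_{4e}}2(\hat\lambda_i-\hat\lambda_j)$. * *Second step $\bar\psi$, from $\hat\psi=2\psi-\tilde\psi$.* $\bar y_i=\mathrm P_{\hat{\mathcal X}_i}\big[\hat y_i-\frac{\tau_{1i}}2(\mathcal R_i^TA_i^T\hat\lambda_i+\rho_\mu\hat y_{iL}+\hat\mu_{iB})\big]$, where $\mathcal R_iy_i=y_i^i$; $\bar\lambda_i=\mathrm P_{\mathbb R^m_+}\big[\hat\lambda_i+\tau_{2i}(A_i(\bar y_i^i-\frac12\hat y_i^i)-\frac{\rho_z}2\hat\lambda_{iL}-\frac12\hat z_{iB})\big]$; and for $e=(j,i)$, $\bar\mu_e=\hat\mu_e+\tau_{3e}\big((\bar y_i-\bar y_j)-\frac12(\hat y_i-\hat y_j)\big)$, $\bar z_e=\hat z_e+\tau_{4e}\big((\bar\lambda_i-\bar\lambda_j)-\frac12(\hat\lambda_i-\hat\lambda_j)\big)$. * *Update.* $\tilde\psi^{(k+1)}=\tilde\psi+2\gamma^{(k)}(\bar\psi-\psi)$.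 Let $\xi_{i,t}^{(k)}$ ($0\le t<T_i^{(k)}$) be the random samples, $\mathcal F_k=\sigma\{\tilde\psi^{(0)},\xi_{i,t}^{(j)}: j<k\}$ and $\mathcal F_{k,i,t}=\sigma\{\mathcal F_k,\xi_{i,0}^{(k)},\dots,\xi_{i,t-1}^{(k)}\}$. Let $\tilde\varphi_i=\frac12(A_i^T\tilde\lambda_i+\tilde\mu^i_{iB}+\rho_\mu\tilde y^i_{iL})$, $\hat{\mathbb J}_i^{(k)}(v)=\mathbb J_i(v;y_i^{-i})+\tilde\varphi_i^Tv+\frac1{2\tau_{1i}}\|v-\tilde y_i^i\|^2$, and let $\hat J_i^{(k)}(v;\xi)$ be the same with $J_i(v;y_i^{-i},\xi)$ in place of $\mathbb J_i$. Assume: 7. The $g_{i,t}^{(k)}$ are square-integrable, $\mathcal F_{k,i,t+1}$-measurable and a.s. satisfy $g_{i,t}^{(k)}\in\partial\hat J_i^{(k)}(y_{i,t};\xi_{i,t}^{(k)})$, $\ \mathbb E[g_{i,t}^{(k)}\mid\mathcal F_{k,i,t}]\in\partial\hat{\mathbb J}_i^{(k)}(y_{i,t})$ and $\ \mathbb E[\|g_{i,t}^{(k)}\|_2^2\mid\mathcal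 F_k]\le\alpha_i^2\|\tilde\psi^{(k)}\|_2^2+\beta_i^2$, with constants $\alpha_i,\beta_i>0$ depending only on $i$. **Theorem.** Let $\gamma^{(k)}\in[0,1]$ with $\sum_k\gamma^{(k)}(1-\gamma^{(k)})=\infty$ and $\sum_k\gamma^{(k)}\big(\min_iT_i^{(k)}\big)^{-1/2}<\infty$. Then $J_{\bar A}$ and $J_{\bar B}$ are single-valued and everywhere defined, and: * $(\|\tilde\psi^{(k)}\|_{\mathcal K})_k$ is bounded a.s.; * the errors $\varepsilon^{(k)}=\|R_{\bar B}(2\psi^{(k+1)}-\tilde\psi^{(k)})-\mathscr R_*(\tilde\psi^{(k)})\|_{\mathcal K}$ are integrable and $\sum_k\gamma^{(k)}\mathbb E[\varepsilon^{(k)}\mid\mathcal F_k]<\infty$ a.s.; * almost surely, $\tilde\psi^{(k)}$ converges to a fixed point of $\mathscr R_*$, and the $\mathbf y$-component of $J_{\bar A}(\tilde\psi^{(k)})$ converges to $\mathbf 1_N\otimes x^*$ for some v-SGNE $x^*$ of the game (in particular the decisions $[y_i^i]_i$ converge to $x^*$). -/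

import Mathlib

open MeasureTheory ProbabilityTheory Filter Topology
open scoped Matrix Kronecker

namespace SGNE

noncomputable section

/-! ### Vectors, convex analysis, set-valued operators

All vectors are plain coordinate functions; inner products are written with `⬝ᵥ` and Euclidean norms
with `norm2`, so the sup norm of function types is never used as a norm. -/

/-- Index set of a collective decision vector `x = [x_1; ...; x_N]`, with `x_j` of dimension `n j`. -/
abbrev Idx {N : ℕ} (n : Fin N → ℕ) : Type := Σ j : Fin N, Fin (n j)

/-- The subvector `x_i` of the collective vector `x`. -/
def block {N : ℕ} {n : Fin N → ℕ} (x : Idx n → ℝ) (i : Fin N) : Fin (n i) → ℝ :=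
  fun a => x ⟨i, a⟩

/-- The collective vector `(v; x_{-i})`: the block `x_i` of `x` is replaced by `v`. -/
def replaceBlock {N : ℕ} {n : Fin N → ℕ} (x : Idx n → ℝ) (i : Fin N) (v : Fin (n i) → ℝ) :
    Idx n → ℝ :=
  fun p => Function.update (fun j => block x j) i v p.1 p.2

/-- The Euclidean norm of a coordinate vector. -/
def norm2 {ι : Type*} [Fintype ι] (v : ι → ℝ) : ℝ := ‖WithLp.toLp 2 v‖

/-- The convex subdifferential of `f` at `x`. -/
def subdiff {ι : Type*} [Fintype ι] (f : (ι → ℝ) → ℝ) (x : ι → ℝ) : Set (ι → ℝ) :=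
  {u | ∀ v, f x + u ⬝ᵥ (v - x) ≤ f v}

/-- The normal cone to `C` at `x`; it is empty when `x ∉ C`. -/
def normalCone {ι : Type*} [Fintype ι] (C : Set (ι → ℝ)) (x : ι → ℝ) : Set (ι → ℝ) :=
  {u | x ∈ C ∧ ∀ z ∈ C, u ⬝ᵥ (z - x) ≤ 0}

/-- The Euclidean projection onto `C` (meaningful for nonempty closed convex `C`). -/
def proj {ι : Type*} [Fintype ι] (C : Set (ι → ℝ)) (x : ι → ℝ) : ι → ℝ :=
  Classical.epsilon fun p => p ∈ C ∧ ∀ v ∈ C, norm2 (p - x) ≤ norm2 (v - x)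

/-- Monotonicity of a set-valued operator. -/
def IsMonotone {ι : Type*} [Fintype ι] (T : (ι → ℝ) → Set (ι → ℝ)) : Prop :=
  ∀ x y, ∀ u ∈ T x, ∀ v ∈ T y, 0 ≤ (u - v) ⬝ᵥ (x - y)

/-- Maximal monotonicity: the graph has no proper monotone extension. -/
def IsMaximallyMonotone {ι : Type*} [Fintype ι] (T : (ι → ℝ) → Set (ι → ℝ)) : Prop :=
  IsMonotone T ∧ ∀ x u, (∀ y, ∀ v ∈ T y, 0 ≤ (u - v) ⬝ᵥ (x - y)) → u ∈ T x

/-- The set-valued resolvent `(I + T)⁻¹`. -/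
def resolventSet {ι : Type*} (T : (ι → ℝ) → Set (ι → ℝ)) (x : ι → ℝ) : Set (ι → ℝ) :=
  {p | x - p ∈ T p}

/-- The resolvent `J_T = (I + T)⁻¹` as a map, for `T` whose resolvent is single-valued. -/
def resolvent {ι : Type*} (T : (ι → ℝ) → Set (ι → ℝ)) (x : ι → ℝ) : ι → ℝ :=
  Classical.epsilon fun p => p ∈ resolventSet T x

/-- The reflected resolvent `R_T = 2 J_T - I`. -/
def reflectedResolvent {ι : Type*} (T : (ι → ℝ) → Set (ι → ℝ)) (x : ι → ℝ) : ι → ℝ :=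
  (2 : ℝ) • resolvent T x - x

/-! ### The game -/

/-- Data of a stochastic generalized Nash game with `N` players. Player `i` has decision space
`ℝ^{n i}`, local feasible set `X i`, coupling matrix `A i`, and scenario-based objective
`J i (x_i; x_{-i}, s)`, written as a function of the collective vector `x`; its randomness is the
random vector `ξ i` on the space `(S i, μ i)`. -/
structure Game (N : ℕ) where
  /-- dimensions of the decisions -/
  n : Fin N → ℕ
  /-- number of coupling constraints -/
  m : ℕ
  /-- dimensions of the random vectors -/
  d : Fin N → ℕ
  X : ∀ i, Set (Fin (n i) → ℝ)
  A : ∀ i, Matrix (Fin m) (Fin (n i)) ℝ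
  c : Fin m → ℝ
  S : Fin N → Type*
  mS : ∀ i, MeasurableSpace (S i)
  μ : ∀ i, Measure (S i)
  ξ : ∀ i, S i → (Fin (d i) → ℝ)
  J : ∀ i, (Idx n → ℝ) → (Fin (d i) → ℝ) → ℝ

attribute [instance] Game.mS

namespace Game

variable {N : ℕ} (G : Game N)

/-- The expected-value objective `𝕁_i(x_i; x_{-i}) = E[J_i(x_i; x_{-i}, ξ_i)]`. -/
def EJ (i : Fin N) (x : Idx G.n → ℝ) : ℝ := ∫ s, G.J i x (G.ξ i s) ∂(G.μ i)

/-- The partial subdifferential `∂_{x_i} 𝕁_i(x_i; x_{-i})`. -/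
def partialSubdiff (i : Fin N) (x : Idx G.n → ℝ) : Set (Fin (G.n i) → ℝ) :=
  subdiff (fun v => G.EJ i (replaceBlock x i v)) (block x i)

/-- `𝒳 = ∏ 𝒳_i`. -/
def localFeasible : Set (Idx G.n → ℝ) := {x | ∀ i, block x i ∈ G.X i}

/-- `Ax = ∑ A_i x_i`. -/
def coupling (x : Idx G.n → ℝ) : Fin G.m → ℝ := ∑ i, G.A i *ᵥ block x i

/-- The collective feasible set `{x ∈ 𝒳 | Ax ≤ c}`. -/
def feasible : Set (Idx G.n → ℝ) := {x | x ∈ G.localFeasible ∧ ∀ r, G.coupling x r ≤ G.c r}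

/-- Variational stochastic generalized Nash equilibria. -/
def IsVSGNE (x : Idx G.n → ℝ) : Prop :=
  x ∈ G.feasible ∧ ∃ g : Idx G.n → ℝ, (∀ i, block g i ∈ G.partialSubdiff i x) ∧
    ∀ z ∈ G.feasible, 0 ≤ (z - x) ⬝ᵥ g

/-- The pseudogradient `F`. -/
def pseudograd (x : Idx G.n → ℝ) : Set (Idx G.n → ℝ) :=
  {u | ∀ i, block u i ∈ G.partialSubdiff i x}

/-- The augmented decision vector `y_i` (own decision and estimates) of player `i`. -/
def aug (y : Fin N × Idx G.n → ℝ) (i : Fin N) : Idx G.n → ℝ := fun p => y (i, p)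

/-- The extended pseudogradient. -/
def extPseudograd (y : Fin N × Idx G.n → ℝ) : Set (Idx G.n → ℝ) :=
  {u | ∀ i, block u i ∈ G.partialSubdiff i (G.aug y i)}

/-- Scenario-based objectives: well-defined expected values; for each fixed sample, continuity in the
collective decision and convexity in the own decision. (The objectives are real-valued, hence proper.) -/
structure ScenarioObjectives : Prop where
  prob : ∀ i, IsProbabilityMeasure (G.μ i)
  meas : ∀ i, Measurable (G.ξ i)
  integrable : ∀ i x, Integrable (fun s => G.J i x (G.ξ i s)) (G.μ i)
  cont : ∀ i s, Continuous fun x => G.J i x (G.ξ i s)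
  convex : ∀ i s x, ConvexOn ℝ Set.univ fun v => G.J i (replaceBlock x i v) (G.ξ i s)

/-- The Mangasarian-Fromovitz constraint qualification for the constraints `x ∈ 𝒳`, `Ax ≤ c`: at each
feasible point some direction tangent to `𝒳` strictly decreases all active coupling constraints. -/
def MFCQ : Prop :=
  ∀ x ∈ G.feasible, ∃ v ∈ posTangentConeAt G.localFeasible x,
    ∀ r, G.coupling x r = G.c r → G.coupling v r < 0

/-- Feasible sets. -/
structure FeasibleSets : Prop where
  nonempty : ∀ i, (G.X i).Nonempty
  compact : ∀ i, IsCompact (G.X i)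
  convex : ∀ i, Convex ℝ (G.X i)
  feasible_nonempty : G.feasible.Nonempty
  mfcq : G.MFCQ

end Game

/-! ### Communication network, step sizes and operators -/

/-- Design data: the edges of the communication graph (the edge `(j, i)` has tail `j` and head `i`),
the parameters `ρ_μ, ρ_z`, the splitting `c_i` of `c`, the corners of the boxes `𝒳_i^B`,
and the step sizes (`τ₁, τ₂` on players, `τ₃, τ₄` on edges). -/
structure Setup {N : ℕ} (G : Game N) where
  E : Finset (Fin N × Fin N)
  ρμ : ℝ
  ρz : ℝ
  cloc : Fin N → Fin G.m → ℝ
  lo : ∀ i, Fin (G.n i) → ℝ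
  hi : ∀ i, Fin (G.n i) → ℝ
  τ₁ : Fin N → ℝ
  τ₂ : Fin N → ℝ
  τ₃ : E → ℝ
  τ₄ : E → ℝ

namespace Setup

variable {N : ℕ} {G : Game N} (S : Setup G)

/-- Index sets of the stacked variables `𝐲`, `𝛌`, `𝛍`, `𝐳`, and of `ψ = [𝐲; 𝛌; 𝛍; 𝐳]`. -/
abbrev YI (_S : Setup G) : Type := Fin N × Idx G.n
abbrev LI (_S : Setup G) : Type := Fin N × Fin G.m
abbrev MI : Type := S.E × Idx G.n
abbrev ZI : Type := S.E × Fin G.m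
abbrev PI : Type := (S.YI ⊕ S.LI) ⊕ (S.MI ⊕ S.ZI)

def yPart (ψ : S.PI → ℝ) : S.YI → ℝ := fun q => ψ (Sum.inl (Sum.inl q))
def lPart (ψ : S.PI → ℝ) : S.LI → ℝ := fun q => ψ (Sum.inl (Sum.inr q))
def mPart (ψ : S.PI → ℝ) : S.MI → ℝ := fun q => ψ (Sum.inr (Sum.inl q))
def zPart (ψ : S.PI → ℝ) : S.ZI → ℝ := fun q => ψ (Sum.inr (Sum.inr q))

/-- `[𝐲; 𝛌; 𝛍; 𝐳]`. -/
def stack (y : S.YI → ℝ) (l : S.LI → ℝ) (μ : S.MI → ℝ) (z : S.ZI → ℝ) : S.PI → ℝ :=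
  Sum.elim (Sum.elim y l) (Sum.elim μ z)

/-- The incidence matrix `B`. -/
def B : Matrix (Fin N) S.E ℝ :=
  Matrix.of fun i e => (if e.1.2 = i then 1 else 0) - (if e.1.1 = i then 1 else 0)

/-- The Laplacian `L = B Bᵀ`. -/
def L : Matrix (Fin N) (Fin N) ℝ := S.B * S.Bᵀ

def Bn : Matrix S.YI S.MI ℝ := S.B ⊗ₖ (1 : Matrix (Idx G.n) (Idx G.n) ℝ)
def Ln : Matrix S.YI S.YI ℝ := S.L ⊗ₖ (1 : Matrix (Idx G.n) (Idx G.n) ℝ)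
def Bm : Matrix S.LI S.ZI ℝ := S.B ⊗ₖ (1 : Matrix (Fin G.m) (Fin G.m) ℝ)
def Lm : Matrix S.LI S.LI ℝ := S.L ⊗ₖ (1 : Matrix (Fin G.m) (Fin G.m) ℝ)

/-- The selection matrix `ℛ`, with `ℛ 𝐲 = [y_i^i]_i`. -/
def R : Matrix (Idx G.n) S.YI ℝ := Matrix.of fun p q => if q = (p.1, p) then 1 else 0

/-- `Λ = blkd(A_1, ..., A_N)`. -/
def Lam : Matrix S.LI (Idx G.n) ℝ :=
  Matrix.of fun q p => if p.1 = q.1 then G.A p.1 q.2 p.2 else 0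

def D : Matrix S.PI S.PI ℝ :=
  Matrix.fromBlocks
    (Matrix.fromBlocks ((S.ρμ / 2) • S.Ln) ((1 / 2 : ℝ) • (S.Lam * S.R)ᵀ)
      (-((1 / 2 : ℝ) • (S.Lam * S.R))) ((S.ρz / 2) • S.Lm))
    (Matrix.fromBlocks ((1 / 2 : ℝ) • S.Bn) 0 0 ((1 / 2 : ℝ) • S.Bm))
    (Matrix.fromBlocks (-((1 / 2 : ℝ) • S.Bnᵀ)) 0 0 (-((1 / 2 : ℝ) • S.Bmᵀ)))
    0

/-- The design matrix `Φ`. -/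
def Phi : Matrix S.PI S.PI ℝ :=
  Matrix.fromBlocks
    (Matrix.fromBlocks
      (Matrix.diagonal (fun q : S.YI => (S.τ₁ q.1)⁻¹) - (S.ρμ / 2) • S.Ln)
      (-((1 / 2 : ℝ) • (S.Lam * S.R)ᵀ))
      (-((1 / 2 : ℝ) • (S.Lam * S.R)))
      (Matrix.diagonal (fun q : S.LI => (S.τ₂ q.1)⁻¹) - (S.ρz / 2) • S.Lm))
    (Matrix.fromBlocks (-((1 / 2 : ℝ) • S.Bn)) 0 0 (-((1 / 2 : ℝ) • S.Bm)))
    (Matrix.fromBlocks (-((1 / 2 : ℝ) • S.Bnᵀ)) 0 0 (-((1 / 2 : ℝ) • S.Bmᵀ)))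
    (Matrix.fromBlocks (Matrix.diagonal fun q : S.MI => (S.τ₃ q.1)⁻¹) 0 0
      (Matrix.diagonal fun q : S.ZI => (S.τ₄ q.1)⁻¹))

/-- The norm of the inner product space `𝒦`, `⟨ψ₁, ψ₂⟩ = ψ₁ᵀ Φ ψ₂`. -/
def normK (ψ : S.PI → ℝ) : ℝ := Real.sqrt (ψ ⬝ᵥ (S.Phi *ᵥ ψ))

/-- The box `𝒳_i^B`. -/
def box (i : Fin N) : Set (Fin (G.n i) → ℝ) := Set.Icc (S.lo i) (S.hi i)

/-- `ℝ^{n_{<i}} × 𝒳_i × ℝ^{n_{>i}}`. -/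
def extX (_S : Setup G) (i : Fin N) : Set (Idx G.n → ℝ) := {x | block x i ∈ G.X i}

/-- The product of the `extX i`. -/
def hatX : Set (S.YI → ℝ) := {y | ∀ i, G.aug y i ∈ S.extX i}

/-- The extended box set. -/
def hatXB : Set (S.YI → ℝ) := {y | ∀ i, block (G.aug y i) i ∈ S.box i}

/-- The operator `𝔸`. -/
def opA (ψ : S.PI → ℝ) : Set (S.PI → ℝ) :=
  {w | ∃ g ∈ G.extPseudograd (S.yPart ψ), ∃ ν ∈ normalCone S.hatXB (S.yPart ψ),
    w = S.D *ᵥ ψ + S.stack (S.Rᵀ *ᵥ g + ν) (fun q => S.cloc q.1 q.2) 0 0}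

/-- The operator `𝔹`. -/
def opB (ψ : S.PI → ℝ) : Set (S.PI → ℝ) :=
  {w | ∃ ν ∈ normalCone S.hatX (S.yPart ψ),
    ∃ η ∈ normalCone {l : S.LI → ℝ | ∀ q, 0 ≤ l q} (S.lPart ψ),
    w = S.D *ᵥ ψ + S.stack ν η 0 0}

/-- `Φ⁻¹ T` for a set-valued operator `T` (with `Φ` invertible). -/
def precond (T : (S.PI → ℝ) → Set (S.PI → ℝ)) (ψ : S.PI → ℝ) : Set (S.PI → ℝ) :=
  {u | S.Phi *ᵥ u ∈ T ψ}

/-- `J` and `R` for `Φ⁻¹𝔸` and `Φ⁻¹𝔹`. -/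
def JA : (S.PI → ℝ) → (S.PI → ℝ) := resolvent (S.precond S.opA)
def RA : (S.PI → ℝ) → (S.PI → ℝ) := reflectedResolvent (S.precond S.opA)
def RB : (S.PI → ℝ) → (S.PI → ℝ) := reflectedResolvent (S.precond S.opB)

/-- The exact operator `ℛ_* = R_B ∘ R_A`. -/
def Rstar : (S.PI → ℝ) → (S.PI → ℝ) := S.RB ∘ S.RA

/-- Communicability: no self-loops, and the underlying undirected graph is connected. -/
structure Communicable : Prop where
  noLoop : ∀ i, (i, i) ∉ S.E
  connected : (SimpleGraph.fromRel fun i j => (i, j) ∈ S.E).Connected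

/-- First convergence condition: `ℛᵀ𝔽 + (ρ_μ/2) L_n` is maximally monotone. -/
def ConvergenceI : Prop :=
  IsMaximallyMonotone fun y : S.YI → ℝ =>
    {w | ∃ g ∈ G.extPseudograd y, w = S.Rᵀ *ᵥ g + (S.ρμ / 2) • (S.Ln *ᵥ y)}

/-- Second convergence condition: strongly monotone and Lipschitz pseudogradient, Lipschitz extended
pseudogradient, and `ρ_μ` large relative to the smallest positive eigenvalue of `L`. -/
def ConvergenceII : Prop :=
  ∃ η θ₁ θ₂ : ℝ, 0 < η ∧ 0 < θ₁ ∧ 0 < θ₂ ∧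
    (∀ x x', ∀ u ∈ G.pseudograd x, ∀ u' ∈ G.pseudograd x',
      η * norm2 (x - x') ^ 2 ≤ (x - x') ⬝ᵥ (u - u') ∧
      norm2 (u - u') ≤ θ₁ * norm2 (x - x')) ∧
    (∀ y y' : S.YI → ℝ, ∀ u ∈ G.extPseudograd y, ∀ u' ∈ G.extPseudograd y',
      norm2 (u - u') ≤ θ₂ * norm2 (y - y')) ∧
    ∀ σ₁ : ℝ, IsLeast {σ : ℝ | 0 < σ ∧ Module.End.HasEigenvalue (Matrix.toLin' S.L) σ} σ₁ →
      2 / σ₁ * ((θ₁ + θ₂) ^ 2 / (4 * η) + θ₂) ≤ S.ρμ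

/-- Admissible design parameters: nonnegative weights, `∑ c_i = c`, boxes containing the local feasible
sets, positive step sizes, and a positive definite design matrix. -/
structure Admissible : Prop where
  ρμ_nonneg : 0 ≤ S.ρμ
  ρz_nonneg : 0 ≤ S.ρz
  sum_cloc : ∑ i, S.cloc i = G.c
  subset_box : ∀ i, G.X i ⊆ S.box i
  τ₁_pos : ∀ i, 0 < S.τ₁ i
  τ₂_pos : ∀ i, 0 < S.τ₂ i
  τ₃_pos : ∀ e, 0 < S.τ₃ e
  τ₄_pos : ∀ e, 0 < S.τ₄ e
  posDef : S.Phi.PosDef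

/-! ### The algorithm -/

/-- `∑_{j neighbour of i} (v_i - v_j)`, summed over the edges entering and leaving `i`. -/
def nbrDiff {κ : Type*} (v : Fin N × κ → ℝ) (i : Fin N) : κ → ℝ := fun a =>
  (∑ j ∈ Finset.univ.filter (fun j => (j, i) ∈ S.E), (v (i, a) - v (j, a))) +
    ∑ j ∈ Finset.univ.filter (fun j => (i, j) ∈ S.E), (v (i, a) - v (j, a))

/-- `∑_{j in-neighbour} u_{ji} - ∑_{j out-neighbour} u_{ij}`. -/
def edgeFlow {κ : Type*} (u : S.E × κ → ℝ) (i : Fin N) : κ → ℝ := fun a =>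
  (∑ e ∈ Finset.univ.filter (fun e : S.E => e.1.2 = i), u (e, a)) -
    ∑ e ∈ Finset.univ.filter (fun e : S.E => e.1.1 = i), u (e, a)

/-- Update of the local estimates; only the blocks `j ≠ i` of the result are used:
`y_i^{-i} = ỹ_i^{-i} - (τ_{1i}/2) (ρ_μ ỹ_{iL}^{-i} + μ̃_{iB}^{-i})`. -/
def estUpdate (ψ : S.PI → ℝ) (i : Fin N) : Idx G.n → ℝ :=
  G.aug (S.yPart ψ) i -
    (S.τ₁ i / 2) • (S.ρμ • S.nbrDiff (S.yPart ψ) i + S.edgeFlow (S.mPart ψ) i)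

/-- `φ̃_i = ½ (A_iᵀ λ̃_i + μ̃_{iB}^i + ρ_μ ỹ_{iL}^i)`. -/
def phiTilde (ψ : S.PI → ℝ) (i : Fin N) : Fin (G.n i) → ℝ :=
  (1 / 2 : ℝ) • ((G.A i)ᵀ *ᵥ (fun r => S.lPart ψ (i, r)) +
    block (S.edgeFlow (S.mPart ψ) i) i + S.ρμ • block (S.nbrDiff (S.yPart ψ) i) i)

/-- The own decision `ỹ_i^i`. -/
def ownDecision (ψ : S.PI → ℝ) (i : Fin N) : Fin (G.n i) → ℝ := block (G.aug (S.yPart ψ) i) i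

/-- The augmented objective `f(v; y_i^{-i}) + φ̃_iᵀ v + ‖v - ỹ_i^i‖² / (2 τ_{1i})` built from `f`. -/
def augmented (f : (Idx G.n → ℝ) → ℝ) (ψ : S.PI → ℝ) (i : Fin N) (v : Fin (G.n i) → ℝ) : ℝ :=
  f (replaceBlock (S.estUpdate ψ i) i v) + S.phiTilde ψ i ⬝ᵥ v +
    1 / (2 * S.τ₁ i) * norm2 (v - S.ownDecision ψ i) ^ 2

/-- Augmented scenario-based objective at the sample value `s`. -/
def augScenario (ψ : S.PI → ℝ) (i : Fin N) (s : Fin (G.d i) → ℝ) : (Fin (G.n i) → ℝ) → ℝ :=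
  S.augmented (fun x => G.J i x s) ψ i

/-- Augmented expected-value objective. -/
def augExpected (ψ : S.PI → ℝ) (i : Fin N) : (Fin (G.n i) → ℝ) → ℝ :=
  S.augmented (G.EJ i) ψ i

/-- The minor iterates of the projected stochastic subgradient solver of player `i`, started at
`ỹ_i^i` and using the stochastic subgradients `g 0, g 1, ...` with step sizes `2 τ_{1i} / (t + 2)`. -/
def minor (ψ : S.PI → ℝ) (i : Fin N) (g : ℕ → Fin (G.n i) → ℝ) : ℕ → Fin (G.n i) → ℝ
  | 0 => S.ownDecision ψ i
  | t + 1 => proj (S.box i) (minor ψ i g t - (2 * S.τ₁ i / ((t : ℝ) + 2)) • g t)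

/-- The vector `ψ^{(k+1)}` computed from `ψ̃^{(k)}` by the first player loop and the first edge loop,
with `T i` minor steps of player `i`. -/
def approxJA (ψ : S.PI → ℝ) (T : Fin N → ℕ) (g : ∀ i, ℕ → Fin (G.n i) → ℝ) : S.PI → ℝ :=
  let y : S.YI → ℝ := fun q =>
    replaceBlock (S.estUpdate ψ q.1) q.1 (S.minor ψ q.1 (g q.1) (T q.1)) q.2
  let l : S.LI → ℝ := fun q => S.lPart ψ q + S.τ₂ q.1 *
    ((G.A q.1 *ᵥ (block (G.aug y q.1) q.1 - (1 / 2 : ℝ) • S.ownDecision ψ q.1)) q.2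
      - S.ρz / 2 * S.nbrDiff (S.lPart ψ) q.1 q.2
      - 1 / 2 * S.edgeFlow (S.zPart ψ) q.1 q.2 - S.cloc q.1 q.2)
  let yh : S.YI → ℝ := (2 : ℝ) • y - S.yPart ψ
  let lh : S.LI → ℝ := (2 : ℝ) • l - S.lPart ψ
  let μ : S.MI → ℝ := fun q => S.mPart ψ q +
    S.τ₃ q.1 / 2 * (yh (q.1.1.2, q.2) - yh (q.1.1.1, q.2))
  let z : S.ZI → ℝ := fun q => S.zPart ψ q +
    S.τ₄ q.1 / 2 * (lh (q.1.1.2, q.2) - lh (q.1.1.1, q.2))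
  S.stack y l μ z

/-- The vector `ψ̄^{(k+1)}` computed from `ψ̂^{(k+1)}` by the second player loop and the second edge
loop. -/
def barStep (ψh : S.PI → ℝ) : S.PI → ℝ :=
  let y : S.YI → ℝ := fun q => proj (S.extX q.1)
    (G.aug (S.yPart ψh) q.1 - (S.τ₁ q.1 / 2) •
      ((fun p => (S.Rᵀ *ᵥ (S.Lamᵀ *ᵥ S.lPart ψh)) (q.1, p)) +
        S.ρμ • S.nbrDiff (S.yPart ψh) q.1 + S.edgeFlow (S.mPart ψh) q.1)) q.2
  let l : S.LI → ℝ := fun q => proj {w : Fin G.m → ℝ | ∀ r, 0 ≤ w r}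
    (fun r => S.lPart ψh (q.1, r) + S.τ₂ q.1 *
      ((G.A q.1 *ᵥ (block (G.aug y q.1) q.1 - (1 / 2 : ℝ) • S.ownDecision ψh q.1)) r
        - S.ρz / 2 * S.nbrDiff (S.lPart ψh) q.1 r
        - 1 / 2 * S.edgeFlow (S.zPart ψh) q.1 r)) q.2
  let μ : S.MI → ℝ := fun q => S.mPart ψh q + S.τ₃ q.1 *
    ((y (q.1.1.2, q.2) - y (q.1.1.1, q.2)) -
      1 / 2 * (S.yPart ψh (q.1.1.2, q.2) - S.yPart ψh (q.1.1.1, q.2)))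
  let z : S.ZI → ℝ := fun q => S.zPart ψh q + S.τ₄ q.1 *
    ((l (q.1.1.2, q.2) - l (q.1.1.1, q.2)) -
      1 / 2 * (S.lPart ψh (q.1.1.2, q.2) - S.lPart ψh (q.1.1.1, q.2)))
  S.stack y l μ z

end Setup

/-- Data of a run: relaxation parameters `γ^{(k)}`, numbers `T_i^{(k)}` of minor steps, random initial
point, samples `ξ_{i,t}^{(k)}`, and stochastic subgradients `g_{i,t}^{(k)}`. -/
structure Run {N : ℕ} {G : Game N} (S : Setup G) (Ω : Type*) where
  γ : ℕ → ℝ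
  T : ℕ → Fin N → ℕ
  ψ₀ : Ω → S.PI → ℝ
  ξ : ℕ → ∀ i : Fin N, ℕ → Ω → (Fin (G.d i) → ℝ)
  g : ℕ → ∀ i : Fin N, ℕ → Ω → (Fin (G.n i) → ℝ)

namespace Run

variable {N : ℕ} {G : Game N} {S : Setup G} {Ω : Type*} (r : Run S Ω)

/-- One major iteration: `ψ̃ + 2γ (ψ̄ - ψ)` with `ψ̄` computed from `ψ̂ = 2ψ - ψ̃`. -/
def step (k : ℕ) (ω : Ω) (ψt : S.PI → ℝ) : S.PI → ℝ :=
  let ψ := S.approxJA ψt (r.T k) (fun i t => r.g k i t ω)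
  ψt + (2 * r.γ k) • (S.barStep ((2 : ℝ) • ψ - ψt) - ψ)

/-- The sequence `ψ̃^{(k)}` generated by the algorithm. -/
def iter (ω : Ω) : ℕ → S.PI → ℝ
  | 0 => r.ψ₀ ω
  | k + 1 => r.step k ω (iter ω k)

/-- The minor iterate `y_{i,t}^{i(k+1)}`. -/
def minorIter (k : ℕ) (i : Fin N) (t : ℕ) (ω : Ω) : Fin (G.n i) → ℝ :=
  S.minor (r.iter ω k) i (fun s => r.g k i s ω) t

/-- The inexact reflected resolvent at `ψ̃^{(k)}`, that is `ψ̂^{(k+1)} = 2ψ^{(k+1)} - ψ̃^{(k)}`. -/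
def approxRA (k : ℕ) (ω : Ω) : S.PI → ℝ :=
  (2 : ℝ) • S.approxJA (r.iter ω k) (r.T k) (fun i t => r.g k i t ω) - r.iter ω k

/-- The error `ε^{(k)} = ‖ℛ(ψ̃^{(k)}) - ℛ_*(ψ̃^{(k)})‖_𝒦`. -/
def err (k : ℕ) (ω : Ω) : ℝ :=
  S.normK (S.RB (r.approxRA k ω) - S.Rstar (r.iter ω k))

/-- The σ-field `ℱ_k` generated by the initial point and all samples of the major iterations `< k`. -/
abbrev F (k : ℕ) : MeasurableSpace Ω :=
  MeasurableSpace.comap r.ψ₀ inferInstance ⊔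
    ⨆ (j : ℕ) (_ : j < k) (i : Fin N) (t : ℕ) (_ : t < r.T j i),
      MeasurableSpace.comap (r.ξ j i t) inferInstance

/-- The σ-field `σ{ℱ_k, ξ_{i,0}^{(k)}, ..., ξ_{i,t-1}^{(k)}}`. -/
abbrev Fminor (k : ℕ) (i : Fin N) (t : ℕ) : MeasurableSpace Ω :=
  r.F k ⊔ ⨆ (s : ℕ) (_ : s < t), MeasurableSpace.comap (r.ξ k i s) inferInstance

/-- The run consists of random vectors, performs at least one minor step per player and major
iteration, and each stochastic subgradient is computed from the information available at its step. -/
structure WellFormed [MeasurableSpace Ω] : Prop where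
  T_pos : ∀ k i, 1 ≤ r.T k i
  meas_ψ₀ : Measurable r.ψ₀
  meas_ξ : ∀ k i t, t < r.T k i → Measurable (r.ξ k i t)
  meas_g : ∀ k i t, t < r.T k i → Measurable[r.Fminor k i (t + 1)] (r.g k i t)

/-- The stochastic subgradients: they are subgradients of the augmented scenario-based objectives at the
current minor iterates, have finite second moments (so that the conditional expectations below are
meaningful), are conditionally unbiased, and have conditionally bounded second moments. -/
structure StochasticSubgradients [MeasurableSpace Ω] (P : Measure Ω) : Prop where
  memLp : ∀ k i t, t < r.T k i → MemLp (r.g k i t) 2 P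
  subgradient : ∀ k i t, t < r.T k i → ∀ᵐ ω ∂P,
    r.g k i t ω ∈ subdiff (S.augScenario (r.iter ω k) i (r.ξ k i t ω)) (r.minorIter k i t ω)
  unbiased : ∀ k i t, t < r.T k i → ∀ᵐ ω ∂P,
    (P[r.g k i t | r.Fminor k i t]) ω ∈
      subdiff (S.augExpected (r.iter ω k) i) (r.minorIter k i t ω)
  variance : ∀ i, ∃ α β : ℝ, 0 < α ∧ 0 < β ∧ ∀ k t, t < r.T k i → ∀ᵐ ω ∂P,
    (P[fun ω' => norm2 (r.g k i t ω') ^ 2 | r.F k]) ω ≤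
      α ^ 2 * norm2 (r.iter ω k) ^ 2 + β ^ 2

/-- `γ_T^{(k)} = γ^{(k)} (min_i T_i^{(k)})^{-1/2}`. -/
def γT (k : ℕ) : ℝ := r.γ k * ((⨅ i, r.T k i : ℕ) : ℝ) ^ (-(1 / 2) : ℝ)

end Run

end

end SGNE

/-! The algorithm is an inexact relaxed Peaceman–Rachford splitting for `0 ∈ 𝔸ψ + 𝔹ψ` in the metric
of `Φ`; only the evaluation of `J_A` is inexact. The proof combines four facts.

Zeros of `𝔸 + 𝔹` are equilibria. The `μ` and `z` rows force `y` and `λ` to be consensual. Pairing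
the other two rows with consensual vectors sums them over the players and kills every Laplacian and
incidence term, leaving the KKT conditions of the variational inequality (`isVSGNE_of_zero`).
Conversely, MFCQ gives a Slater point, Hahn–Banach then gives multipliers, and connectedness lets
`z` absorb the differences between players (`exists_zero_of_isVSGNE`). Such zeros are the values of
`J_A` at the fixed points of `R_B ∘ R_A`.

Both resolvents are explicit. `Φ` is chosen so that `Φ + D` is block lower triangular, hence `Φ(ψ -
p) ∈ Tp` is solved by forward substitution (`Phi_mulVec_sub_eq_iff`). For `𝔹` this is a chain of
projections, which is literally the second step of the algorithm. For `𝔸` it leaves one strongly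
convex problem per player, whose solution is `decision`; everything else is an affine function of it
(`completeStep`).

The exact map is continuous and quasi-nonexpansive. The skew part of `D` drops out of the quadratic
form, and `𝔹` is monotone. Under the second convergence condition `𝔸` is shown to be monotone only
between an arbitrary point and a consensual one: the strong monotonicity handles the average, the
spectral gap of `L` the disagreement (`ConvergenceII.pairMonotone`). This suffices, because the
points `J_A ψ` at fixed points `ψ` are consensual (`normK_Rstar_le`). Continuity of `J_A` is then a
separate argument. A Krasnosel'skii–Mann iteration of such a map converges in finite dimension as
soon as `∑ γ_k ε_k < ∞` (`krasnoselskii_mann`).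

The errors are summable almost surely. The projected stochastic subgradient method on a strongly
convex problem has conditional mean square error `O(1/T)`, so `E[ε_k | F_k] ≤ C (‖ψ̃_k‖ + 1)
T_k^{-1/2}` (`exists_condExp_err_le`). The factor `‖ψ̃_k‖` is itself driven by the earlier errors,
and a discrete Grönwall inequality closes the loop. As the initial point need not be integrable,
this is done on events of `F_0` where it is bounded, and these events exhaust the space
(`ae_restrict_summable`, `ae_summable_err`). Boundedness of the iterates and summability of the
conditional errors are then read off from convergence. -/

namespace SGNE

/-! ### Euclidean norm, projections, subgradients and proximal steps. -/

section ConvexAnalysis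

variable {ι : Type*} [Fintype ι]

theorem norm2_sq (v : ι → ℝ) : norm2 v ^ 2 = v ⬝ᵥ v := by
  rw [norm2, EuclideanSpace.norm_sq_eq]
  simp [dotProduct, sq]

theorem norm2_nonneg (v : ι → ℝ) : 0 ≤ norm2 v := norm_nonneg _

theorem norm2_add_le (v w : ι → ℝ) : norm2 (v + w) ≤ norm2 v + norm2 w := by
  simpa [norm2] using norm_add_le (WithLp.toLp 2 v) (WithLp.toLp 2 w)

theorem norm2_smul (a : ℝ) (v : ι → ℝ) : norm2 (a • v) = |a| * norm2 v := by
  simpa [norm2] using norm_smul a (WithLp.toLp 2 v)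

theorem norm2_neg (v : ι → ℝ) : norm2 (-v) = norm2 v := by
  simp [norm2]

theorem norm2_sub_comm (v w : ι → ℝ) : norm2 (v - w) = norm2 (w - v) := by
  rw [← norm2_neg, neg_sub]

theorem norm2_zero : norm2 (0 : ι → ℝ) = 0 := by simp [norm2]

theorem norm2_eq_zero {v : ι → ℝ} : norm2 v = 0 ↔ v = 0 := by simp [norm2]

theorem continuous_norm2 : Continuous (norm2 : (ι → ℝ) → ℝ) := by
  unfold norm2
  fun_prop

theorem inner_toLp (v w : ι → ℝ) :
    inner ℝ (WithLp.toLp 2 v) (WithLp.toLp 2 w) = v ⬝ᵥ w := by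
  simp [PiLp.inner_apply, dotProduct, mul_comm]

theorem abs_dotProduct_le (v w : ι → ℝ) : |v ⬝ᵥ w| ≤ norm2 v * norm2 w := by
  rw [← inner_toLp]
  exact abs_real_inner_le_norm _ _

theorem dotProduct_le_norm2 (v w : ι → ℝ) : v ⬝ᵥ w ≤ norm2 v * norm2 w :=
  (le_abs_self _).trans (abs_dotProduct_le v w)

theorem neg_norm2_le_dotProduct (v w : ι → ℝ) : -(norm2 v * norm2 w) ≤ v ⬝ᵥ w :=
  neg_le_of_abs_le (abs_dotProduct_le v w)

theorem norm2_add_sq (v w : ι → ℝ) :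
    norm2 (v + w) ^ 2 = norm2 v ^ 2 + 2 * (v ⬝ᵥ w) + norm2 w ^ 2 := by
  simp only [norm2_sq, add_dotProduct, dotProduct_add, dotProduct_comm w v]
  ring

theorem norm2_sub_sq (v w : ι → ℝ) :
    norm2 (v - w) ^ 2 = norm2 v ^ 2 - 2 * (v ⬝ᵥ w) + norm2 w ^ 2 := by
  simp only [norm2_sq, sub_dotProduct, dotProduct_sub, dotProduct_comm w v]
  ring

theorem norm_le_norm2 (v : ι → ℝ) : ‖v‖ ≤ norm2 v := by
  refine (pi_norm_le_iff_of_nonneg (norm2_nonneg v)).2 fun i => ?_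
  simpa [norm2] using PiLp.norm_apply_le (WithLp.toLp 2 v) i

theorem exists_norm2_le_mul_norm (ι : Type*) [Fintype ι] :
    ∃ C : ℝ, 0 < C ∧ ∀ v : ι → ℝ, norm2 v ≤ C * ‖v‖ := by
  refine ⟨Fintype.card ι + 1, by positivity, fun v => ?_⟩
  have h : norm2 v ^ 2 ≤ ((Fintype.card ι + 1) * ‖v‖) ^ 2 := by
    rw [norm2_sq]
    have h1 : v ⬝ᵥ v ≤ Fintype.card ι * ‖v‖ ^ 2 := by
      calc v ⬝ᵥ v ≤ ∑ _i : ι, ‖v‖ ^ 2 := Finset.sum_le_sum fun i _ => by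
            rw [← sq, ← sq_abs]
            exact pow_le_pow_left₀ (abs_nonneg _) (norm_le_pi_norm v i) 2
        _ = _ := by simp
    have : (0 : ℝ) ≤ Fintype.card ι := by positivity
    nlinarith [sq_nonneg ‖v‖, mul_nonneg this (sq_nonneg ‖v‖),
      mul_nonneg (mul_nonneg this this) (sq_nonneg ‖v‖)]
  exact (pow_le_pow_iff_left₀ (norm2_nonneg _) (by positivity) two_ne_zero).1 h

/-- The variational characterization of the projection. -/
theorem isNearest_iff {C : Set (ι → ℝ)} (hC : Convex ℝ C) {x p : ι → ℝ} (hp : p ∈ C) :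
    (∀ v ∈ C, norm2 (p - x) ≤ norm2 (v - x)) ↔ ∀ v ∈ C, (x - p) ⬝ᵥ (v - p) ≤ 0 := by
  constructor
  · intro h v hv
    by_contra! hlt
    have key : ∀ t : ℝ, 0 < t → t ≤ 1 →
        2 * ((x - p) ⬝ᵥ (v - p)) ≤ t * norm2 (v - p) ^ 2 := by
      intro t ht ht1
      have hm : p + t • (v - p) ∈ C := hC.add_smul_sub_mem hp hv ⟨ht.le, ht1⟩
      have h1 := pow_le_pow_left₀ (norm2_nonneg _) (h _ hm) 2
      have h2 : p + t • (v - p) - x = t • (v - p) - (x - p) := by abel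
      rw [h2, norm2_sub_comm p x, norm2_sub_sq (t • _), norm2_smul, smul_dotProduct, mul_pow, sq_abs,
        smul_eq_mul, dotProduct_comm (v - p)] at h1
      have h3 : t * (2 * ((x - p) ⬝ᵥ (v - p))) ≤ t * (t * norm2 (v - p) ^ 2) := by linarith
      exact le_of_mul_le_mul_left h3 ht
    set a := (x - p) ⬝ᵥ (v - p)
    set b := norm2 (v - p) ^ 2
    have hb : 0 ≤ b := sq_nonneg _
    -- For this `t` one has `t * b ≤ a`, so `key` would give `2 * a ≤ a` with `a > 0`.
    have h1 := key (min 1 (a / (b + 1))) (by positivity) (min_le_left _ _)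
    have h2 : min 1 (a / (b + 1)) * b ≤ a / (b + 1) * b := by gcongr; exact min_le_right _ _
    have h3 : a / (b + 1) * b ≤ a := by
      rw [div_mul_eq_mul_div, div_le_iff₀ (by positivity)]
      nlinarith
    linarith
  · intro h v hv
    have h1 : norm2 (p - x) ^ 2 ≤ norm2 (v - x) ^ 2 := by
      have h2 : v - x = (v - p) - (x - p) := by abel
      rw [h2, norm2_sub_comm p x, norm2_sub_sq (v - p), dotProduct_comm]
      nlinarith [h v hv, sq_nonneg (norm2 (v - p))]
    exact (pow_le_pow_iff_left₀ (norm2_nonneg _) (norm2_nonneg _) two_ne_zero).1 h1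

theorem exists_nearest {C : Set (ι → ℝ)} (hcl : IsClosed C) (hne : C.Nonempty) (x : ι → ℝ) :
    ∃ p ∈ C, ∀ v ∈ C, norm2 (p - x) ≤ norm2 (v - x) := by
  obtain ⟨c, hc⟩ := hne
  have hcont : ContinuousOn (fun v => norm2 (v - x)) C :=
    (continuous_norm2.comp (continuous_id.sub continuous_const)).continuousOn
  refine hcont.exists_isMinOn' hcl hc ?_
  refine Filter.Eventually.filter_mono inf_le_left ?_
  have : Tendsto (fun v : ι → ℝ => norm2 (v - x)) (cocompact _) atTop := by
    refine tendsto_atTop_mono (fun v => norm_le_norm2 (v - x)) ?_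
    exact tendsto_norm_cocompact_atTop.comp (Homeomorph.subRight x).isClosedEmbedding.tendsto_cocompact
  exact this.eventually_ge_atTop _

theorem proj_spec {C : Set (ι → ℝ)} (hC : Convex ℝ C) (hcl : IsClosed C) (hne : C.Nonempty)
    (x : ι → ℝ) : proj C x ∈ C ∧ ∀ v ∈ C, (x - proj C x) ⬝ᵥ (v - proj C x) ≤ 0 := by
  obtain ⟨p, hp, hp'⟩ := exists_nearest hcl hne x
  have h : proj C x ∈ C ∧ ∀ v ∈ C, norm2 (proj C x - x) ≤ norm2 (v - x) :=
    Classical.epsilon_spec (p := fun p => p ∈ C ∧ ∀ v ∈ C, norm2 (p - x) ≤ norm2 (v - x))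
      ⟨p, hp, hp'⟩
  exact ⟨h.1, (isNearest_iff hC h.1).1 h.2⟩

/-- Testing each inequality at the other point and adding gives `‖p - q‖² ≤ (x - y) ⬝ᵥ (p - q)`;
Cauchy–Schwarz finishes. -/
theorem norm2_sub_le_of_variational {C : Set (ι → ℝ)} {x y p q : ι → ℝ} (hp : p ∈ C)
    (hq : q ∈ C) (hp' : ∀ v ∈ C, (x - p) ⬝ᵥ (v - p) ≤ 0)
    (hq' : ∀ v ∈ C, (y - q) ⬝ᵥ (v - q) ≤ 0) : norm2 (p - q) ≤ norm2 (x - y) := by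
  have h1 := hp' q hq
  have h2 := hq' p hp
  have h3 : norm2 (p - q) ^ 2 ≤ (x - y) ⬝ᵥ (p - q) := by
    rw [norm2_sq]
    simp only [sub_dotProduct, dotProduct_sub] at *
    linarith
  have h4 := h3.trans (dotProduct_le_norm2 _ _)
  by_contra! h
  nlinarith [norm2_nonneg (p - q), norm2_nonneg (x - y)]

theorem eq_proj {C : Set (ι → ℝ)} (hC : Convex ℝ C) (hcl : IsClosed C) {x p : ι → ℝ}
    (hp : p ∈ C) (hp' : ∀ v ∈ C, (x - p) ⬝ᵥ (v - p) ≤ 0) : p = proj C x := by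
  obtain ⟨h1, h2⟩ := proj_spec hC hcl ⟨p, hp⟩ x
  have := norm2_sub_le_of_variational hp h1 hp' h2
  rw [sub_self, norm2_zero] at this
  exact sub_eq_zero.1 (norm2_eq_zero.1 (le_antisymm this (norm2_nonneg _)))

theorem proj_of_mem {C : Set (ι → ℝ)} (hC : Convex ℝ C) (hcl : IsClosed C) {x : ι → ℝ}
    (hx : x ∈ C) : proj C x = x :=
  (eq_proj hC hcl hx (by simp)).symm

theorem norm2_proj_sub_proj_le {C : Set (ι → ℝ)} (hC : Convex ℝ C) (hcl : IsClosed C)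
    (hne : C.Nonempty) (x y : ι → ℝ) : norm2 (proj C x - proj C y) ≤ norm2 (x - y) :=
  norm2_sub_le_of_variational (proj_spec hC hcl hne x).1 (proj_spec hC hcl hne y).1
    (proj_spec hC hcl hne x).2 (proj_spec hC hcl hne y).2

theorem continuous_of_norm2_le {κ X : Type*} [Fintype κ] [TopologicalSpace X] {f : X → κ → ℝ}
    {g : X → X → ℝ} (hg : ∀ x, Tendsto (fun y => g y x) (𝓝 x) (𝓝 0))
    (h : ∀ x y, norm2 (f x - f y) ≤ g x y) : Continuous f := by
  refine continuous_iff_continuousAt.2 fun x => ?_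
  rw [ContinuousAt, tendsto_iff_norm_sub_tendsto_zero]
  exact squeeze_zero (fun _ => norm_nonneg _)
    (fun y => (norm_le_norm2 _).trans (h y x)) (hg x)

theorem continuous_of_norm2_lipschitz {κ : Type*} [Fintype κ] {f : (ι → ℝ) → κ → ℝ} (C : ℝ)
    (h : ∀ x y, norm2 (f x - f y) ≤ C * norm2 (x - y)) : Continuous f := by
  refine continuous_of_norm2_le (g := fun x y => C * norm2 (x - y)) (fun x => ?_) h
  have : Continuous fun y : ι → ℝ => C * norm2 (y - x) :=
    continuous_const.mul (continuous_norm2.comp (continuous_id.sub continuous_const))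
  simpa [norm2_zero] using this.tendsto x

theorem continuous_proj {C : Set (ι → ℝ)} (hC : Convex ℝ C) (hcl : IsClosed C)
    (hne : C.Nonempty) : Continuous (proj C) :=
  continuous_of_norm2_lipschitz 1 fun x y => by
    simpa using norm2_proj_sub_proj_le hC hcl hne x y

/-- Coordinates for the separating functionals that Hahn–Banach produces, both for subgradients and
for multipliers. -/
theorem continuousLinear_eq_dotProduct (φ : StrongDual ℝ ((ι → ℝ) × ℝ)) :
    ∃ a : ι → ℝ, ∃ b : ℝ, ∀ v r, φ (v, r) = a ⬝ᵥ v + b * r := by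
  classical
  refine ⟨fun i => φ (fun j => if i = j then 1 else 0, 0), φ (0, 1), fun v r => ?_⟩
  have h1 : (v, r) = (v, 0) + r • ((0 : ι → ℝ), (1 : ℝ)) := by simp
  rw [h1, map_add, map_smul, smul_eq_mul, mul_comm]
  congr 1
  have := LinearMap.pi_apply_eq_sum_univ
    ((φ : ((ι → ℝ) × ℝ) →ₗ[ℝ] ℝ).comp (LinearMap.inl ℝ (ι → ℝ) ℝ)) v
  simpa [dotProduct, mul_comm] using this

/-- At a minimizer of a convex function over a convex set, some subgradient satisfies the
first-order condition. -/
theorem exists_subgradient_of_isMinOn {f : (ι → ℝ) → ℝ} (hf : ConvexOn ℝ Set.univ f)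
    {C : Set (ι → ℝ)} (hC : Convex ℝ C) {x : ι → ℝ} (hx : x ∈ C) (hmin : ∀ v ∈ C, f x ≤ f v) :
    ∃ g ∈ subdiff f x, ∀ v ∈ C, 0 ≤ g ⬝ᵥ (v - x) := by
  have hfc : Continuous f := hf.locallyLipschitz.continuous
  have hs1 : Convex ℝ {p : (ι → ℝ) × ℝ | f p.1 < p.2} := by
    simpa using hf.convex_strict_epigraph
  have hs2 : IsOpen {p : (ι → ℝ) × ℝ | f p.1 < p.2} :=
    isOpen_lt (hfc.comp continuous_fst) continuous_snd
  have ht : Convex ℝ (C ×ˢ Set.Iic (f x)) := hC.prod (convex_Iic _)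
  -- Minimality says that the open strict epigraph misses `C × (-∞, f x]`. The separating functional
  -- has negative slope `b` in the last coordinate, and dividing by `-b` yields the subgradient.
  obtain ⟨φ, u, h1, h2⟩ := geometric_hahn_banach_open hs1 hs2 ht (by
    rw [Set.disjoint_left]
    rintro ⟨v, r⟩ hv ⟨hv1, hv2⟩
    exact absurd (lt_of_lt_of_le hv hv2) (not_lt.2 (hmin v hv1)))
  obtain ⟨a, b, hab⟩ := continuousLinear_eq_dotProduct φ
  have hs : ∀ v r, f v < r → a ⬝ᵥ v + b * r < u := fun v r h => by
    rw [← hab]; exact h1 (v, r) h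
  have hw : ∀ w ∈ C, u ≤ a ⬝ᵥ w + b * f x := fun w h => by
    rw [← hab]; exact h2 (w, f x) ⟨h, le_refl (f x)⟩
  have hb : b < 0 := by
    have := hs x (f x + 1) (by linarith)
    have := hw x hx
    linarith
  have key : ∀ v, ∀ w ∈ C, a ⬝ᵥ v + b * f v ≤ a ⬝ᵥ w + b * f x := by
    intro v w hwC
    refine le_of_forall_pos_le_add fun ε hε => ?_
    have h3 := hs v (f v + ε / (-b)) (by
      have : 0 < ε / (-b) := div_pos hε (by linarith)
      linarith)
    have h4 := hw w hwC
    have h5 : b * (f v + ε / (-b)) = b * f v - ε := by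
      have : b ≠ 0 := hb.ne
      field_simp
      ring
    linarith
  refine ⟨(-b)⁻¹ • a, fun v => ?_, fun v hv => ?_⟩
  · have h := key v x hx
    rw [smul_dotProduct, smul_eq_mul, dotProduct_sub]
    have : (-b)⁻¹ * (a ⬝ᵥ v - a ⬝ᵥ x) ≤ f v - f x := by
      rw [inv_mul_le_iff₀ (by linarith)]
      linarith
    linarith
  · have h := key x v hv
    rw [smul_dotProduct, smul_eq_mul, dotProduct_sub]
    have : 0 < (-b)⁻¹ := inv_pos.2 (by linarith)
    exact mul_nonneg this.le (by linarith)

/-- Every point minimizes `f` over the singleton containing it. -/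
theorem subdiff_nonempty {f : (ι → ℝ) → ℝ} (hf : ConvexOn ℝ Set.univ f) (x : ι → ℝ) :
    (subdiff f x).Nonempty := by
  obtain ⟨g, hg, -⟩ := exists_subgradient_of_isMinOn hf (convex_singleton x)
    (Set.mem_singleton x) (by simp)
  exact ⟨g, hg⟩

theorem subdiff_monotone {f : (ι → ℝ) → ℝ} {x y u v : ι → ℝ} (hu : u ∈ subdiff f x)
    (hv : v ∈ subdiff f y) : 0 ≤ (u - v) ⬝ᵥ (x - y) := by
  have h1 := hu y
  have h2 := hv x
  simp only [sub_dotProduct, dotProduct_sub] at *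
  linarith

/-- The proximal step over a compact convex set, with its optimality condition. -/
theorem exists_prox {f : (ι → ℝ) → ℝ} (hf : ConvexOn ℝ Set.univ f) {C : Set (ι → ℝ)}
    (hC : Convex ℝ C) (hcpt : IsCompact C) (hne : C.Nonempty) {σ : ℝ} (hσ : 0 < σ)
    (φ u : ι → ℝ) : ∃ x ∈ C, ∃ g ∈ subdiff f x,
      ∀ v ∈ C, 0 ≤ (g + φ + σ • (x - u)) ⬝ᵥ (v - x) := by
  have hfc : Continuous f := hf.locallyLipschitz.continuous
  have hcont : Continuous fun v : ι → ℝ => f v + φ ⬝ᵥ v + σ / 2 * norm2 (v - u) ^ 2 := by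
    have := continuous_norm2 (ι := ι)
    have h2 : Continuous fun v : ι → ℝ => φ ⬝ᵥ v := by
      unfold dotProduct; fun_prop
    fun_prop
  obtain ⟨x, hx, hmin⟩ := hcpt.exists_isMinOn hne hcont.continuousOn
  -- `q` is the gradient of the smooth part at the minimizer. Moving from `x` towards `v` by `t` and
  -- letting `t` be small shows that `x` also minimizes the linearization `f + q ⬝ᵥ ·`, which is
  -- convex without the quadratic term.
  set q := φ + σ • (x - u) with hq
  have hmin' : ∀ v ∈ C, f x + q ⬝ᵥ x ≤ f v + q ⬝ᵥ v := by
    intro v hv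
    have key : ∀ t : ℝ, 0 < t → t ≤ 1 →
        f x + q ⬝ᵥ x - (f v + q ⬝ᵥ v) ≤ t * (σ / 2 * norm2 (v - x) ^ 2) := by
      intro t ht ht1
      have hm : x + t • (v - x) ∈ C := hC.add_smul_sub_mem hx hv ⟨ht.le, ht1⟩
      have h1 := hmin hm
      simp only [Set.mem_ofPred_eq] at h1
      have h2 : x + t • (v - x) - u = (x - u) + t • (v - x) := by abel
      have h3 := hf.2 (Set.mem_univ x) (Set.mem_univ v) (by linarith : (0:ℝ) ≤ 1 - t) ht.le
        (by ring)
      have h4 : (1 - t) • x + t • v = x + t • (v - x) := by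
        rw [sub_smul, one_smul, smul_sub]; abel
      rw [h4, smul_eq_mul, smul_eq_mul] at h3
      rw [h2, norm2_add_sq, norm2_smul, mul_pow, sq_abs, dotProduct_smul, dotProduct_add,
        dotProduct_smul, smul_eq_mul, smul_eq_mul] at h1
      have h5 : q ⬝ᵥ v - q ⬝ᵥ x = φ ⬝ᵥ (v - x) + σ * ((x - u) ⬝ᵥ (v - x)) := by
        rw [← dotProduct_sub, hq, add_dotProduct, smul_dotProduct, smul_eq_mul]
      have h6 : t * (f x + q ⬝ᵥ x - (f v + q ⬝ᵥ v)) ≤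
          t * (t * (σ / 2 * norm2 (v - x) ^ 2)) := by
        have : f x + q ⬝ᵥ x - (f v + q ⬝ᵥ v) = f x - f v -
            (φ ⬝ᵥ (v - x) + σ * ((x - u) ⬝ᵥ (v - x))) := by linarith
        rw [this]
        nlinarith
      exact le_of_mul_le_mul_left h6 ht
    by_contra! hlt
    set a := f x + q ⬝ᵥ x - (f v + q ⬝ᵥ v)
    have ha : 0 < a := sub_pos.2 hlt
    set b := σ / 2 * norm2 (v - x) ^ 2
    have hb : 0 ≤ b := by positivity
    have h1 := key (min 1 (a / (b + 1))) (by positivity) (min_le_left _ _)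
    have h2 : min 1 (a / (b + 1)) * b ≤ a / (b + 1) * b := by gcongr; exact min_le_right _ _
    have h3 : a / (b + 1) * b < a := by
      rw [div_mul_eq_mul_div, div_lt_iff₀ (by positivity)]
      nlinarith
    linarith
  have hlin : ConvexOn ℝ Set.univ fun v : ι → ℝ => f v + q ⬝ᵥ v :=
    hf.add ⟨convex_univ, fun a _ b _ s t _ _ _ => by simp [dotProduct_add, dotProduct_smul]⟩
  obtain ⟨g, hg, hg'⟩ := exists_subgradient_of_isMinOn hlin hC hx hmin'
  refine ⟨x, hx, g - q, fun v => ?_, fun v hv => ?_⟩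
  · have := hg v
    simp only [sub_dotProduct, dotProduct_sub] at *
    linarith
  · have : g - q + φ + σ • (x - u) = g := by rw [hq]; abel
    rw [this]
    exact hg' v hv

/-- Stability of solutions of strongly monotone variational inequalities. -/
theorem variational_stability {C : Set (ι → ℝ)} {σ : ℝ} {x y g h φ θ u w : ι → ℝ}
    (hx : x ∈ C) (hy : y ∈ C)
    (hxv : ∀ v ∈ C, 0 ≤ (g + φ + σ • (x - u)) ⬝ᵥ (v - x))
    (hyv : ∀ v ∈ C, 0 ≤ (h + θ + σ • (y - w)) ⬝ᵥ (v - y)) :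
    (g - h) ⬝ᵥ (x - y) + σ * norm2 (x - y) ^ 2 ≤ (θ - φ + σ • (u - w)) ⬝ᵥ (x - y) := by
  have h1 := hxv y hy
  have h2 := hyv x hx
  rw [norm2_sq]
  simp only [add_dotProduct, sub_dotProduct, dotProduct_sub, smul_dotProduct, smul_eq_mul] at *
  linarith

end ConvexAnalysis

/-! ### Network matrices and the block form of `D` and `Φ`. -/

namespace Setup

variable {N : ℕ} {G : Game N} (S : Setup G)

section Network

variable {κ : Type*} [Fintype κ] [DecidableEq κ]

theorem kronB_transpose_mulVec (v : Fin N × κ → ℝ) (e : S.E) (a : κ) :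
    ((S.B ⊗ₖ (1 : Matrix κ κ ℝ))ᵀ *ᵥ v) (e, a) = v (e.1.2, a) - v (e.1.1, a) := by
  simp only [Matrix.mulVec, dotProduct, Fintype.sum_prod_type, Matrix.transpose_apply,
    Matrix.kroneckerMap_apply, B, Matrix.of_apply, Matrix.one_apply, mul_ite, mul_one, mul_zero,
    ite_mul, zero_mul, Finset.sum_ite_eq', Finset.mem_univ, if_true, sub_mul, one_mul,
    Finset.sum_sub_distrib, Finset.sum_ite_eq]

theorem kronB_mulVec (u : S.E × κ → ℝ) (i : Fin N) (a : κ) :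
    ((S.B ⊗ₖ (1 : Matrix κ κ ℝ)) *ᵥ u) (i, a) = S.edgeFlow u i a := by
  simp only [Matrix.mulVec, dotProduct, Fintype.sum_prod_type, edgeFlow,
    Matrix.kroneckerMap_apply, B, Matrix.of_apply, Matrix.one_apply, mul_ite, mul_one, mul_zero,
    ite_mul, zero_mul, Finset.mem_univ, if_true, sub_mul, one_mul,
    Finset.sum_sub_distrib, Finset.sum_ite_eq, Finset.sum_filter]

theorem kronL_eq : S.L ⊗ₖ (1 : Matrix κ κ ℝ) =
    (S.B ⊗ₖ (1 : Matrix κ κ ℝ)) * (S.B ⊗ₖ (1 : Matrix κ κ ℝ))ᵀ := by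
  rw [← Matrix.kroneckerMap_transpose, ← Matrix.mul_kronecker_mul, Matrix.transpose_one, mul_one, L]

theorem sum_heads (f : Fin N → ℝ) (i : Fin N) :
    ∑ e ∈ Finset.univ.filter (fun e : S.E => e.1.2 = i), f e.1.1 =
      ∑ j ∈ Finset.univ.filter (fun j => (j, i) ∈ S.E), f j := by
  refine Finset.sum_bij' (fun e _ => e.1.1)
    (fun j hj => ⟨(j, i), (Finset.mem_filter.1 hj).2⟩) ?_ ?_ ?_ ?_ ?_
  · rintro ⟨⟨j, k⟩, he⟩ h
    simp only [Finset.mem_filter, Finset.mem_univ, true_and] at h ⊢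
    exact h ▸ he
  · simp
  · rintro ⟨⟨j, k⟩, he⟩ h
    simp only [Finset.mem_filter, Finset.mem_univ, true_and] at h
    simp [h]
  · simp
  · simp

theorem sum_tails (f : Fin N → ℝ) (i : Fin N) :
    ∑ e ∈ Finset.univ.filter (fun e : S.E => e.1.1 = i), f e.1.2 =
      ∑ j ∈ Finset.univ.filter (fun j => (i, j) ∈ S.E), f j := by
  refine Finset.sum_bij' (fun e _ => e.1.2)
    (fun j hj => ⟨(i, j), (Finset.mem_filter.1 hj).2⟩) ?_ ?_ ?_ ?_ ?_
  · rintro ⟨⟨j, k⟩, he⟩ h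
    simp only [Finset.mem_filter, Finset.mem_univ, true_and] at h ⊢
    exact h ▸ he
  · simp
  · rintro ⟨⟨j, k⟩, he⟩ h
    simp only [Finset.mem_filter, Finset.mem_univ, true_and] at h
    simp [h]
  · simp
  · simp

theorem kronL_mulVec (v : Fin N × κ → ℝ) (i : Fin N) (a : κ) :
    ((S.L ⊗ₖ (1 : Matrix κ κ ℝ)) *ᵥ v) (i, a) = S.nbrDiff v i a := by
  rw [kronL_eq, ← Matrix.mulVec_mulVec, kronB_mulVec, edgeFlow, nbrDiff,
    ← S.sum_heads (fun j => v (i, a) - v (j, a)), ← S.sum_tails (fun j => v (i, a) - v (j, a)),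
    sub_eq_add_neg, ← Finset.sum_neg_distrib]
  congr 1
  · refine Finset.sum_congr rfl fun e he => ?_
    rw [kronB_transpose_mulVec, (Finset.mem_filter.1 he).2]
  · refine Finset.sum_congr rfl fun e he => ?_
    rw [kronB_transpose_mulVec, (Finset.mem_filter.1 he).2]
    ring

theorem dotProduct_kronL (v w : Fin N × κ → ℝ) :
    v ⬝ᵥ ((S.L ⊗ₖ (1 : Matrix κ κ ℝ)) *ᵥ w) =
      ((S.B ⊗ₖ (1 : Matrix κ κ ℝ))ᵀ *ᵥ v) ⬝ᵥ ((S.B ⊗ₖ (1 : Matrix κ κ ℝ))ᵀ *ᵥ w) := by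
  simp only [kronL_eq, ← Matrix.mulVec_mulVec, Matrix.dotProduct_mulVec, Matrix.mulVec_transpose]

theorem dotProduct_kronL_nonneg (v : Fin N × κ → ℝ) :
    0 ≤ v ⬝ᵥ ((S.L ⊗ₖ (1 : Matrix κ κ ℝ)) *ᵥ v) := by
  rw [dotProduct_kronL, ← norm2_sq]
  positivity

end Network

theorem R_mulVec (y : S.YI → ℝ) (p : Idx G.n) : (S.R *ᵥ y) p = y (p.1, p) := by
  simp [Matrix.mulVec, dotProduct, R]

theorem R_transpose_mulVec (g : Idx G.n → ℝ) (i : Fin N) (p : Idx G.n) :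
    (S.Rᵀ *ᵥ g) (i, p) = if p.1 = i then g p else 0 := by
  simp only [Matrix.mulVec, dotProduct, R, Matrix.transpose_apply, Matrix.of_apply, ite_mul,
    one_mul, zero_mul, Prod.mk.injEq]
  rw [Finset.sum_eq_single p]
  · simp [eq_comm]
  · intro b _ hb
    simp [hb.symm]
  · simp

theorem Lam_mulVec (x : Idx G.n → ℝ) (i : Fin N) (a : Fin G.m) :
    (S.Lam *ᵥ x) (i, a) = (G.A i *ᵥ block x i) a := by
  simp only [Matrix.mulVec, dotProduct, Lam, Matrix.of_apply, ite_mul, zero_mul,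
    Fintype.sum_sigma]
  rw [Finset.sum_eq_single i]
  · simp [block]
  · intro b _ hb
    simp [hb]
  · simp

theorem Lam_transpose_mulVec (l : S.LI → ℝ) (p : Idx G.n) :
    (S.Lamᵀ *ᵥ l) p = ((G.A p.1)ᵀ *ᵥ fun a => l (p.1, a)) p.2 := by
  simp only [Matrix.mulVec, dotProduct, Lam, Matrix.transpose_apply, Matrix.of_apply, ite_mul,
    zero_mul, Fintype.sum_prod_type]
  rw [Finset.sum_eq_single p.1]
  · simp
  · intro b _ hb
    simp [hb.symm]
  · simp

/-- The decisions stored in the augmented vectors of the players. -/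
def own (y : S.YI → ℝ) : Idx G.n → ℝ := fun p => y (p.1, p)

theorem R_mulVec_eq (y : S.YI → ℝ) : S.R *ᵥ y = S.own y := funext (S.R_mulVec y)

theorem block_own (y : S.YI → ℝ) (i : Fin N) : block (S.own y) i = block (G.aug y i) i := rfl

@[simp] theorem yPart_stack (y : S.YI → ℝ) (l : S.LI → ℝ) (μ : S.MI → ℝ) (z : S.ZI → ℝ) :
    S.yPart (S.stack y l μ z) = y := rfl
@[simp] theorem lPart_stack (y : S.YI → ℝ) (l : S.LI → ℝ) (μ : S.MI → ℝ) (z : S.ZI → ℝ) :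
    S.lPart (S.stack y l μ z) = l := rfl
@[simp] theorem mPart_stack (y : S.YI → ℝ) (l : S.LI → ℝ) (μ : S.MI → ℝ) (z : S.ZI → ℝ) :
    S.mPart (S.stack y l μ z) = μ := rfl
@[simp] theorem zPart_stack (y : S.YI → ℝ) (l : S.LI → ℝ) (μ : S.MI → ℝ) (z : S.ZI → ℝ) :
    S.zPart (S.stack y l μ z) = z := rfl

theorem ext_parts {ψ φ : S.PI → ℝ} (hy : S.yPart ψ = S.yPart φ) (hl : S.lPart ψ = S.lPart φ)
    (hm : S.mPart ψ = S.mPart φ) (hz : S.zPart ψ = S.zPart φ) : ψ = φ := by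
  ext ((q | q) | (q | q))
  · exact congrFun hy q
  · exact congrFun hl q
  · exact congrFun hm q
  · exact congrFun hz q

theorem stack_parts (ψ : S.PI → ℝ) :
    S.stack (S.yPart ψ) (S.lPart ψ) (S.mPart ψ) (S.zPart ψ) = ψ :=
  S.ext_parts rfl rfl rfl rfl

theorem stack_add (y y' : S.YI → ℝ) (l l' : S.LI → ℝ) (μ μ' : S.MI → ℝ) (z z' : S.ZI → ℝ) :
    S.stack y l μ z + S.stack y' l' μ' z' = S.stack (y + y') (l + l') (μ + μ') (z + z') :=
  S.ext_parts rfl rfl rfl rfl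

theorem stack_inj {y y' : S.YI → ℝ} {l l' : S.LI → ℝ} {μ μ' : S.MI → ℝ} {z z' : S.ZI → ℝ} :
    S.stack y l μ z = S.stack y' l' μ' z' ↔ y = y' ∧ l = l' ∧ μ = μ' ∧ z = z' := by
  constructor
  · intro h
    exact ⟨congrArg S.yPart h, congrArg S.lPart h, congrArg S.mPart h, congrArg S.zPart h⟩
  · rintro ⟨rfl, rfl, rfl, rfl⟩
    rfl

theorem dotProduct_stack (ψ φ : S.PI → ℝ) :
    ψ ⬝ᵥ φ = S.yPart ψ ⬝ᵥ S.yPart φ + S.lPart ψ ⬝ᵥ S.lPart φ + S.mPart ψ ⬝ᵥ S.mPart φ +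
      S.zPart ψ ⬝ᵥ S.zPart φ := by
  simp only [dotProduct, Fintype.sum_sum_type, yPart, lPart, mPart, zPart]
  ring

theorem D_mulVec (ψ : S.PI → ℝ) : S.D *ᵥ ψ = S.stack
    ((S.ρμ / 2) • (S.Ln *ᵥ S.yPart ψ) + (1 / 2 : ℝ) • (S.Rᵀ *ᵥ (S.Lamᵀ *ᵥ S.lPart ψ)) +
      (1 / 2 : ℝ) • (S.Bn *ᵥ S.mPart ψ))
    (-((1 / 2 : ℝ) • (S.Lam *ᵥ (S.R *ᵥ S.yPart ψ))) + (S.ρz / 2) • (S.Lm *ᵥ S.lPart ψ) +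
      (1 / 2 : ℝ) • (S.Bm *ᵥ S.zPart ψ))
    (-((1 / 2 : ℝ) • (S.Bnᵀ *ᵥ S.yPart ψ))) (-((1 / 2 : ℝ) • (S.Bmᵀ *ᵥ S.lPart ψ))) := by
  conv_lhs => rw [← S.stack_parts ψ]
  simp only [D, stack, Matrix.fromBlocks_mulVec, Sum.elim_comp_inl, Sum.elim_comp_inr,
    Matrix.smul_mulVec, Matrix.neg_mulVec, Matrix.zero_mulVec, Matrix.transpose_mul,
    ← Matrix.mulVec_mulVec, add_zero, zero_add]
  refine S.ext_parts ?_ ?_ ?_ ?_ <;> rfl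

theorem Phi_mulVec (ψ : S.PI → ℝ) : S.Phi *ᵥ ψ = S.stack
    ((fun q => (S.τ₁ q.1)⁻¹ * S.yPart ψ q) - (S.ρμ / 2) • (S.Ln *ᵥ S.yPart ψ) -
      (1 / 2 : ℝ) • (S.Rᵀ *ᵥ (S.Lamᵀ *ᵥ S.lPart ψ)) - (1 / 2 : ℝ) • (S.Bn *ᵥ S.mPart ψ))
    (-((1 / 2 : ℝ) • (S.Lam *ᵥ (S.R *ᵥ S.yPart ψ))) +
      ((fun q => (S.τ₂ q.1)⁻¹ * S.lPart ψ q) - (S.ρz / 2) • (S.Lm *ᵥ S.lPart ψ)) -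
      (1 / 2 : ℝ) • (S.Bm *ᵥ S.zPart ψ))
    (-((1 / 2 : ℝ) • (S.Bnᵀ *ᵥ S.yPart ψ)) + fun q => (S.τ₃ q.1)⁻¹ * S.mPart ψ q)
    (-((1 / 2 : ℝ) • (S.Bmᵀ *ᵥ S.lPart ψ)) + fun q => (S.τ₄ q.1)⁻¹ * S.zPart ψ q) := by
  conv_lhs => rw [← S.stack_parts ψ]
  simp only [Phi, stack, Matrix.fromBlocks_mulVec, Sum.elim_comp_inl, Sum.elim_comp_inr,
    Matrix.smul_mulVec, Matrix.neg_mulVec, Matrix.sub_mulVec, Matrix.zero_mulVec,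
    Matrix.transpose_mul, ← Matrix.mulVec_mulVec, add_zero, zero_add]
  refine S.ext_parts ?_ ?_ ?_ ?_ <;> ext q <;>
    simp [yPart, lPart, mPart, zPart, Matrix.mulVec_diagonal, sub_eq_add_neg]

/-- Preconditioning makes the implicit linear part of the resolvent block triangular. -/
theorem Phi_mulVec_sub_eq_iff (ψ p : S.PI → ℝ) (a : S.YI → ℝ) (b : S.LI → ℝ) :
    S.Phi *ᵥ (ψ - p) = S.D *ᵥ p + S.stack a b 0 0 ↔
      (∀ i q, (S.τ₁ i)⁻¹ * (S.yPart ψ (i, q) - S.yPart p (i, q)) -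
        1 / 2 * ((S.Rᵀ *ᵥ (S.Lamᵀ *ᵥ S.lPart ψ)) (i, q) + S.ρμ * S.nbrDiff (S.yPart ψ) i q +
          S.edgeFlow (S.mPart ψ) i q) = a (i, q)) ∧
      (∀ i q, (S.τ₂ i)⁻¹ * (S.lPart ψ (i, q) - S.lPart p (i, q)) +
        (G.A i *ᵥ (block (G.aug (S.yPart p) i) i - (1 / 2 : ℝ) • S.ownDecision ψ i)) q -
          S.ρz / 2 * S.nbrDiff (S.lPart ψ) i q - 1 / 2 * S.edgeFlow (S.zPart ψ) i q = b (i, q)) ∧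
      (∀ e q, (S.τ₃ e)⁻¹ * (S.mPart ψ (e, q) - S.mPart p (e, q)) +
        ((S.yPart p (e.1.2, q) - S.yPart p (e.1.1, q)) -
          1 / 2 * (S.yPart ψ (e.1.2, q) - S.yPart ψ (e.1.1, q))) = 0) ∧
      (∀ e q, (S.τ₄ e)⁻¹ * (S.zPart ψ (e, q) - S.zPart p (e, q)) +
        ((S.lPart p (e.1.2, q) - S.lPart p (e.1.1, q)) -
          1 / 2 * (S.lPart ψ (e.1.2, q) - S.lPart ψ (e.1.1, q))) = 0) := by
  rw [Matrix.mulVec_sub, sub_eq_iff_eq_add, Phi_mulVec, Phi_mulVec, D_mulVec, stack_add, stack_add,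
    stack_inj]
  refine and_congr ?_ (and_congr ?_ (and_congr ?_ ?_))
  · rw [funext_iff, Prod.forall]
    refine forall_congr' fun i => forall_congr' fun q => ?_
    simp only [Pi.add_apply, Pi.sub_apply, Pi.smul_apply, smul_eq_mul, Ln, Bn, kronL_mulVec,
      kronB_mulVec]
    constructor <;> intro h <;> linarith
  · rw [funext_iff, Prod.forall]
    refine forall_congr' fun i => forall_congr' fun q => ?_
    simp only [Pi.add_apply, Pi.sub_apply, Pi.smul_apply, Pi.neg_apply, smul_eq_mul, Lm, Bm,
      kronL_mulVec, kronB_mulVec, Lam_mulVec, R_mulVec_eq, block_own, Matrix.mulVec_sub,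
      Matrix.mulVec_smul, ownDecision]
    constructor <;> intro h <;> linarith
  · rw [funext_iff, Prod.forall]
    refine forall_congr' fun i => forall_congr' fun q => ?_
    simp only [Pi.add_apply, Pi.smul_apply, Pi.neg_apply, Pi.zero_apply, smul_eq_mul, Bn,
      kronB_transpose_mulVec]
    constructor <;> intro h <;> linarith
  · rw [funext_iff, Prod.forall]
    refine forall_congr' fun i => forall_congr' fun q => ?_
    simp only [Pi.add_apply, Pi.smul_apply, Pi.neg_apply, Pi.zero_apply, smul_eq_mul, Bm,
      kronB_transpose_mulVec]
    constructor <;> intro h <;> linarith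

/-- The symmetric part of `D` consists of the Laplacian blocks. -/
theorem dotProduct_D (ψ : S.PI → ℝ) : (S.D *ᵥ ψ) ⬝ᵥ ψ =
    S.ρμ / 2 * ((S.Ln *ᵥ S.yPart ψ) ⬝ᵥ S.yPart ψ) +
      S.ρz / 2 * ((S.Lm *ᵥ S.lPart ψ) ⬝ᵥ S.lPart ψ) := by
  have h1 : (S.Rᵀ *ᵥ (S.Lamᵀ *ᵥ S.lPart ψ)) ⬝ᵥ S.yPart ψ =
      (S.Lam *ᵥ (S.R *ᵥ S.yPart ψ)) ⬝ᵥ S.lPart ψ := by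
    rw [dotProduct_comm, Matrix.dotProduct_mulVec, Matrix.vecMul_transpose,
      Matrix.dotProduct_mulVec, Matrix.vecMul_transpose]
  have h2 : (S.Bnᵀ *ᵥ S.yPart ψ) ⬝ᵥ S.mPart ψ = (S.Bn *ᵥ S.mPart ψ) ⬝ᵥ S.yPart ψ := by
    rw [dotProduct_comm, Matrix.dotProduct_mulVec, Matrix.vecMul_transpose]
  have h3 : (S.Bmᵀ *ᵥ S.lPart ψ) ⬝ᵥ S.zPart ψ = (S.Bm *ᵥ S.zPart ψ) ⬝ᵥ S.lPart ψ := by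
    rw [dotProduct_comm, Matrix.dotProduct_mulVec, Matrix.vecMul_transpose]
  rw [dotProduct_stack, D_mulVec]
  simp only [yPart_stack, lPart_stack, mPart_stack, zPart_stack, add_dotProduct, neg_dotProduct,
    smul_dotProduct, smul_eq_mul, h1, h2, h3]
  ring

end Setup

/-! ### Normal cones of products and of cylinders. -/

section NormalCones

variable {κ ι : Type*} [Fintype κ] [Fintype ι]

theorem normalCone_prod {C : ι → Set (κ → ℝ)} {ν y : ι × κ → ℝ} :
    ν ∈ normalCone {y : ι × κ → ℝ | ∀ i, (fun a => y (i, a)) ∈ C i} y ↔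
      ∀ i, (fun a => ν (i, a)) ∈ normalCone (C i) fun a => y (i, a) := by
  classical
  constructor
  · rintro ⟨hy, h⟩ i
    refine ⟨hy i, fun z hz => ?_⟩
    have := h (fun q => if q.1 = i then z q.2 else y q) (fun j => by
      by_cases hj : j = i
      · subst hj; simpa using hz
      · simpa [hj] using hy j)
    simp only [dotProduct, Fintype.sum_prod_type, Pi.sub_apply] at this ⊢
    rw [Finset.sum_eq_single i] at this
    · simpa using this
    · intro j _ hj
      simp [hj]
    · simp
  · intro h
    refine ⟨fun i => (h i).1, fun z hz => ?_⟩
    simp only [dotProduct, Fintype.sum_prod_type]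
    exact Finset.sum_nonpos fun i _ => (h i).2 _ (hz i)

end NormalCones

section Blocks

variable {N : ℕ} {n : Fin N → ℕ}

theorem block_replaceBlock (x : Idx n → ℝ) (i : Fin N) (v : Fin (n i) → ℝ) :
    block (replaceBlock x i v) i = v := by
  funext a
  simp [block, replaceBlock]

theorem replaceBlock_replaceBlock (x : Idx n → ℝ) (i : Fin N) (v w : Fin (n i) → ℝ) :
    replaceBlock (replaceBlock x i v) i w = replaceBlock x i w := by
  funext ⟨j, a⟩
  by_cases h : j = i
  · subst h; simp [replaceBlock]
  · simp [replaceBlock, block, h]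

theorem replaceBlock_block_apply (x v : Idx n → ℝ) (i : Fin N) (p : Idx n) :
    replaceBlock x i (block v i) p = if p.1 = i then v p else x p := by
  obtain ⟨j, a⟩ := p
  by_cases h : j = i
  · subst h; simp [replaceBlock, block]
  · simp [replaceBlock, block, h]

theorem dotProduct_eq_sum_block (x y : Idx n → ℝ) :
    x ⬝ᵥ y = ∑ i, block x i ⬝ᵥ block y i := by
  simp [dotProduct, Fintype.sum_sigma, block]

theorem dotProduct_eq_block {x y : Idx n → ℝ} {i : Fin N} (h : ∀ p : Idx n, p.1 ≠ i → x p = 0) :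
    x ⬝ᵥ y = block x i ⬝ᵥ block y i := by
  rw [dotProduct_eq_sum_block]
  refine Finset.sum_eq_single i (fun j _ hj => ?_) (by simp)
  exact Finset.sum_eq_zero fun a _ => by simp [block, h ⟨j, a⟩ hj]

theorem normalCone_block {K : ∀ i : Fin N, Set (Fin (n i) → ℝ)} {i : Fin N} {u x : Idx n → ℝ} :
    u ∈ normalCone {x : Idx n → ℝ | block x i ∈ K i} x ↔
      block u i ∈ normalCone (K i) (block x i) ∧ ∀ p : Idx n, p.1 ≠ i → u p = 0 := by
  constructor
  · rintro ⟨hx, h⟩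
    have h0 : ∀ p : Idx n, p.1 ≠ i → u p = 0 := by
      intro p hp
      -- The coordinate `p` is unconstrained; moving along it by `u p` gives `(u p)² ≤ 0`.
      have := h (x + Pi.single p (u p)) (by
        have : block (x + Pi.single p (u p)) i = block x i := by
          funext a
          have : (⟨i, a⟩ : Idx n) ≠ p := fun h => hp (h ▸ rfl)
          simp [block, this]
        simpa [this] using hx)
      rw [add_sub_cancel_left, dotProduct_single] at this
      nlinarith
    refine ⟨⟨hx, fun z hz => ?_⟩, h0⟩
    have := h (replaceBlock x i z) (by simpa [block_replaceBlock] using hz)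
    rw [dotProduct_eq_block h0] at this
    have h1 : block (replaceBlock x i z - x) i = z - block x i := by
      change block (replaceBlock x i z) i - block x i = _
      rw [block_replaceBlock]
    rwa [h1] at this
  · rintro ⟨⟨hx, h⟩, h0⟩
    refine ⟨hx, fun z hz => ?_⟩
    rw [dotProduct_eq_block h0]
    exact h _ hz

end Blocks

/-! ### Expected objectives are convex and have subgradients. -/

namespace Game

variable {N : ℕ} {G : Game N}

theorem EJ_convex (hJ : G.ScenarioObjectives) (i : Fin N) (x : Idx G.n → ℝ) :
    ConvexOn ℝ Set.univ fun v => G.EJ i (replaceBlock x i v) := by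
  refine ⟨convex_univ, fun v _ w _ a b ha hb hab => ?_⟩
  simp only [EJ, smul_eq_mul]
  rw [← integral_const_mul, ← integral_const_mul, ← integral_add
    ((hJ.integrable i _).const_mul a) ((hJ.integrable i _).const_mul b)]
  refine integral_mono (hJ.integrable i _)
    (((hJ.integrable i _).const_mul a).add ((hJ.integrable i _).const_mul b)) fun s => ?_
  exact (hJ.convex i s x).2 (Set.mem_univ v) (Set.mem_univ w) ha hb hab

theorem partialSubdiff_nonempty (hJ : G.ScenarioObjectives) (i : Fin N) (x : Idx G.n → ℝ) :
    (G.partialSubdiff i x).Nonempty :=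
  subdiff_nonempty (EJ_convex hJ i x) _

theorem partialSubdiff_replaceBlock (i : Fin N) (x : Idx G.n → ℝ) (v : Fin (G.n i) → ℝ) :
    G.partialSubdiff i (replaceBlock x i v) =
      subdiff (fun w => G.EJ i (replaceBlock x i w)) v := by
  simp [partialSubdiff, replaceBlock_replaceBlock, block_replaceBlock]

theorem extPseudograd_nonempty (hJ : G.ScenarioObjectives) (y : Fin N × Idx G.n → ℝ) :
    (G.extPseudograd y).Nonempty := by
  choose u hu using fun i => partialSubdiff_nonempty hJ i (G.aug y i)
  exact ⟨fun p => u p.1 p.2, hu⟩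

end Game

/-! ### The two resolvents in closed form. -/

namespace Setup

variable {N : ℕ} {G : Game N} (S : Setup G)

theorem nbrDiff_add {κ : Type*} (v w : Fin N × κ → ℝ) (i : Fin N) (a : κ) :
    S.nbrDiff (v + w) i a = S.nbrDiff v i a + S.nbrDiff w i a := by
  simp only [nbrDiff, Pi.add_apply, add_sub_add_comm, Finset.sum_add_distrib]
  ring

theorem nbrDiff_smul {κ : Type*} (c : ℝ) (v : Fin N × κ → ℝ) (i : Fin N) (a : κ) :
    S.nbrDiff (c • v) i a = c * S.nbrDiff v i a := by
  simp only [nbrDiff, Pi.smul_apply, smul_eq_mul, ← mul_sub, ← Finset.mul_sum, mul_add]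

theorem edgeFlow_add {κ : Type*} (v w : S.E × κ → ℝ) (i : Fin N) (a : κ) :
    S.edgeFlow (v + w) i a = S.edgeFlow v i a + S.edgeFlow w i a := by
  simp only [edgeFlow, Pi.add_apply, Finset.sum_add_distrib]
  ring

theorem edgeFlow_smul {κ : Type*} (c : ℝ) (v : S.E × κ → ℝ) (i : Fin N) (a : κ) :
    S.edgeFlow (c • v) i a = c * S.edgeFlow v i a := by
  simp only [edgeFlow, Pi.smul_apply, smul_eq_mul, ← Finset.mul_sum, mul_sub]

/-- The first step of an iteration when the own decisions are set to `v`. -/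
noncomputable def completeStep (ψ : S.PI → ℝ) (v : Idx G.n → ℝ) : S.PI → ℝ :=
  let y : S.YI → ℝ := fun q => replaceBlock (S.estUpdate ψ q.1) q.1 (block v q.1) q.2
  let l : S.LI → ℝ := fun q => S.lPart ψ q + S.τ₂ q.1 *
    ((G.A q.1 *ᵥ (block (G.aug y q.1) q.1 - (1 / 2 : ℝ) • S.ownDecision ψ q.1)) q.2
      - S.ρz / 2 * S.nbrDiff (S.lPart ψ) q.1 q.2
      - 1 / 2 * S.edgeFlow (S.zPart ψ) q.1 q.2 - S.cloc q.1 q.2)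
  let yh : S.YI → ℝ := (2 : ℝ) • y - S.yPart ψ
  let lh : S.LI → ℝ := (2 : ℝ) • l - S.lPart ψ
  let μ : S.MI → ℝ := fun q => S.mPart ψ q +
    S.τ₃ q.1 / 2 * (yh (q.1.1.2, q.2) - yh (q.1.1.1, q.2))
  let z : S.ZI → ℝ := fun q => S.zPart ψ q +
    S.τ₄ q.1 / 2 * (lh (q.1.1.2, q.2) - lh (q.1.1.1, q.2))
  S.stack y l μ z

theorem aug_completeStep (ψ : S.PI → ℝ) (v : Idx G.n → ℝ) (i : Fin N) :
    G.aug (S.yPart (S.completeStep ψ v)) i = replaceBlock (S.estUpdate ψ i) i (block v i) := rfl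

theorem yPart_completeStep (ψ : S.PI → ℝ) (v : Idx G.n → ℝ) (i : Fin N) (q : Idx G.n) :
    S.yPart (S.completeStep ψ v) (i, q) = if q.1 = i then v q else
      S.yPart ψ (i, q) - S.τ₁ i / 2 *
        (S.ρμ * S.nbrDiff (S.yPart ψ) i q + S.edgeFlow (S.mPart ψ) i q) :=
  replaceBlock_block_apply _ v i q

theorem lPart_completeStep (ψ : S.PI → ℝ) (v : Idx G.n → ℝ) (i : Fin N) (q : Fin G.m) :
    S.lPart (S.completeStep ψ v) (i, q) = S.lPart ψ (i, q) + S.τ₂ i *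
      ((G.A i *ᵥ (block v i - (1 / 2 : ℝ) • S.ownDecision ψ i)) q
        - S.ρz / 2 * S.nbrDiff (S.lPart ψ) i q
        - 1 / 2 * S.edgeFlow (S.zPart ψ) i q - S.cloc i q) := by
  have h : block (G.aug (S.yPart (S.completeStep ψ v)) i) i = block v i := by
    rw [aug_completeStep, block_replaceBlock]
  rw [← h]
  rfl

theorem mPart_completeStep (ψ : S.PI → ℝ) (v : Idx G.n → ℝ) (e : S.E) (q : Idx G.n) :
    S.mPart (S.completeStep ψ v) (e, q) = S.mPart ψ (e, q) + S.τ₃ e / 2 *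
      ((2 * S.yPart (S.completeStep ψ v) (e.1.2, q) - S.yPart ψ (e.1.2, q)) -
        (2 * S.yPart (S.completeStep ψ v) (e.1.1, q) - S.yPart ψ (e.1.1, q))) := rfl

theorem zPart_completeStep (ψ : S.PI → ℝ) (v : Idx G.n → ℝ) (e : S.E) (q : Fin G.m) :
    S.zPart (S.completeStep ψ v) (e, q) = S.zPart ψ (e, q) + S.τ₄ e / 2 *
      ((2 * S.lPart (S.completeStep ψ v) (e.1.2, q) - S.lPart ψ (e.1.2, q)) -
        (2 * S.lPart (S.completeStep ψ v) (e.1.1, q) - S.lPart ψ (e.1.1, q))) := rfl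

theorem yPart_add (ψ φ : S.PI → ℝ) : S.yPart (ψ + φ) = S.yPart ψ + S.yPart φ := rfl
theorem yPart_sub (ψ φ : S.PI → ℝ) : S.yPart (ψ - φ) = S.yPart ψ - S.yPart φ := rfl
theorem yPart_smul (c : ℝ) (ψ : S.PI → ℝ) : S.yPart (c • ψ) = c • S.yPart ψ := rfl
theorem lPart_add (ψ φ : S.PI → ℝ) : S.lPart (ψ + φ) = S.lPart ψ + S.lPart φ := rfl
theorem lPart_sub (ψ φ : S.PI → ℝ) : S.lPart (ψ - φ) = S.lPart ψ - S.lPart φ := rfl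
theorem lPart_smul (c : ℝ) (ψ : S.PI → ℝ) : S.lPart (c • ψ) = c • S.lPart ψ := rfl
theorem mPart_add (ψ φ : S.PI → ℝ) : S.mPart (ψ + φ) = S.mPart ψ + S.mPart φ := rfl
theorem mPart_sub (ψ φ : S.PI → ℝ) : S.mPart (ψ - φ) = S.mPart ψ - S.mPart φ := rfl
theorem mPart_smul (c : ℝ) (ψ : S.PI → ℝ) : S.mPart (c • ψ) = c • S.mPart ψ := rfl
theorem zPart_add (ψ φ : S.PI → ℝ) : S.zPart (ψ + φ) = S.zPart ψ + S.zPart φ := rfl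
theorem zPart_sub (ψ φ : S.PI → ℝ) : S.zPart (ψ - φ) = S.zPart ψ - S.zPart φ := rfl
theorem zPart_smul (c : ℝ) (ψ : S.PI → ℝ) : S.zPart (c • ψ) = c • S.zPart ψ := rfl

-- All randomness and nonlinearity of the first step sits in the own decisions; the rest is affine.
-- This turns an error in the decisions into an error of the same order in the whole vector.
set_option maxHeartbeats 1000000 in
theorem completeStep_affine (c : ℝ) (ψ φ : S.PI → ℝ) (v w : Idx G.n → ℝ) :
    S.completeStep (c • ψ + φ) (c • v + w) - S.completeStep 0 0 =
      c • (S.completeStep ψ v - S.completeStep 0 0) +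
        (S.completeStep φ w - S.completeStep 0 0) := by
  have z0Y : S.yPart 0 = 0 := rfl
  have z0L : S.lPart 0 = 0 := rfl
  have z0M : S.mPart 0 = 0 := rfl
  have z0Z : S.zPart 0 = 0 := rfl
  have n0 : ∀ (κ : Type) (i : Fin N) (a : κ), S.nbrDiff (0 : Fin N × κ → ℝ) i a = 0 := by
    intro κ i a; simp [nbrDiff]
  have e0 : ∀ (κ : Type) (i : Fin N) (a : κ), S.edgeFlow (0 : S.E × κ → ℝ) i a = 0 := by
    intro κ i a; simp [edgeFlow]
  have hY : S.yPart (S.completeStep (c • ψ + φ) (c • v + w) - S.completeStep 0 0) =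
      S.yPart (c • (S.completeStep ψ v - S.completeStep 0 0) +
        (S.completeStep φ w - S.completeStep 0 0)) := by
    ext ⟨i, q⟩
    simp only [yPart_add, mPart_add, yPart_sub, yPart_smul, mPart_smul, z0Y, z0M,
      Pi.add_apply, Pi.sub_apply, Pi.smul_apply,
      smul_eq_mul, yPart_completeStep, nbrDiff_add, nbrDiff_smul, edgeFlow_add, edgeFlow_smul,
      n0, e0, Pi.zero_apply]
    split_ifs <;> ring
  have hL : S.lPart (S.completeStep (c • ψ + φ) (c • v + w) - S.completeStep 0 0) =
      S.lPart (c • (S.completeStep ψ v - S.completeStep 0 0) +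
        (S.completeStep φ w - S.completeStep 0 0)) := by
    have oD : ∀ i, S.ownDecision (c • ψ + φ) i = c • S.ownDecision ψ i + S.ownDecision φ i :=
      fun _ => rfl
    have bl : ∀ i, block (c • v + w) i = c • block v i + block w i := fun _ => rfl
    have oD0 : ∀ i, S.ownDecision 0 i = 0 := fun _ => rfl
    have bl0 : ∀ i, block (0 : Idx G.n → ℝ) i = 0 := fun _ => rfl
    ext ⟨i, q⟩
    simp only [lPart_add, zPart_add, lPart_sub, lPart_smul, zPart_smul, z0L, z0Z,
      Pi.add_apply, Pi.sub_apply, Pi.smul_apply,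
      smul_eq_mul, lPart_completeStep, nbrDiff_add, nbrDiff_smul, edgeFlow_add, edgeFlow_smul,
      n0, e0, Pi.zero_apply, oD, bl, oD0, bl0, Matrix.mulVec_sub, Matrix.mulVec_add,
      Matrix.mulVec_smul, Matrix.mulVec_zero]
    ring
  refine S.ext_parts hY hL ?_ ?_
  · ext ⟨e, q⟩
    have h1 := congrFun hY (e.1.2, q)
    have h2 := congrFun hY (e.1.1, q)
    simp only [yPart_add, mPart_add, yPart_sub, mPart_sub, yPart_smul, mPart_smul, z0Y, z0M,
      Pi.add_apply, Pi.sub_apply, Pi.smul_apply,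
      smul_eq_mul, mPart_completeStep, Pi.zero_apply] at h1 h2 ⊢
    linear_combination S.τ₃ e * (h1 - h2)
  · ext ⟨e, q⟩
    have h1 := congrFun hL (e.1.2, q)
    have h2 := congrFun hL (e.1.1, q)
    simp only [lPart_add, zPart_add, lPart_sub, zPart_sub, lPart_smul, zPart_smul, z0L, z0Z,
      Pi.add_apply, Pi.sub_apply, Pi.smul_apply,
      smul_eq_mul, zPart_completeStep, Pi.zero_apply] at h1 h2 ⊢
    linear_combination S.τ₄ e * (h1 - h2)

/-- The linear part of `completeStep`. -/
noncomputable def completeLin : ((S.PI → ℝ) × (Idx G.n → ℝ)) →ₗ[ℝ] (S.PI → ℝ) where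
  toFun p := S.completeStep p.1 p.2 - S.completeStep 0 0
  map_add' p q := by simpa using S.completeStep_affine 1 p.1 q.1 p.2 q.2
  map_smul' c p := by simpa using S.completeStep_affine c p.1 0 p.2 0

theorem completeStep_sub (ψ φ : S.PI → ℝ) (v w : Idx G.n → ℝ) :
    S.completeStep ψ v - S.completeStep φ w = S.completeLin (ψ - φ, v - w) := by
  rw [← Prod.mk_sub_mk, map_sub]
  simp [completeLin]

theorem continuous_completeStep :
    Continuous fun p : (S.PI → ℝ) × (Idx G.n → ℝ) => S.completeStep p.1 p.2 := by
  have : (fun p : (S.PI → ℝ) × (Idx G.n → ℝ) => S.completeStep p.1 p.2) =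
      fun p => S.completeLin p + S.completeStep 0 0 := by
    funext p; simp [completeLin]
  rw [this]
  exact (LinearMap.continuous_of_finiteDimensional _).add continuous_const

/-- The own decisions `v` solve the local problems of the exact first step. -/
def IsDecision (ψ : S.PI → ℝ) (v : Idx G.n → ℝ) : Prop :=
  ∀ i, block v i ∈ S.box i ∧
    ∃ g ∈ subdiff (fun w => G.EJ i (replaceBlock (S.estUpdate ψ i) i w)) (block v i),
      ∀ w ∈ S.box i, 0 ≤ (g + S.phiTilde ψ i + (S.τ₁ i)⁻¹ • (block v i - S.ownDecision ψ i)) ⬝ᵥ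
        (w - block v i)

theorem box_convex (i : Fin N) : Convex ℝ (S.box i) := convex_Icc _ _

theorem box_compact (i : Fin N) : IsCompact (S.box i) := isCompact_Icc

theorem box_nonempty (hX : G.FeasibleSets) (hS : S.Admissible) (i : Fin N) :
    (S.box i).Nonempty := (hX.nonempty i).mono (hS.subset_box i)

theorem exists_isDecision (hJ : G.ScenarioObjectives) (hX : G.FeasibleSets) (hS : S.Admissible)
    (ψ : S.PI → ℝ) : ∃ v, S.IsDecision ψ v := by
  choose v hv using fun i => exists_prox (Game.EJ_convex hJ i (S.estUpdate ψ i)) (S.box_convex i)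
    (S.box_compact i) (S.box_nonempty hX hS i) (inv_pos.2 (hS.τ₁_pos i)) (S.phiTilde ψ i)
    (S.ownDecision ψ i)
  exact ⟨fun p => v p.1 p.2, hv⟩

-- The term `τ₁⁻¹ ‖·‖²` makes each local problem strongly monotone.
variable {S} in
theorem IsDecision.eq (hS : S.Admissible) {ψ : S.PI → ℝ} {v w : Idx G.n → ℝ}
    (hv : S.IsDecision ψ v) (hw : S.IsDecision ψ w) : v = w := by
  have : ∀ i, block v i = block w i := by
    intro i
    obtain ⟨hv1, g, hg, hg'⟩ := hv i
    obtain ⟨hw1, h, hh, hh'⟩ := hw i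
    have h1 := variational_stability hv1 hw1 hg' hh'
    have h2 := subdiff_monotone hg hh
    have h3 : 0 < (S.τ₁ i)⁻¹ := inv_pos.2 (hS.τ₁_pos i)
    simp only [sub_self, smul_zero, add_zero, zero_dotProduct] at h1
    have h4 : norm2 (block v i - block w i) ^ 2 = 0 :=
      le_antisymm (by nlinarith) (sq_nonneg _)
    exact sub_eq_zero.1 (norm2_eq_zero.1 (pow_eq_zero_iff two_ne_zero |>.1 h4))
  funext p
  exact congrFun (this p.1) p.2

/-- The subgradient and the normal vector vanish on the blocks of estimates, so these are explicit;
the own blocks form the optimality conditions of the local problems; `λ`, `μ`, `z` follow by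
substitution in this order. -/
theorem mem_resolventSet_opA_iff (hS : S.Admissible) (ψ p : S.PI → ℝ) :
    p ∈ resolventSet (S.precond S.opA) ψ ↔
      ∃ v, S.IsDecision ψ v ∧ p = S.completeStep ψ v := by
  have hτ₁ : ∀ i, S.τ₁ i ≠ 0 := fun i => (hS.τ₁_pos i).ne'
  have hτ₂ : ∀ i, S.τ₂ i ≠ 0 := fun i => (hS.τ₂_pos i).ne'
  have hτ₃ : ∀ e, S.τ₃ e ≠ 0 := fun e => (hS.τ₃_pos e).ne'
  have hτ₄ : ∀ e, S.τ₄ e ≠ 0 := fun e => (hS.τ₄_pos e).ne'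
  have hB : ∀ ν y : S.YI → ℝ, ν ∈ normalCone S.hatXB y ↔ ∀ i,
      block (G.aug ν i) i ∈ normalCone (S.box i) (block (G.aug y i) i) ∧
        ∀ q : Idx G.n, q.1 ≠ i → ν (i, q) = 0 := fun ν y =>
    (normalCone_prod (C := fun i => {x : Idx G.n → ℝ | block x i ∈ S.box i})).trans
      (forall_congr' fun i => normalCone_block (K := S.box) (i := i))
  have hφ : ∀ i a, S.phiTilde ψ i a = 1 / 2 * ((S.Rᵀ *ᵥ (S.Lamᵀ *ᵥ S.lPart ψ)) (i, ⟨i, a⟩) +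
      S.ρμ * S.nbrDiff (S.yPart ψ) i ⟨i, a⟩ + S.edgeFlow (S.mPart ψ) i ⟨i, a⟩) := by
    intro i a
    simp only [phiTilde, R_transpose_mulVec, Lam_transpose_mulVec, Pi.smul_apply, Pi.add_apply,
      smul_eq_mul, block, if_true]
    ring
  constructor
  · rintro ⟨g, hg, ν, hν, h⟩
    obtain ⟨h1, h2, h3, h4⟩ := (S.Phi_mulVec_sub_eq_iff _ _ _ _).1 h
    rw [hB] at hν
    have hY : ∀ i q, S.yPart p (i, q) =
        S.yPart (S.completeStep ψ (S.own (S.yPart p))) (i, q) := by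
      intro i q
      rw [yPart_completeStep]
      split_ifs with hq
      · subst hq; rfl
      · have := h1 i q
        rw [Pi.add_apply, (hν i).2 q hq, R_transpose_mulVec, R_transpose_mulVec, if_neg hq,
          if_neg hq] at this
        have h5 := hτ₁ i
        field_simp at this ⊢
        linarith
    have hL : ∀ i q, S.lPart p (i, q) =
        S.lPart (S.completeStep ψ (S.own (S.yPart p))) (i, q) := by
      intro i q
      rw [lPart_completeStep, block_own, ← h2 i q]
      have h5 := hτ₂ i
      field_simp
      ring
    have haug : ∀ i, G.aug (S.yPart p) i =
        replaceBlock (S.estUpdate ψ i) i (block (S.own (S.yPart p)) i) := by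
      intro i
      rw [← aug_completeStep]
      funext q
      exact hY i q
    refine ⟨S.own (S.yPart p), fun i => ⟨(hν i).1.1, block g i, ?_, fun w hw => ?_⟩,
      S.ext_parts (funext fun ⟨i, q⟩ => hY i q) (funext fun ⟨i, q⟩ => hL i q)
        (funext fun ⟨e, q⟩ => ?_) (funext fun ⟨e, q⟩ => ?_)⟩
    · have := hg i
      rwa [haug, Game.partialSubdiff_replaceBlock] at this
    · have h5 := (hν i).1.2 w hw
      have h6 : block g i + S.phiTilde ψ i + (S.τ₁ i)⁻¹ • (block (S.own (S.yPart p)) i -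
          S.ownDecision ψ i) = -block (G.aug ν i) i := by
        funext a
        have := h1 i ⟨i, a⟩
        rw [Pi.add_apply, R_transpose_mulVec _ g, if_pos rfl] at this
        simp only [Pi.add_apply, Pi.smul_apply, Pi.sub_apply, smul_eq_mul, hφ, Pi.neg_apply]
        simp only [block, own, ownDecision, Game.aug] at this ⊢
        linarith
      rw [h6, neg_dotProduct]
      exact neg_nonneg.2 h5
    · rw [mPart_completeStep, ← hY, ← hY]
      have := h3 e q
      have h5 := hτ₃ e
      field_simp at this ⊢
      linarith
    · rw [zPart_completeStep, ← hL, ← hL]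
      have := h4 e q
      have h5 := hτ₄ e
      field_simp at this ⊢
      linarith
  · rintro ⟨v, hv, rfl⟩
    choose hv1 g hg hg' using hv
    have hb : ∀ i, block (G.aug (S.yPart (S.completeStep ψ v)) i) i = block v i := fun i => by
      rw [aug_completeStep, block_replaceBlock]
    -- The normal vector is forced: minus the residual of the local optimality condition on own
    -- blocks, zero on estimates.
    refine ⟨fun p => g p.1 p.2, fun i => ?_, fun q => if q.2.1 = q.1 then
      -(g q.2.1 + S.phiTilde ψ q.2.1 + (S.τ₁ q.2.1)⁻¹ • (block v q.2.1 - S.ownDecision ψ q.2.1))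
        q.2.2 else 0, ?_, ?_⟩
    · rw [aug_completeStep, Game.partialSubdiff_replaceBlock]
      exact hg i
    · rw [hB]
      intro i
      refine ⟨⟨by rw [hb]; exact hv1 i, fun w hw => ?_⟩, fun q hq => by simp [hq]⟩
      rw [hb]
      have h5 := hg' i w hw
      have h6 : block (G.aug (fun q : S.YI => if q.2.1 = q.1 then -(g q.2.1 + S.phiTilde ψ q.2.1 +
          (S.τ₁ q.2.1)⁻¹ • (block v q.2.1 - S.ownDecision ψ q.2.1)) q.2.2 else 0) i) i =
          -(g i + S.phiTilde ψ i + (S.τ₁ i)⁻¹ • (block v i - S.ownDecision ψ i)) := by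
        funext a
        simp [block, Game.aug]
      rw [h6, neg_dotProduct]
      exact neg_nonpos.2 h5
    · refine (S.Phi_mulVec_sub_eq_iff _ _ _ _).2 ⟨fun i q => ?_, fun i q => ?_, fun e q => ?_,
        fun e q => ?_⟩
      · rw [yPart_completeStep, Pi.add_apply, R_transpose_mulVec _ fun p => g p.1 p.2]
        by_cases hq : q.1 = i
        · obtain ⟨j, a⟩ := q
          simp only at hq
          subst hq
          simp only [if_true, Pi.add_apply, Pi.smul_apply, Pi.sub_apply, smul_eq_mul, hφ]
          simp only [block, ownDecision, Game.aug]
          ring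
        · rw [if_neg hq, if_neg hq, if_neg hq, R_transpose_mulVec, if_neg hq]
          have h5 := hτ₁ i
          field_simp
          ring
      · rw [lPart_completeStep, hb]
        have h5 := hτ₂ i
        field_simp
        ring
      · rw [mPart_completeStep]
        have h5 := hτ₃ e
        field_simp
        ring
      · rw [zPart_completeStep]
        have h5 := hτ₄ e
        field_simp
        ring

theorem existsUnique_resolvent_opA (hJ : G.ScenarioObjectives) (hX : G.FeasibleSets)
    (hS : S.Admissible) (ψ : S.PI → ℝ) : ∃! p, p ∈ resolventSet (S.precond S.opA) ψ := by
  obtain ⟨v, hv⟩ := S.exists_isDecision hJ hX hS ψ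
  refine ⟨S.completeStep ψ v, (S.mem_resolventSet_opA_iff hS _ _).2 ⟨v, hv, rfl⟩, fun p hp => ?_⟩
  obtain ⟨w, hw, rfl⟩ := (S.mem_resolventSet_opA_iff hS _ _).1 hp
  rw [hw.eq hS hv]

theorem extX_convex (hX : G.FeasibleSets) (i : Fin N) : Convex ℝ (S.extX i) := by
  intro x hx y hy a b ha hb hab
  exact hX.convex i hx hy ha hb hab

theorem extX_closed (hX : G.FeasibleSets) (i : Fin N) : IsClosed (S.extX i) :=
  (hX.compact i).isClosed.preimage (by unfold block; fun_prop)

theorem extX_nonempty (hX : G.FeasibleSets) (i : Fin N) : (S.extX i).Nonempty := by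
  obtain ⟨v, hv⟩ := hX.nonempty i
  exact ⟨replaceBlock 0 i v, by simpa [extX, block_replaceBlock] using hv⟩

theorem nonneg_convex (m : ℕ) : Convex ℝ {w : Fin m → ℝ | ∀ r, 0 ≤ w r} :=
  convex_Ici (0 : Fin m → ℝ)

theorem nonneg_closed (m : ℕ) : IsClosed {w : Fin m → ℝ | ∀ r, 0 ≤ w r} :=
  isClosed_Ici (a := (0 : Fin m → ℝ))

/-- The factor `τ` is the step size of a row of the resolvent equation: a cone absorbs it, so rows
with different step sizes all become plain projections. -/
theorem mem_normalCone_iff_eq_proj {ι : Type*} [Fintype ι] {C : Set (ι → ℝ)} (hC : Convex ℝ C)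
    (hcl : IsClosed C) (hne : C.Nonempty) {τ : ℝ} (hτ : 0 < τ) {u p ν : ι → ℝ}
    (h : u - p = τ • ν) : ν ∈ normalCone C p ↔ p = proj C u := by
  constructor
  · rintro ⟨hp, hν⟩
    refine eq_proj hC hcl hp fun v hv => ?_
    rw [h, smul_dotProduct, smul_eq_mul]
    exact mul_nonpos_of_nonneg_of_nonpos hτ.le (hν v hv)
  · rintro rfl
    obtain ⟨h1, h2⟩ := proj_spec hC hcl hne u
    refine ⟨h1, fun v hv => ?_⟩
    have := h2 v hv
    rw [h, smul_dotProduct, smul_eq_mul] at this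
    by_contra! hlt
    nlinarith [mul_pos hτ hlt]

/-- As for `𝔸`, but the nonlinear part consists of normal cones only, so each row is a projection or
an explicit formula. -/
theorem mem_resolventSet_opB_iff (hX : G.FeasibleSets) (hS : S.Admissible) (ψ p : S.PI → ℝ) :
    p ∈ resolventSet (S.precond S.opB) ψ ↔ p = S.barStep ψ := by
  set u : Fin N → Idx G.n → ℝ := fun i => G.aug (S.yPart ψ) i - (S.τ₁ i / 2) •
      ((fun p => (S.Rᵀ *ᵥ (S.Lamᵀ *ᵥ S.lPart ψ)) (i, p)) +
        S.ρμ • S.nbrDiff (S.yPart ψ) i + S.edgeFlow (S.mPart ψ) i) with hu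
  set w : (S.YI → ℝ) → Fin N → Fin G.m → ℝ := fun y i => fun r =>
      S.lPart ψ (i, r) + S.τ₂ i *
        ((G.A i *ᵥ (block (G.aug y i) i - (1 / 2 : ℝ) • S.ownDecision ψ i)) r
        - S.ρz / 2 * S.nbrDiff (S.lPart ψ) i r
        - 1 / 2 * S.edgeFlow (S.zPart ψ) i r) with hw
  have hbar : p = S.barStep ψ ↔
      (∀ i, G.aug (S.yPart p) i = proj (S.extX i) (u i)) ∧
      (∀ i, (fun r => S.lPart p (i, r)) =
        proj {w : Fin G.m → ℝ | ∀ r, 0 ≤ w r} (w (S.yPart p) i)) ∧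
      (∀ e q, S.mPart p (e, q) = S.mPart ψ (e, q) + S.τ₃ e *
        ((S.yPart p (e.1.2, q) - S.yPart p (e.1.1, q)) -
          1 / 2 * (S.yPart ψ (e.1.2, q) - S.yPart ψ (e.1.1, q)))) ∧
      (∀ e q, S.zPart p (e, q) = S.zPart ψ (e, q) + S.τ₄ e *
        ((S.lPart p (e.1.2, q) - S.lPart p (e.1.1, q)) -
          1 / 2 * (S.lPart ψ (e.1.2, q) - S.lPart ψ (e.1.1, q)))) := by
    constructor
    · rintro rfl
      exact ⟨fun _ => rfl, fun _ => rfl, fun _ _ => rfl, fun _ _ => rfl⟩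
    · rintro ⟨h1, h2, h3, h4⟩
      have hy : S.yPart p = S.yPart (S.barStep ψ) := by
        funext ⟨i, q⟩
        exact congrFun (h1 i) q
      have hl : S.lPart p = S.lPart (S.barStep ψ) := by
        funext ⟨i, q⟩
        have := congrFun (h2 i) q
        rw [hy] at this
        exact this
      refine S.ext_parts hy hl ?_ ?_
      · funext ⟨e, q⟩
        rw [h3, hy]
        rfl
      · funext ⟨e, q⟩
        rw [h4, hl]
        rfl
  have hin : ∀ ν y : S.YI → ℝ, ν ∈ normalCone S.hatX y ↔
      ∀ i, G.aug ν i ∈ normalCone (S.extX i) (G.aug y i) :=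
    fun ν y => normalCone_prod (C := S.extX)
  have hinl : ∀ η l : S.LI → ℝ, η ∈ normalCone {l : S.LI → ℝ | ∀ q, 0 ≤ l q} l ↔
      ∀ i, (fun r => η (i, r)) ∈ normalCone {w : Fin G.m → ℝ | ∀ r, 0 ≤ w r}
        fun r => l (i, r) := by
    intro η l
    have := normalCone_prod (ι := Fin N) (C := fun _ => {w : Fin G.m → ℝ | ∀ r, 0 ≤ w r})
      (ν := η) (y := l)
    rw [← this]
    simp only [Set.mem_ofPred_eq, Prod.forall]
  have hne : ({w : Fin G.m → ℝ | ∀ r, 0 ≤ w r}).Nonempty := ⟨0, fun _ => le_rfl⟩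
  have key1 : ∀ (ν : S.YI → ℝ), (∀ i q, (S.τ₁ i)⁻¹ * (S.yPart ψ (i, q) - S.yPart p (i, q)) -
        1 / 2 * ((S.Rᵀ *ᵥ (S.Lamᵀ *ᵥ S.lPart ψ)) (i, q) + S.ρμ * S.nbrDiff (S.yPart ψ) i q +
          S.edgeFlow (S.mPart ψ) i q) = ν (i, q)) →
      (ν ∈ normalCone S.hatX (S.yPart p) ↔
        ∀ i, G.aug (S.yPart p) i = proj (S.extX i) (u i)) := by
    intro ν h
    rw [hin]
    refine forall_congr' fun i => mem_normalCone_iff_eq_proj (S.extX_convex hX i)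
      (S.extX_closed hX i) (S.extX_nonempty hX i) (hS.τ₁_pos i) ?_
    funext q
    have := h i q
    have h5 := (hS.τ₁_pos i).ne'
    simp only [hu, Game.aug, Pi.sub_apply, Pi.smul_apply, Pi.add_apply, smul_eq_mul, ← this]
    field_simp
    ring
  have key2 : ∀ (η : S.LI → ℝ), (∀ i q, (S.τ₂ i)⁻¹ * (S.lPart ψ (i, q) - S.lPart p (i, q)) +
        (G.A i *ᵥ (block (G.aug (S.yPart p) i) i - (1 / 2 : ℝ) • S.ownDecision ψ i)) q -
          S.ρz / 2 * S.nbrDiff (S.lPart ψ) i q - 1 / 2 * S.edgeFlow (S.zPart ψ) i q = η (i, q)) →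
      (η ∈ normalCone {l : S.LI → ℝ | ∀ q, 0 ≤ l q} (S.lPart p) ↔
        ∀ i, (fun r => S.lPart p (i, r)) =
          proj {w : Fin G.m → ℝ | ∀ r, 0 ≤ w r} (w (S.yPart p) i)) := by
    intro η h
    rw [hinl]
    refine forall_congr' fun i => mem_normalCone_iff_eq_proj (nonneg_convex _)
      (nonneg_closed _) hne (hS.τ₂_pos i) ?_
    funext q
    have := h i q
    have h5 := (hS.τ₂_pos i).ne'
    simp only [hw, Pi.sub_apply, Pi.smul_apply, smul_eq_mul, ← this]
    field_simp
    ring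
  rw [hbar]
  constructor
  · rintro ⟨ν, hν, η, hη, h⟩
    obtain ⟨h1, h2, h3, h4⟩ := (S.Phi_mulVec_sub_eq_iff _ _ _ _).1 h
    refine ⟨(key1 ν h1).1 hν, (key2 η h2).1 hη, fun e q => ?_, fun e q => ?_⟩
    · have := h3 e q
      have h5 := (hS.τ₃_pos e).ne'
      field_simp at this ⊢
      linarith
    · have := h4 e q
      have h5 := (hS.τ₄_pos e).ne'
      field_simp at this ⊢
      linarith
  · rintro ⟨h1, h2, h3, h4⟩
    -- The normal vectors are defined as the residuals of the first two rows, which makes these rows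
    -- hold by definition.
    refine ⟨fun q => (S.τ₁ q.1)⁻¹ * (S.yPart ψ (q.1, q.2) - S.yPart p (q.1, q.2)) -
        1 / 2 * ((S.Rᵀ *ᵥ (S.Lamᵀ *ᵥ S.lPart ψ)) (q.1, q.2) +
          S.ρμ * S.nbrDiff (S.yPart ψ) q.1 q.2 + S.edgeFlow (S.mPart ψ) q.1 q.2),
      (key1 _ fun i q => rfl).2 h1,
      fun q => (S.τ₂ q.1)⁻¹ * (S.lPart ψ (q.1, q.2) - S.lPart p (q.1, q.2)) +
        (G.A q.1 *ᵥ (block (G.aug (S.yPart p) q.1) q.1 - (1 / 2 : ℝ) • S.ownDecision ψ q.1)) q.2 -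
          S.ρz / 2 * S.nbrDiff (S.lPart ψ) q.1 q.2 - 1 / 2 * S.edgeFlow (S.zPart ψ) q.1 q.2,
      (key2 _ fun i q => rfl).2 h2,
      (S.Phi_mulVec_sub_eq_iff _ _ _ _).2 ⟨fun _ _ => rfl, fun _ _ => rfl, fun e q => ?_,
        fun e q => ?_⟩⟩
    · rw [h3]
      have h5 := (hS.τ₃_pos e).ne'
      field_simp
      ring
    · rw [h4]
      have h5 := (hS.τ₄_pos e).ne'
      field_simp
      ring

theorem existsUnique_resolvent_opB (hX : G.FeasibleSets) (hS : S.Admissible) (ψ : S.PI → ℝ) :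
    ∃! p, p ∈ resolventSet (S.precond S.opB) ψ :=
  ⟨S.barStep ψ, (S.mem_resolventSet_opB_iff hX hS _ _).2 rfl,
    fun _ hp => (S.mem_resolventSet_opB_iff hX hS _ _).1 hp⟩

end Setup

theorem resolvent_eq_iff {ι : Type*} {T : (ι → ℝ) → Set (ι → ℝ)} {x p : ι → ℝ}
    (h : ∃! p, p ∈ resolventSet T x) : resolvent T x = p ↔ p ∈ resolventSet T x := by
  have h1 : resolvent T x ∈ resolventSet T x :=
    Classical.epsilon_spec (p := fun p => p ∈ resolventSet T x) h.exists
  exact ⟨fun e => e ▸ h1, fun hp => h.unique h1 hp⟩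

/-! ### The metric of `Φ` as a Euclidean norm. -/

section Quadratic

/-- Writing `M = Bᴴ B` turns the quadratic form into a Euclidean norm pulled back along `B`, so the
ordinary inner product identities apply to `normK`. -/
theorem _root_.Matrix.PosDef.exists_linearMap {ι : Type*} [Fintype ι] [DecidableEq ι]
    {M : Matrix ι ι ℝ} (hM : M.PosDef) :
    ∃ L : (ι → ℝ) →ₗ[ℝ] EuclideanSpace ℝ ι, Function.Injective L ∧
      ∀ v w, inner ℝ (L v) (L w) = v ⬝ᵥ (M *ᵥ w) := by
  open scoped MatrixOrder Matrix.Norms.L2Operator in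
  obtain ⟨B, hB⟩ := CStarAlgebra.nonneg_iff_eq_star_mul_self.1 hM.posSemidef.nonneg
  have hin : ∀ v w : ι → ℝ, inner ℝ (WithLp.toLp 2 (B *ᵥ v)) (WithLp.toLp 2 (B *ᵥ w)) =
      v ⬝ᵥ (M *ᵥ w) := by
    intro v w
    rw [inner_toLp, hB, ← Matrix.mulVec_mulVec, Matrix.dotProduct_mulVec v,
      Matrix.star_eq_conjTranspose, Matrix.conjTranspose_eq_transpose_of_trivial,
      Matrix.vecMul_transpose]
  let L : (ι → ℝ) →ₗ[ℝ] EuclideanSpace ℝ ι :=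
    (WithLp.linearEquiv 2 ℝ (ι → ℝ)).symm.toLinearMap ∘ₗ B.mulVecLin
  refine ⟨L, ?_, hin⟩
  refine (injective_iff_map_eq_zero L).2 fun v hv => ?_
  by_contra hne
  have h1 := hM.dotProduct_mulVec_pos hne
  have h2 : inner ℝ (L v) (L v) = v ⬝ᵥ (M *ᵥ v) := hin v v
  rw [hv, inner_zero_left] at h2
  simp only [star_trivial] at h1
  linarith

theorem _root_.LinearMap.exists_norm_bounds {V H : Type*} [NormedAddCommGroup V] [NormedSpace ℝ V]
    [FiniteDimensional ℝ V] [NormedAddCommGroup H] [NormedSpace ℝ H] (L : V →ₗ[ℝ] H)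
    (hL : Function.Injective L) :
    ∃ c C : ℝ, 0 < c ∧ 0 < C ∧ ∀ v, ‖v‖ ≤ c * ‖L v‖ ∧ ‖L v‖ ≤ C * ‖v‖ := by
  obtain ⟨K, hK, hL'⟩ := L.exists_antilipschitzWith (LinearMap.ker_eq_bot.2 hL)
  refine ⟨K, ‖LinearMap.toContinuousLinearMap L‖ + 1, by exact_mod_cast hK, by positivity,
    fun v => ⟨?_, ?_⟩⟩
  · simpa [dist_eq_norm] using hL'.le_mul_dist v 0
  · refine ((LinearMap.toContinuousLinearMap L).le_opNorm v).trans ?_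
    gcongr
    linarith

end Quadratic

/-! ### Monotonicity in the metric of `Φ`. -/

namespace Setup

variable {N : ℕ} {G : Game N} {S : Setup G}

theorem exists_normK_eq (hS : S.Admissible) :
    ∃ L : (S.PI → ℝ) →ₗ[ℝ] EuclideanSpace ℝ S.PI, Function.Injective L ∧
      (∀ v w, inner ℝ (L v) (L w) = v ⬝ᵥ (S.Phi *ᵥ w)) ∧ ∀ v, S.normK v = ‖L v‖ := by
  obtain ⟨L, h1, h2⟩ := hS.posDef.exists_linearMap
  refine ⟨L, h1, h2, fun v => ?_⟩
  rw [normK, ← h2, real_inner_self_eq_norm_sq, Real.sqrt_sq (norm_nonneg _)]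

theorem normK_sub_le (hS : S.Admissible) {a b : S.PI → ℝ} (h : 0 ≤ a ⬝ᵥ (S.Phi *ᵥ b)) :
    S.normK a ≤ S.normK (a + b) ∧ S.normK (a - b) ≤ S.normK (a + b) := by
  obtain ⟨L, -, h2, h3⟩ := exists_normK_eq hS
  rw [← h2] at h
  simp only [h3, map_sub, map_add]
  constructor
  · refine (pow_le_pow_iff_left₀ (norm_nonneg _) (norm_nonneg _) two_ne_zero).1 ?_
    rw [norm_add_sq_real]
    nlinarith [sq_nonneg ‖L b‖]
  · refine (pow_le_pow_iff_left₀ (norm_nonneg _) (norm_nonneg _) two_ne_zero).1 ?_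
    rw [norm_add_sq_real, norm_sub_sq_real]
    linarith

/-- With `a = p - q` and `b = (ψ - p) - (φ - q)`, the sum `a + b` is `ψ - φ`, the difference `a - b`
is that of the reflections, and monotonicity is `⟨a, b⟩ ≥ 0`. Only the one pair of points enters,
which allows operators that are monotone only at some pairs. -/
theorem normK_resolvent_le (hS : S.Admissible) {ψ φ p q : S.PI → ℝ}
    (h : 0 ≤ (S.Phi *ᵥ (ψ - p) - S.Phi *ᵥ (φ - q)) ⬝ᵥ (p - q)) :
    S.normK (p - q) ≤ S.normK (ψ - φ) ∧
      S.normK (((2 : ℝ) • p - ψ) - ((2 : ℝ) • q - φ)) ≤ S.normK (ψ - φ) := by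
  rw [← Matrix.mulVec_sub, dotProduct_comm] at h
  have h1 := normK_sub_le hS h
  have h2 : (p - q) + ((ψ - p) - (φ - q)) = ψ - φ := by abel
  have h3 : (p - q) - ((ψ - p) - (φ - q)) = ((2 : ℝ) • p - ψ) - ((2 : ℝ) • q - φ) := by
    rw [two_smul, two_smul]; abel
  rwa [h2, h3] at h1

theorem normalCone_monotone {ι : Type*} [Fintype ι] {C : Set (ι → ℝ)} {x y u v : ι → ℝ}
    (hu : u ∈ normalCone C x) (hv : v ∈ normalCone C y) : 0 ≤ (u - v) ⬝ᵥ (x - y) := by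
  have h1 := hu.2 y hv.1
  have h2 := hv.2 x hu.1
  simp only [sub_dotProduct, dotProduct_sub] at *
  linarith

theorem dotProduct_D_nonneg (hS : S.Admissible) (ψ : S.PI → ℝ) :
    S.ρμ / 2 * ((S.Ln *ᵥ S.yPart ψ) ⬝ᵥ S.yPart ψ) ≤ (S.D *ᵥ ψ) ⬝ᵥ ψ ∧
      0 ≤ S.ρμ / 2 * ((S.Ln *ᵥ S.yPart ψ) ⬝ᵥ S.yPart ψ) := by
  rw [dotProduct_D]
  have h1 := S.dotProduct_kronL_nonneg (S.yPart ψ)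
  have h2 := S.dotProduct_kronL_nonneg (S.lPart ψ)
  rw [dotProduct_comm] at h1 h2
  have := hS.ρμ_nonneg
  have := hS.ρz_nonneg
  constructor
  · have : 0 ≤ S.ρz / 2 * ((S.Lm *ᵥ S.lPart ψ) ⬝ᵥ S.lPart ψ) := mul_nonneg (by linarith) h2
    linarith
  · exact mul_nonneg (by linarith) h1

theorem opB_monotone (hS : S.Admissible) : IsMonotone S.opB := by
  rintro p q _ ⟨ν, hν, η, hη, rfl⟩ _ ⟨ν', hν', η', hη', rfl⟩
  have h1 := normalCone_monotone hν hν'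
  have h2 := normalCone_monotone hη hη'
  obtain ⟨h3, h4⟩ := dotProduct_D_nonneg hS (p - q)
  rw [add_sub_add_comm, ← Matrix.mulVec_sub, add_dotProduct,
    S.dotProduct_stack (S.stack _ _ _ _ - _)]
  simp only [yPart_sub, lPart_sub, mPart_sub, zPart_sub, yPart_stack, lPart_stack, mPart_stack,
    zPart_stack, sub_self, zero_dotProduct] at *
  linarith

/-- Monotonicity of the smoothed extended pseudogradient between the points `y` and `y'`. -/
def PairMonotone (S : Setup G) (y y' : S.YI → ℝ) : Prop :=
  ∀ g ∈ G.extPseudograd y, ∀ g' ∈ G.extPseudograd y',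
    0 ≤ (g - g') ⬝ᵥ (S.own y - S.own y') + S.ρμ / 2 * ((S.Ln *ᵥ (y - y')) ⬝ᵥ (y - y'))

theorem R_transpose_dotProduct (g : Idx G.n → ℝ) (y : S.YI → ℝ) :
    (S.Rᵀ *ᵥ g) ⬝ᵥ y = g ⬝ᵥ S.own y := by
  rw [dotProduct_comm, Matrix.dotProduct_mulVec, Matrix.vecMul_transpose, R_mulVec_eq,
    dotProduct_comm]

/-- Half of the smoothing `ρμ Ln` sits in `𝔸` through `D`; this is the Laplacian term of
`PairMonotone`. -/
theorem opA_pairMonotone (hS : S.Admissible) {p q : S.PI → ℝ}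
    (h : S.PairMonotone (S.yPart p) (S.yPart q)) {u v : S.PI → ℝ} (hu : u ∈ S.opA p)
    (hv : v ∈ S.opA q) : 0 ≤ (u - v) ⬝ᵥ (p - q) := by
  obtain ⟨g, hg, ν, hν, rfl⟩ := hu
  obtain ⟨g', hg', ν', hν', rfl⟩ := hv
  have h1 := normalCone_monotone hν hν'
  obtain ⟨h3, h4⟩ := dotProduct_D_nonneg hS (p - q)
  have h5 := h g hg g' hg'
  have h6 : S.own (S.yPart p) - S.own (S.yPart q) = S.own (S.yPart p - S.yPart q) := rfl
  rw [h6, ← R_transpose_dotProduct, Matrix.mulVec_sub] at h5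
  rw [add_sub_add_comm, ← Matrix.mulVec_sub, add_dotProduct,
    S.dotProduct_stack (S.stack _ _ _ _ - _)]
  simp only [yPart_sub, lPart_sub, mPart_sub, zPart_sub, yPart_stack, lPart_stack, mPart_stack,
    zPart_stack, sub_self, zero_dotProduct, add_sub_add_comm, add_dotProduct] at *
  linarith

theorem ConvergenceI.pairMonotone (h : S.ConvergenceI) (y y' : S.YI → ℝ) : S.PairMonotone y y' := by
  intro g hg g' hg'
  have := h.1 y y' _ ⟨g, hg, rfl⟩ _ ⟨g', hg', rfl⟩
  rw [add_sub_add_comm, ← Matrix.mulVec_sub, ← smul_sub, ← Matrix.mulVec_sub, add_dotProduct,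
    smul_dotProduct, R_transpose_dotProduct, smul_eq_mul] at this
  exact this

/-! ### Spectral gap of the Laplacian and restricted monotonicity. -/

section SpectralGap

theorem eq_of_edges (hc : S.Communicable) {u : Fin N → ℝ} (h : ∀ e : S.E, u e.1.2 = u e.1.1)
    (i j : Fin N) : u i = u j := by
  have := hc.connected.preconnected i j
  rw [SimpleGraph.reachable_iff_reflTransGen] at this
  induction this with
  | refl => rfl
  | tail _ hadj ih =>
    rw [ih]
    rw [SimpleGraph.fromRel_adj] at hadj
    rcases hadj.2 with hE | hE
    · exact (h ⟨_, hE⟩).symm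
    · exact h ⟨_, hE⟩

theorem B_transpose_mulVec (u : Fin N → ℝ) (e : S.E) :
    (S.Bᵀ *ᵥ u) e = u e.1.2 - u e.1.1 := by
  simp [Matrix.mulVec, dotProduct, B, sub_mul, Finset.sum_sub_distrib]

theorem dotProduct_L (u : Fin N → ℝ) : u ⬝ᵥ (S.L *ᵥ u) = (S.Bᵀ *ᵥ u) ⬝ᵥ (S.Bᵀ *ᵥ u) := by
  simp only [L, ← Matrix.mulVec_mulVec, Matrix.dotProduct_mulVec, Matrix.mulVec_transpose]

theorem kronL_mulVec_eq {κ : Type*} [Fintype κ] [DecidableEq κ] (v : Fin N × κ → ℝ) (i : Fin N)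
    (a : κ) : ((S.L ⊗ₖ (1 : Matrix κ κ ℝ)) *ᵥ v) (i, a) = (S.L *ᵥ fun i => v (i, a)) i := by
  simp [Matrix.mulVec, dotProduct, Fintype.sum_prod_type, Matrix.one_apply]

/-- Expand `u` in an eigenbasis of `L`. By connectedness a kernel eigenvector is constant, so its
coefficient is a multiple of `∑ u i = 0`; all other eigenvalues are at least the smallest positive
one. -/
theorem laplacian_bound (hc : S.Communicable) {K ρ : ℝ} (hρ : 0 ≤ ρ)
    (hσ : ∀ σ₁ : ℝ, IsLeast {σ : ℝ | 0 < σ ∧ Module.End.HasEigenvalue (Matrix.toLin' S.L) σ} σ₁ →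
      2 / σ₁ * K ≤ ρ) {u : Fin N → ℝ} (hu : ∑ i, u i = 0) :
    K * (u ⬝ᵥ u) ≤ ρ / 2 * ((S.L *ᵥ u) ⬝ᵥ u) := by
  have hsymm : S.Lᵀ = S.L := by simp [L]
  have hL : S.L.IsHermitian := by
    rw [Matrix.IsHermitian, Matrix.conjTranspose_eq_transpose_of_trivial, hsymm]
  set b := hL.eigenvectorBasis with hb
  have hmul : ∀ i, S.L *ᵥ (b i).ofLp = hL.eigenvalues i • (b i).ofLp :=
    fun i => hL.mulVec_eigenvectorBasis i
  set c : Fin N → ℝ := fun i => u ⬝ᵥ (b i).ofLp with hc'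
  have hbi : ∀ (w : Fin N → ℝ) i, inner ℝ (WithLp.toLp 2 w) (b i) = w ⬝ᵥ (b i).ofLp :=
    fun w i => inner_toLp w (b i).ofLp
  have h1 : u ⬝ᵥ u = ∑ i, c i * c i := by
    rw [← inner_toLp, ← b.sum_inner_mul_inner]
    refine Finset.sum_congr rfl fun i _ => ?_
    rw [real_inner_comm (WithLp.toLp 2 u) (b i), hbi]
  have h2 : (S.L *ᵥ u) ⬝ᵥ u = ∑ i, hL.eigenvalues i * (c i * c i) := by
    rw [← inner_toLp, ← b.sum_inner_mul_inner]
    refine Finset.sum_congr rfl fun i _ => ?_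
    rw [real_inner_comm (WithLp.toLp 2 u) (b i), hbi, hbi]
    have : (S.L *ᵥ u) ⬝ᵥ (b i).ofLp = hL.eigenvalues i * c i := by
      rw [dotProduct_comm, Matrix.dotProduct_mulVec, ← Matrix.mulVec_transpose, hsymm, hmul,
        smul_dotProduct, dotProduct_comm, smul_eq_mul]
    rw [this, mul_assoc]
  rw [h1, h2, Finset.mul_sum, Finset.mul_sum]
  refine Finset.sum_le_sum fun i _ => ?_
  have hne : (b i).ofLp ≠ 0 := by
    intro h
    have := b.orthonormal.ne_zero i
    exact this ((WithLp.ofLp_eq_zero 2).1 h)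
  have hnn : 0 ≤ hL.eigenvalues i := by
    have h3 := S.dotProduct_L (b i).ofLp
    rw [hmul, dotProduct_smul, ← norm2_sq, ← norm2_sq, smul_eq_mul] at h3
    have h4 : 0 < norm2 (b i).ofLp ^ 2 := by
      have : norm2 (b i).ofLp ≠ 0 := fun h => hne (norm2_eq_zero.1 h)
      positivity
    by_contra! hlt
    nlinarith [sq_nonneg (norm2 (S.Bᵀ *ᵥ (b i).ofLp)), mul_neg_of_neg_of_pos hlt h4]
  rcases hnn.eq_or_lt with h0 | hpos
  · have hB : S.Bᵀ *ᵥ (b i).ofLp = 0 := by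
      have h3 := S.dotProduct_L (b i).ofLp
      rw [hmul, ← h0, zero_smul, dotProduct_zero, ← norm2_sq] at h3
      exact norm2_eq_zero.1 (pow_eq_zero_iff two_ne_zero |>.1 h3.symm)
    have hconst := eq_of_edges hc (u := (b i).ofLp) fun e => by
      have := congrFun hB e
      rw [B_transpose_mulVec] at this
      simpa [sub_eq_zero] using this
    have hci : c i = 0 := by
      simp only [hc', dotProduct]
      rw [Finset.sum_congr rfl fun j _ => by rw [hconst j i], ← Finset.sum_mul, hu, zero_mul]
    simp [hci]
  · have hmem : hL.eigenvalues i ∈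
        {σ : ℝ | 0 < σ ∧ Module.End.HasEigenvalue (Matrix.toLin' S.L) σ} := by
      refine ⟨hpos, Module.End.hasEigenvalue_of_hasEigenvector (x := (b i).ofLp) ?_⟩
      rw [Module.End.hasEigenvector_iff, Module.End.mem_eigenspace_iff, Matrix.toLin'_apply]
      exact ⟨hmul i, hne⟩
    -- The hypothesis on `σ₁` is invoked only here, where a positive eigenvalue exists; finiteness
    -- of the spectrum then provides the least one.
    have hfin : {σ : ℝ | 0 < σ ∧ Module.End.HasEigenvalue (Matrix.toLin' S.L) σ}.Finite :=
      (Module.End.finite_hasEigenvalue (Matrix.toLin' S.L)).subset fun _ h => h.2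
    obtain ⟨σ, hσ1, hσ2⟩ := Set.exists_min_image _ id hfin ⟨_, hmem⟩
    have h3 := hσ σ ⟨hσ1, hσ2⟩
    have h4 : σ ≤ hL.eigenvalues i := hσ2 _ hmem
    have h5 : 0 < σ := hσ1.1
    have h6 : K ≤ ρ / 2 * hL.eigenvalues i := by
      rw [div_mul_eq_mul_div, div_le_iff₀ h5] at h3
      nlinarith
    rw [← mul_assoc (ρ / 2)]
    exact mul_le_mul_of_nonneg_right h6 (mul_self_nonneg _)

theorem kron_laplacian_bound (hc : S.Communicable) {κ : Type*} [Fintype κ] [DecidableEq κ]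
    {K ρ : ℝ} (hρ : 0 ≤ ρ)
    (hσ : ∀ σ₁ : ℝ, IsLeast {σ : ℝ | 0 < σ ∧ Module.End.HasEigenvalue (Matrix.toLin' S.L) σ} σ₁ →
      2 / σ₁ * K ≤ ρ) {v : Fin N × κ → ℝ} (hv : ∀ a, ∑ i, v (i, a) = 0) :
    K * norm2 v ^ 2 ≤ ρ / 2 * (((S.L ⊗ₖ (1 : Matrix κ κ ℝ)) *ᵥ v) ⬝ᵥ v) := by
  rw [norm2_sq]
  simp only [dotProduct, Fintype.sum_prod_type_right, kronL_mulVec_eq, Finset.mul_sum (s := Finset.univ (α := κ))]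
  exact Finset.sum_le_sum fun a _ => laplacian_bound hc hρ hσ (hv a)

end SpectralGap

theorem norm2_block_le {n : Fin N → ℕ} (x : Idx n → ℝ) (i : Fin N) :
    norm2 (block x i) ≤ norm2 x := by
  refine (pow_le_pow_iff_left₀ (norm2_nonneg _) (norm2_nonneg _) two_ne_zero).1 ?_
  rw [norm2_sq, norm2_sq, dotProduct_eq_sum_block]
  refine Finset.single_le_sum (f := fun i => block x i ⬝ᵥ block x i) (fun j _ => ?_)
    (Finset.mem_univ i)
  rw [← norm2_sq]
  positivity

theorem norm2_own_le (y : S.YI → ℝ) : norm2 (S.own y) ≤ norm2 y := by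
  refine (pow_le_pow_iff_left₀ (norm2_nonneg _) (norm2_nonneg _) two_ne_zero).1 ?_
  rw [norm2_sq, norm2_sq]
  simp only [dotProduct, Fintype.sum_prod_type_right, own]
  exact Finset.sum_le_sum fun p _ => Finset.single_le_sum (f := fun i => y (i, p) * y (i, p))
    (fun _ _ => mul_self_nonneg _) (Finset.mem_univ p.1)

/-- Split `y` into its average over players and the disagreement `v`, of norms `a` (relative to `x`)
and `b`. Strong monotonicity at the average contributes `η a²`, the Lipschitz bounds cost at most
`(θ₁ + θ₂) a b + θ₂ b²`, and the Laplacian pays for the terms in `b`. Consensus of the second point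
is essential: the Laplacian sees `v` alone. -/
theorem ConvergenceII.pairMonotone (hJ : G.ScenarioObjectives) (hc : S.Communicable)
    (hS : S.Admissible) (h : S.ConvergenceII) (y : S.YI → ℝ) (x : Idx G.n → ℝ) :
    S.PairMonotone y fun q => x q.2 := by
  obtain ⟨η, θ₁, θ₂, hη, hθ₁, hθ₂, hF, hE, hσ⟩ := h
  intro g hg g' hg'
  have hN : (0 : ℝ) < N := by
    obtain ⟨i⟩ := hc.connected.nonempty
    exact_mod_cast i.pos
  set xb : Idx G.n → ℝ := fun p => (N : ℝ)⁻¹ * ∑ i, y (i, p) with hxb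
  set Y : S.YI → ℝ := fun q => xb q.2 with hY
  set v : S.YI → ℝ := y - Y with hv
  obtain ⟨gb, hgb⟩ := Game.extPseudograd_nonempty hJ Y
  have hgb' : gb ∈ G.pseudograd xb := hgb
  have hg'' : g' ∈ G.pseudograd x := hg'
  -- At consensual points the extended pseudogradient is the pseudogradient itself, so `gb` serves
  -- both sets of Lipschitz bounds.
  obtain ⟨h1, h2⟩ := hF xb x gb hgb' g' hg''
  have h3 := hE y Y g hg gb hgb
  have hsum : ∀ p, ∑ i, v (i, p) = 0 := by
    intro p
    simp only [hv, Pi.sub_apply, hY, hxb, Finset.sum_sub_distrib, Finset.sum_const,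
      Finset.card_univ, Fintype.card_fin, nsmul_eq_mul]
    field_simp
    ring
  have h4 := kron_laplacian_bound hc hS.ρμ_nonneg hσ hsum
  have h5 : (S.Ln *ᵥ (y - fun q => x q.2)) ⬝ᵥ (y - fun q => x q.2) =
      ((S.L ⊗ₖ (1 : Matrix (Idx G.n) (Idx G.n) ℝ)) *ᵥ v) ⬝ᵥ v := by
    rw [dotProduct_comm, dotProduct_comm _ v, Ln, dotProduct_kronL, dotProduct_kronL]
    have : (S.B ⊗ₖ (1 : Matrix (Idx G.n) (Idx G.n) ℝ))ᵀ *ᵥ (y - fun q => x q.2) =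
        (S.B ⊗ₖ (1 : Matrix (Idx G.n) (Idx G.n) ℝ))ᵀ *ᵥ v := by
      funext ⟨e, p⟩
      simp only [kronB_transpose_mulVec, hv, hY, Pi.sub_apply]
      ring
    rw [this]
  have h6 : S.own y - S.own (fun q => x q.2) = (xb - x) + S.own v := by
    funext p
    simp only [own, hv, hY, Pi.sub_apply, Pi.add_apply]
    ring
  have h7 : g - g' = (g - gb) + (gb - g') := by abel
  rw [h5, h6, h7]
  have h8 := S.norm2_own_le v
  set a := norm2 (xb - x)
  set b := norm2 v
  have ha : 0 ≤ a := norm2_nonneg _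
  have hb : 0 ≤ b := norm2_nonneg _
  simp only [add_dotProduct, dotProduct_add]
  have e1 := neg_norm2_le_dotProduct (g - gb) (xb - x)
  have e2 := neg_norm2_le_dotProduct (g - gb) (S.own v)
  have e3 := neg_norm2_le_dotProduct (gb - g') (S.own v)
  have f1 : norm2 (g - gb) * a ≤ θ₂ * b * a := mul_le_mul_of_nonneg_right h3 ha
  have f2 : norm2 (g - gb) * norm2 (S.own v) ≤ θ₂ * b * b :=
    mul_le_mul h3 h8 (norm2_nonneg _) (by positivity)
  have f3 : norm2 (gb - g') * norm2 (S.own v) ≤ θ₁ * a * b :=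
    mul_le_mul h2 h8 (norm2_nonneg _) (by positivity)
  rw [dotProduct_comm] at h1
  -- Completing the square explains the constant `(θ₁ + θ₂)² / (4 η)`; the additional `θ₂` in the
  -- bound on `ρμ` absorbs `θ₂ b²`.
  have hsq : 0 ≤ η * a ^ 2 - (θ₁ + θ₂) * a * b + (θ₁ + θ₂) ^ 2 / (4 * η) * b ^ 2 := by
    have : η * a ^ 2 - (θ₁ + θ₂) * a * b + (θ₁ + θ₂) ^ 2 / (4 * η) * b ^ 2 =
        (2 * η * a - (θ₁ + θ₂) * b) ^ 2 / (4 * η) := by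
      field_simp
      ring
    rw [this]
    positivity
  nlinarith

end Setup

/-! ### Slater points and Lagrange multipliers. -/

namespace Game

variable {N : ℕ} {G : Game N}

/-- The coupling map `x ↦ Ax` as a linear map. -/
noncomputable def couplingLin (G : Game N) : (Idx G.n → ℝ) →ₗ[ℝ] (Fin G.m → ℝ) where
  toFun := G.coupling
  map_add' x y := by
    have : ∀ i, block (x + y) i = block x i + block y i := fun _ => rfl
    simp only [coupling, this, Matrix.mulVec_add, Finset.sum_add_distrib]
  map_smul' c x := by
    have : ∀ i, block (c • x) i = c • block x i := fun _ => rfl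
    simp only [coupling, this, Matrix.mulVec_smul, Finset.smul_sum, RingHom.id_apply]

theorem coupling_add (x y : Idx G.n → ℝ) : G.coupling (x + y) = G.coupling x + G.coupling y :=
  G.couplingLin.map_add x y

theorem coupling_sub (x y : Idx G.n → ℝ) : G.coupling (x - y) = G.coupling x - G.coupling y :=
  G.couplingLin.map_sub x y

theorem coupling_smul (c : ℝ) (x : Idx G.n → ℝ) : G.coupling (c • x) = c • G.coupling x :=
  G.couplingLin.map_smul c x

theorem continuous_coupling : Continuous G.coupling :=
  G.couplingLin.continuous_of_finiteDimensional

theorem localFeasible_convex (hX : G.FeasibleSets) : Convex ℝ G.localFeasible := by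
  intro x hx y hy a b ha hb hab i
  exact hX.convex i (hx i) (hy i) ha hb hab

/-- The Mangasarian-Fromovitz condition at a feasible point yields a Slater point. -/
theorem exists_slater (hX : G.FeasibleSets) {x : Idx G.n → ℝ} (hx : x ∈ G.feasible) :
    ∃ z ∈ G.localFeasible, ∀ r, G.coupling z r < G.c r := by
  obtain ⟨v, hv, hv'⟩ := hX.mfcq x hx
  obtain ⟨α, l, hl, c, d, -, hd, hcd⟩ := exists_fun_of_mem_tangentConeAt hv
  -- The tangent vector is a limit of `c n • d n` with `c n ≥ 0` and `x + d n` in the local set, so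
  -- for suitable `n` the displacement `d n` already decreases all active constraints.
  have h1 : ∀ᶠ n in l, ∀ r, G.coupling x r = G.c r → G.coupling (c n • d n) r < 0 := by
    refine Filter.eventually_all.2 fun r => ?_
    by_cases hr : G.coupling x r = G.c r
    · have h2 := (((continuous_apply r).comp G.continuous_coupling).tendsto v).comp hcd
      filter_upwards [h2.eventually (gt_mem_nhds (hv' r hr))] with n hn _ using hn
    · exact Filter.Eventually.of_forall fun _ h => absurd h hr
  obtain ⟨n, hn1, hn2⟩ := (hd.and h1).exists
  set w := d n
  have hw : ∀ r, G.coupling x r = G.c r → G.coupling w r < 0 := by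
    intro r hr
    have h3 := hn2 r hr
    have h4 : c n • w = (c n : ℝ) • w := rfl
    rw [h4, coupling_smul, Pi.smul_apply, smul_eq_mul] at h3
    by_contra! h5
    exact absurd h3 (not_lt.2 (mul_nonneg (c n).2 h5))
  -- A short move along `w` makes active constraints strict and keeps inactive ones strict by
  -- continuity.
  have h5 : ∀ᶠ t : ℝ in 𝓝[>] 0, ∀ r, G.coupling (x + t • w) r < G.c r := by
    refine Filter.eventually_all.2 fun r => ?_
    simp only [coupling_add, coupling_smul, Pi.add_apply, Pi.smul_apply, smul_eq_mul]
    rcases (hx.2 r).eq_or_lt with hr | hr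
    · filter_upwards [self_mem_nhdsWithin] with t ht
      have := mul_neg_of_pos_of_neg (show (0 : ℝ) < t from ht) (hw r hr)
      linarith
    · have hc : Continuous fun t : ℝ => G.coupling x r + t * G.coupling w r := by fun_prop
      have h6 := (hc.tendsto 0).mono_left (nhdsWithin_le_nhds (s := Set.Ioi 0))
      exact h6.eventually (gt_mem_nhds (by simpa using hr))
  have h6 : ∀ᶠ t : ℝ in 𝓝[>] 0, t ∈ Set.Ioc (0 : ℝ) 1 := Ioc_mem_nhdsGT one_pos
  obtain ⟨t, ht, ht'⟩ := (h5.and h6).exists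
  refine ⟨x + t • w, ?_, ht⟩
  have h7 := localFeasible_convex hX hx.1 hn1 (by linarith [ht'.2] : (0:ℝ) ≤ 1 - t) ht'.1.le
    (by ring)
  have h8 : (1 - t) • x + t • (x + w) = x + t • w := by
    rw [sub_smul, one_smul, smul_add]; abel
  rwa [h8] at h7

/-- Lagrange multipliers for the variational inequality over the shared feasible set. -/
theorem exists_multiplier (hX : G.FeasibleSets) {x g : Idx G.n → ℝ} (hx : x ∈ G.feasible)
    (hvi : ∀ z ∈ G.feasible, 0 ≤ (z - x) ⬝ᵥ g) :
    ∃ lam : Fin G.m → ℝ, (∀ r, 0 ≤ lam r) ∧ lam ⬝ᵥ (G.coupling x - G.c) = 0 ∧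
      ∀ z ∈ G.localFeasible, 0 ≤ g ⬝ᵥ (z - x) + lam ⬝ᵥ G.coupling (z - x) := by
  -- `K` collects the strict upper bounds on (constraint excess, change of the linearized
  -- objective). The variational inequality says exactly that the origin is not in it.
  set K : Set ((Fin G.m → ℝ) × ℝ) :=
    {p | ∃ z ∈ G.localFeasible, g ⬝ᵥ (z - x) < p.2 ∧ ∀ r, G.coupling z r - G.c r < p.1 r}
    with hK
  have hKc : Convex ℝ K := by
    rintro p ⟨z, hz, hz1, hz2⟩ q ⟨w, hw, hw1, hw2⟩ a b ha hb hab
    refine ⟨a • z + b • w, localFeasible_convex hX hz hw ha hb hab, ?_, fun r => ?_⟩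
    · have h1 : a • z + b • w - x = a • (z - x) + b • (w - x) := by
        have : x = (a + b) • x := by rw [hab, one_smul]
        conv_lhs => rw [this]
        module
      rw [h1, dotProduct_add, dotProduct_smul, dotProduct_smul]
      simp only [Prod.snd_add, Prod.smul_snd, smul_eq_mul]
      rcases ha.eq_or_lt with rfl | ha
      · rw [zero_add] at hab; subst hab; simpa using hw1
      · nlinarith [mul_lt_mul_of_pos_left hz1 ha, mul_le_mul_of_nonneg_left hw1.le hb]
    · simp only [coupling_add, coupling_smul, Prod.fst_add, Prod.smul_fst, Pi.add_apply,
        Pi.smul_apply, smul_eq_mul]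
      have h1 : G.c r = a * G.c r + b * G.c r := by rw [← add_mul, hab, one_mul]
      rcases ha.eq_or_lt with rfl | ha
      · rw [zero_add] at hab; subst hab; simpa using hw2 r
      · nlinarith [mul_lt_mul_of_pos_left (hz2 r) ha, mul_le_mul_of_nonneg_left (hw2 r).le hb]
  have hKo : IsOpen K := by
    have : K = ⋃ z ∈ G.localFeasible, ({p | g ⬝ᵥ (z - x) < p.2} ∩
        ⋂ r, {p : (Fin G.m → ℝ) × ℝ | G.coupling z r - G.c r < p.1 r}) := by
      ext p
      simp only [hK, Set.mem_ofPred_eq, Set.mem_iUnion, Set.mem_inter_iff, Set.mem_iInter,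
        exists_prop]
    rw [this]
    refine isOpen_biUnion fun z _ => (isOpen_lt continuous_const continuous_snd).inter
      (isOpen_iInter_of_finite fun r => isOpen_lt continuous_const (by fun_prop))
  have h0 : (0 : (Fin G.m → ℝ) × ℝ) ∉ K := by
    rintro ⟨z, hz, hz1, hz2⟩
    have := hvi z ⟨hz, fun r => by have := hz2 r; simp at this; exact this.le⟩
    rw [dotProduct_comm] at this
    exact absurd hz1 (not_lt.2 this)
  obtain ⟨φ, hφ⟩ := geometric_hahn_banach_open_point hKc hKo h0
  obtain ⟨α, b, hαb⟩ := continuousLinear_eq_dotProduct φ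
  have key : ∀ z ∈ G.localFeasible, ∀ u : Fin G.m → ℝ, ∀ s : ℝ, g ⬝ᵥ (z - x) < s →
      (∀ r, G.coupling z r - G.c r < u r) → α ⬝ᵥ u + b * s < 0 := by
    intro z hz u s h1 h2
    have := hφ (u, s) ⟨z, hz, h1, h2⟩
    rwa [hαb, map_zero] at this
  -- At a Slater point `u = 0` is admissible with some `s > 0`, so the functional is negative on the
  -- last axis; without it the multiplier could be at infinity.
  have hb : b < 0 := by
    obtain ⟨z, hz, hz'⟩ := exists_slater hX hx
    have := key z hz 0 (|g ⬝ᵥ (z - x)| + 1) (by linarith [le_abs_self (g ⬝ᵥ (z - x))])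
      (fun r => by simpa using hz' r)
    rw [dotProduct_zero, zero_add] at this
    by_contra! h
    exact absurd this (not_lt.2 (mul_nonneg h (by positivity)))
  have hα : ∀ r, α r ≤ 0 := by
    intro r
    by_contra! hr
    set s := α ⬝ᵥ (fun _ => 1) + b
    have h1 : (0 : ℝ) ≤ |s| / α r := by positivity
    -- Raising coordinate `r` by `|s| / α r` adds `|s|` to the functional and contradicts its
    -- negativity.
    have := key x hx.1 ((fun _ => 1) + Pi.single r (|s| / α r)) 1 (by simp) (fun r' => by
      have h2 := hx.2 r'
      have h3 : (0 : ℝ) ≤ (Pi.single r (|s| / α r) : Fin G.m → ℝ) r' := by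
        by_cases h : r' = r
        · subst h; simpa using h1
        · simp [h]
      simp only [Pi.add_apply]
      linarith)
    rw [dotProduct_add, dotProduct_single, mul_div_cancel₀ _ hr.ne', mul_one] at this
    have h4 : 0 ≤ s + |s| := by linarith [neg_abs_le s]
    simp only [s] at h4 this
    linarith
  have hlim : ∀ z ∈ G.localFeasible,
      α ⬝ᵥ (G.coupling z - G.c) + b * (g ⬝ᵥ (z - x)) ≤ 0 := by
    intro z hz
    have hc : Continuous fun ε : ℝ =>
        α ⬝ᵥ (G.coupling z - G.c + fun _ => ε) + b * (g ⬝ᵥ (z - x) + ε) := by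
      simp only [dotProduct]; fun_prop
    have h1 := (hc.tendsto 0).mono_left (nhdsWithin_le_nhds (s := Set.Ioi 0))
    have h2 := le_of_tendsto h1 (b := 0) (by
      filter_upwards [self_mem_nhdsWithin] with ε hε
      have hε' : (0 : ℝ) < ε := hε
      exact (key z hz _ _ (by linarith) fun r => by simpa using hε').le)
    have h3 : (fun _ => (0 : ℝ)) = (0 : Fin G.m → ℝ) := rfl
    simpa [h3] using h2
  have hlam : ∀ r, 0 ≤ (b⁻¹ • α) r := fun r =>
    mul_nonneg_of_nonpos_of_nonpos (inv_nonpos.2 hb.le) (hα r)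
  have hlim' : ∀ z ∈ G.localFeasible,
      0 ≤ (b⁻¹ • α) ⬝ᵥ (G.coupling z - G.c) + g ⬝ᵥ (z - x) := by
    intro z hz
    have h1 := mul_nonneg_of_nonpos_of_nonpos (inv_nonpos.2 hb.le) (hlim z hz)
    rwa [mul_add, ← mul_assoc, inv_mul_cancel₀ hb.ne, one_mul, ← smul_eq_mul b⁻¹,
      ← smul_dotProduct] at h1
  have hcomp : (b⁻¹ • α) ⬝ᵥ (G.coupling x - G.c) = 0 := by
    refine le_antisymm ?_ ?_
    · exact Finset.sum_nonpos fun r _ => mul_nonpos_of_nonneg_of_nonpos (hlam r)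
        (sub_nonpos.2 (hx.2 r))
    · simpa using hlim' x hx.1
  refine ⟨b⁻¹ • α, hlam, hcomp, fun z hz => ?_⟩
  have h1 := hlim' z hz
  have h2 : G.coupling z - G.c = G.coupling (z - x) + (G.coupling x - G.c) := by
    rw [coupling_sub]; abel
  rw [h2, dotProduct_add, hcomp] at h1
  linarith

end Game

/-! ### Zeros of `𝔸 + 𝔹` and variational equilibria. -/

namespace Setup

variable {N : ℕ} {G : Game N} {S : Setup G}

theorem dotProduct_consensus {κ : Type*} [Fintype κ] (v : Fin N × κ → ℝ) (d : κ → ℝ) :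
    v ⬝ᵥ (fun q => d q.2) = ∑ a, (∑ i, v (i, a)) * d a := by
  simp only [dotProduct, Fintype.sum_prod_type_right, Finset.sum_mul]

theorem kronB_transpose_consensus {κ : Type*} [Fintype κ] [DecidableEq κ] (d : κ → ℝ) :
    (S.B ⊗ₖ (1 : Matrix κ κ ℝ))ᵀ *ᵥ (fun q : Fin N × κ => d q.2) = 0 := by
  funext ⟨e, a⟩
  rw [kronB_transpose_mulVec]
  simp

theorem kronB_dotProduct_consensus {κ : Type*} [Fintype κ] [DecidableEq κ] (u : S.E × κ → ℝ)
    (d : κ → ℝ) :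
    ((S.B ⊗ₖ (1 : Matrix κ κ ℝ)) *ᵥ u) ⬝ᵥ (fun q : Fin N × κ => d q.2) = 0 := by
  rw [dotProduct_comm, Matrix.dotProduct_mulVec, ← Matrix.mulVec_transpose,
    kronB_transpose_consensus, zero_dotProduct]

theorem kronL_dotProduct_consensus {κ : Type*} [Fintype κ] [DecidableEq κ] (v : Fin N × κ → ℝ)
    (d : κ → ℝ) :
    ((S.L ⊗ₖ (1 : Matrix κ κ ℝ)) *ᵥ v) ⬝ᵥ (fun q : Fin N × κ => d q.2) = 0 := by
  rw [kronL_eq, ← Matrix.mulVec_mulVec, kronB_dotProduct_consensus]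

theorem kronL_consensus {κ : Type*} [Fintype κ] [DecidableEq κ] (d : κ → ℝ) :
    (S.L ⊗ₖ (1 : Matrix κ κ ℝ)) *ᵥ (fun q : Fin N × κ => d q.2) = 0 := by
  rw [kronL_eq, ← Matrix.mulVec_mulVec, kronB_transpose_consensus, Matrix.mulVec_zero]

theorem exists_consensus (hc : S.Communicable) {κ : Type*} [Fintype κ] [DecidableEq κ]
    {v : Fin N × κ → ℝ} (h : (S.B ⊗ₖ (1 : Matrix κ κ ℝ))ᵀ *ᵥ v = 0) :
    ∃ d : κ → ℝ, v = fun q => d q.2 := by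
  obtain ⟨i₀⟩ := hc.connected.nonempty
  refine ⟨fun a => v (i₀, a), funext fun ⟨i, a⟩ => ?_⟩
  refine eq_of_edges hc (u := fun i => v (i, a)) (fun e => ?_) i i₀
  have := congrFun h (e, a)
  rw [kronB_transpose_mulVec] at this
  exact sub_eq_zero.1 this

/-- Columns of `B` are differences of unit vectors along edges; telescoping along paths yields all
differences, and these span the vectors with zero sum. -/
theorem exists_B_mulVec (hc : S.Communicable) {u : Fin N → ℝ} (hu : ∑ i, u i = 0) :
    ∃ t, S.B *ᵥ t = u := by
  obtain ⟨i₀⟩ := hc.connected.nonempty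
  have hmem : ∀ j, (Pi.single j 1 - Pi.single i₀ 1 : Fin N → ℝ) ∈ LinearMap.range S.B.mulVecLin := by
    intro j
    have := hc.connected.preconnected i₀ j
    rw [SimpleGraph.reachable_iff_reflTransGen] at this
    induction this with
    | refl => simp
    | @tail b c _ hadj ih =>
      have he : (Pi.single c 1 - Pi.single b 1 : Fin N → ℝ) ∈ LinearMap.range S.B.mulVecLin := by
        have hcol : ∀ e : S.E, (Pi.single e.1.2 1 - Pi.single e.1.1 1 : Fin N → ℝ) ∈
            LinearMap.range S.B.mulVecLin := by
          intro e
          refine ⟨Pi.single e 1, ?_⟩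
          funext i
          simp [Matrix.mulVec_single, B, Matrix.col, Pi.single_apply, eq_comm]
        rw [SimpleGraph.fromRel_adj] at hadj
        rcases hadj.2 with hE | hE
        · exact hcol ⟨_, hE⟩
        · rw [← neg_sub]
          exact Submodule.neg_mem _ (hcol ⟨_, hE⟩)
      have := Submodule.add_mem _ he ih
      rwa [sub_add_sub_cancel] at this
  have hsum : u = ∑ j, u j • (Pi.single j 1 - Pi.single i₀ 1 : Fin N → ℝ) := by
    simp only [smul_sub, Finset.sum_sub_distrib, ← Finset.sum_smul, hu, zero_smul, sub_zero]
    funext i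
    simp [Finset.sum_apply, Pi.single_apply]
  have : u ∈ LinearMap.range S.B.mulVecLin := by
    rw [hsum]
    exact Submodule.sum_mem _ fun j _ => Submodule.smul_mem _ _ (hmem j)
  obtain ⟨t, ht⟩ := this
  exact ⟨t, ht⟩

theorem exists_kronB_mulVec (hc : S.Communicable) {κ : Type*} [Fintype κ] [DecidableEq κ]
    {v : Fin N × κ → ℝ} (hv : ∀ a, ∑ i, v (i, a) = 0) :
    ∃ z, (S.B ⊗ₖ (1 : Matrix κ κ ℝ)) *ᵥ z = v := by
  choose t ht using fun a => exists_B_mulVec hc (hv a)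
  refine ⟨fun q => t q.2 q.1, funext fun ⟨i, a⟩ => ?_⟩
  rw [← congrFun (ht a) i]
  simp [Matrix.mulVec, dotProduct, Fintype.sum_prod_type, Matrix.one_apply]

theorem Lam_transpose_consensus_dotProduct (lam : Fin G.m → ℝ) (x : Idx G.n → ℝ) :
    (S.Lamᵀ *ᵥ fun q : S.LI => lam q.2) ⬝ᵥ x = lam ⬝ᵥ G.coupling x := by
  rw [dotProduct_comm, Matrix.dotProduct_mulVec, Matrix.vecMul_transpose, dotProduct_consensus,
    dotProduct_comm]
  simp only [dotProduct, Game.coupling, Lam_mulVec, Finset.sum_apply]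

theorem sum_cloc_apply (hS : S.Admissible) (r : Fin G.m) : ∑ i, S.cloc i r = G.c r := by
  rw [← hS.sum_cloc, Finset.sum_apply]

/-- Zeros of `𝔸 + 𝔹` are consensual and yield variational equilibria. -/
theorem isVSGNE_of_zero (hc : S.Communicable) (hS : S.Admissible) {p w : S.PI → ℝ}
    (hA : w ∈ S.opA p) (hB : -w ∈ S.opB p) :
    ∃ x, G.IsVSGNE x ∧ S.yPart p = fun q => x q.2 := by
  obtain ⟨g, hg, ν', hν', hw⟩ := hA
  obtain ⟨ν, hν, η, hη, hw'⟩ := hB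
  have hsum : S.stack (S.Rᵀ *ᵥ g + ν' + ν) (fun q => S.cloc q.1 q.2 + η q) 0 0 +
      (2 : ℝ) • (S.D *ᵥ p) = 0 := by
    have h1 : S.stack (S.Rᵀ *ᵥ g + ν' + ν) (fun q => S.cloc q.1 q.2 + η q) 0 0 =
        S.stack (S.Rᵀ *ᵥ g + ν') (fun q => S.cloc q.1 q.2) 0 0 + S.stack ν η 0 0 := by
      rw [stack_add, add_zero, add_zero]; rfl
    have h2 : w + -w = 0 := add_neg_cancel w
    rw [hw, ← hw, hw', hw] at h2
    rw [h1, ← h2, two_smul]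
    abel
  rw [D_mulVec] at hsum
  have hY := congrArg S.yPart hsum
  have hL := congrArg S.lPart hsum
  have hM := congrArg S.mPart hsum
  have hZ := congrArg S.zPart hsum
  simp only [yPart_add, lPart_add, mPart_add, zPart_add, yPart_smul, lPart_smul, mPart_smul,
    zPart_smul, yPart_stack, lPart_stack, mPart_stack, zPart_stack, zero_add] at hY hL hM hZ
  have hM' : S.Bnᵀ *ᵥ S.yPart p = 0 := by
    have : S.Bnᵀ *ᵥ S.yPart p = -((2 : ℝ) • -((1 / 2 : ℝ) • (S.Bnᵀ *ᵥ S.yPart p))) := by module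
    rw [this, hM]; exact neg_zero
  have hZ' : S.Bmᵀ *ᵥ S.lPart p = 0 := by
    have : S.Bmᵀ *ᵥ S.lPart p = -((2 : ℝ) • -((1 / 2 : ℝ) • (S.Bmᵀ *ᵥ S.lPart p))) := by module
    rw [this, hZ]; exact neg_zero
  obtain ⟨x, hx⟩ := exists_consensus hc hM'
  obtain ⟨lam, hlam⟩ := exists_consensus hc hZ'
  rw [hx] at hg hν' hν hY hL
  rw [hlam] at hη hY hL
  -- Pairing the `λ` row with `1 ⊗ e` sums it over the players: the Laplacian and incidence terms
  -- vanish and the local `c_i` add up to `c`.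
  have hrow : ∀ e : Fin G.m → ℝ, e ⬝ᵥ (G.c - G.coupling x) + η ⬝ᵥ (fun q => e q.2) = 0 := by
    intro e
    have h1 : (0 : S.LI → ℝ) ⬝ᵥ (fun q : S.LI => e q.2) = 0 := zero_dotProduct _
    have h2 : S.lPart 0 = 0 := rfl
    rw [h2] at hL
    rw [← hL, add_dotProduct, smul_dotProduct, add_dotProduct, add_dotProduct, smul_dotProduct,
      smul_dotProduct, Lm, Bm, kronB_dotProduct_consensus, kronL_dotProduct_consensus,
      neg_dotProduct, smul_dotProduct, dotProduct_comm (S.Lam *ᵥ _), Matrix.dotProduct_mulVec,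
      ← Matrix.mulVec_transpose, Lam_transpose_consensus_dotProduct, R_mulVec_eq] at h1
    have h3 : (fun q : S.LI => S.cloc q.1 q.2 + η q) ⬝ᵥ (fun q : S.LI => e q.2) =
        e ⬝ᵥ G.c + η ⬝ᵥ (fun q : S.LI => e q.2) := by
      have : (fun q : S.LI => S.cloc q.1 q.2 + η q) = (fun q : S.LI => S.cloc q.1 q.2) + η := rfl
      rw [this, add_dotProduct, dotProduct_consensus]
      simp only [sum_cloc_apply hS]
      rw [dotProduct_comm e]
      rfl
    have h4 : S.own (fun q => x q.2) = x := rfl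
    rw [h3, h4] at h1
    simp only [smul_eq_mul, mul_zero, add_zero] at h1
    rw [dotProduct_sub]
    linarith
  have hηneg : ∀ q, η q ≤ 0 := by
    intro q
    have := hη.2 ((fun q => lam q.2) + Pi.single q 1) fun q' => by
      have h1 := hη.1 q'
      have h2 : (0 : ℝ) ≤ (Pi.single q 1 : S.LI → ℝ) q' := by
        by_cases h : q' = q
        · subst h; simp
        · simp [h]
      exact add_nonneg h1 h2
    rw [add_sub_cancel_left, dotProduct_single, mul_one] at this
    exact this
  have hcompl : η ⬝ᵥ (fun q => lam q.2) = 0 := by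
    have h1 := hη.2 0 fun q => le_rfl
    have h2 : η ⬝ᵥ (fun q => lam q.2) ≤ 0 := Finset.sum_nonpos fun q _ =>
      mul_nonpos_of_nonpos_of_nonneg (hηneg q) (hη.1 q)
    rw [zero_sub, dotProduct_neg] at h1
    linarith
  have hfeas : ∀ r, G.coupling x r ≤ G.c r := by
    intro r
    have h1 := hrow (Pi.single r 1)
    rw [single_dotProduct, one_mul, Pi.sub_apply] at h1
    have h2 : η ⬝ᵥ (fun q : S.LI => (Pi.single r 1 : Fin G.m → ℝ) q.2) ≤ 0 :=
      Finset.sum_nonpos fun q _ => mul_nonpos_of_nonpos_of_nonneg (hηneg q) (by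
        change (0 : ℝ) ≤ (Pi.single r 1 : Fin G.m → ℝ) q.2
        by_cases h : q.2 = r
        · rw [h]; simp
        · simp [h])
    linarith
  have hxX : x ∈ G.localFeasible := fun i => hν.1 i
  have hlam0 : ∀ r, 0 ≤ lam r := by
    obtain ⟨i₀⟩ := hc.connected.nonempty
    exact fun r => hη.1 (i₀, r)
  refine ⟨x, ⟨⟨hxX, hfeas⟩, g, hg, fun z hz => ?_⟩, hx⟩
  have hzX : (fun q : S.YI => z q.2) ∈ S.hatX := fun i => hz.1 i
  have hzB : (fun q : S.YI => z q.2) ∈ S.hatXB := fun i => hS.subset_box i (hz.1 i)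
  have hdiff : (fun q : S.YI => z q.2) - (fun q : S.YI => x q.2) = fun q => (z - x) q.2 := rfl
  have n1 := hν.2 _ hzX
  have n2 := hν'.2 _ hzB
  rw [hdiff] at n1 n2
  have h1 : (0 : S.YI → ℝ) ⬝ᵥ (fun q : S.YI => (z - x) q.2) = 0 := zero_dotProduct _
  have h2 : S.yPart 0 = 0 := rfl
  have h4 : S.own (fun q => (z - x) q.2) = z - x := rfl
  rw [h2] at hY
  rw [← hY] at h1
  simp only [add_dotProduct, smul_dotProduct, Ln, Bn, kronB_dotProduct_consensus,
    kronL_dotProduct_consensus, R_transpose_dotProduct, h4,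
    Lam_transpose_consensus_dotProduct] at h1
  simp only [smul_eq_mul, mul_zero, add_zero, zero_add] at h1
  have h5 := hrow lam
  rw [hcompl, add_zero] at h5
  -- Complementarity at `x` replaces `Ax` by `c`; feasibility of `z` and `lam ≥ 0` do the rest.
  have h6 : lam ⬝ᵥ G.coupling (z - x) ≤ 0 := by
    have h7 : G.coupling (z - x) = (G.coupling z - G.c) + (G.c - G.coupling x) := by
      rw [Game.coupling_sub]; abel
    rw [h7, dotProduct_add, h5, add_zero]
    exact Finset.sum_nonpos fun r _ => mul_nonpos_of_nonneg_of_nonpos (hlam0 r)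
      (sub_nonpos.2 (hz.2 r))
  rw [dotProduct_comm]
  linarith

/-- A variational equilibrium yields a zero of `𝔸 + 𝔹`. -/
theorem exists_zero_of_isVSGNE (hX : G.FeasibleSets) (hc : S.Communicable) (hS : S.Admissible)
    {x : Idx G.n → ℝ} (hx : G.IsVSGNE x) :
    ∃ p w : S.PI → ℝ, w ∈ S.opA p ∧ -w ∈ S.opB p := by
  obtain ⟨hxf, g, hg, hvi⟩ := hx
  obtain ⟨lam, hlam, hcomp, hkkt⟩ := Game.exists_multiplier hX hxf hvi
  have hN : (N : ℝ) ≠ 0 := by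
    obtain ⟨i⟩ := hc.connected.nonempty
    exact_mod_cast i.pos.ne'
  -- Sharing the slack `Ax - c` equally makes `lrow` sum to zero over players, so some `z` has `Bm z
  -- = lrow`. With equal copies of `x` and of `lam`, `μ = 0` suffices.
  set η : S.LI → ℝ := fun q => (N : ℝ)⁻¹ * (G.coupling x q.2 - G.c q.2) with hη
  set lrow : S.LI → ℝ := S.Lam *ᵥ x - (fun q => S.cloc q.1 q.2) - η with hlrow
  have hsum : ∀ r, ∑ i, lrow (i, r) = 0 := by
    intro r
    have h1 : ∑ i, (S.Lam *ᵥ x) (i, r) = G.coupling x r := by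
      simp only [Lam_mulVec, Game.coupling, Finset.sum_apply]
    simp only [hlrow, hη, Pi.sub_apply, Finset.sum_sub_distrib, h1, sum_cloc_apply hS,
      Finset.sum_const, Finset.card_univ, Fintype.card_fin, nsmul_eq_mul]
    field_simp
    ring
  obtain ⟨z, hz⟩ := exists_kronB_mulVec hc hsum
  set p : S.PI → ℝ := S.stack (fun q => x q.2) (fun q => lam q.2) 0 z with hp
  have hD : S.D *ᵥ p = S.stack
      ((1 / 2 : ℝ) • (S.Rᵀ *ᵥ (S.Lamᵀ *ᵥ fun q => lam q.2)))
      (-((1 / 2 : ℝ) • (S.Lam *ᵥ x)) + (1 / 2 : ℝ) • lrow) 0 0 := by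
    have h4 : S.own (fun q => x q.2) = x := rfl
    rw [D_mulVec]
    simp only [hp, yPart_stack, lPart_stack, mPart_stack, zPart_stack, Ln, Lm, Bn, Bm,
      kronL_consensus, kronB_transpose_consensus, hz, R_mulVec_eq, h4, Matrix.mulVec_zero,
      smul_zero, zero_add, add_zero, neg_zero]
  refine ⟨p, S.D *ᵥ p + S.stack (S.Rᵀ *ᵥ g + 0) (fun q => S.cloc q.1 q.2) 0 0,
    ⟨g, hg, 0, ⟨fun i => hS.subset_box i (hxf.1 i), by simp⟩, rfl⟩,
    -(S.Rᵀ *ᵥ (S.Lamᵀ *ᵥ fun q => lam q.2) + S.Rᵀ *ᵥ g), ⟨fun i => hxf.1 i, fun v hv => ?_⟩,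
    η, ⟨fun q => hlam q.2, fun l hl => ?_⟩, ?_⟩
  · have hv' : S.own v ∈ G.localFeasible := fun i => hv i
    have h1 := hkkt _ hv'
    have h2 : S.own (v - S.yPart p) = S.own v - x := rfl
    rw [neg_dotProduct, add_dotProduct, R_transpose_dotProduct, R_transpose_dotProduct, h2,
      Lam_transpose_consensus_dotProduct]
    linarith
  · have h1 : η ⬝ᵥ S.lPart p = 0 := by
      rw [hp, lPart_stack, dotProduct_comm, dotProduct]
      have h2 : ∑ q : S.LI, lam q.2 * η q = lam ⬝ᵥ (G.coupling x - G.c) := by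
        simp only [hη, Fintype.sum_prod_type_right, Finset.sum_const, Finset.card_univ,
          Fintype.card_fin, nsmul_eq_mul, dotProduct, Pi.sub_apply]
        refine Finset.sum_congr rfl fun r _ => ?_
        field_simp
      rw [h2, hcomp]
    rw [dotProduct_sub, h1, sub_zero]
    refine Finset.sum_nonpos fun q _ => mul_nonpos_of_nonpos_of_nonneg ?_ (hl q)
    exact mul_nonpos_of_nonneg_of_nonpos (by positivity) (sub_nonpos.2 (hxf.2 q.2))
  · rw [hD]
    refine S.ext_parts ?_ ?_ ?_ ?_ <;> funext q
    · simp only [yPart, Pi.neg_apply, Pi.add_apply, stack, Sum.elim_inl, Pi.smul_apply, smul_eq_mul,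
        Pi.zero_apply]
      ring
    · simp only [lPart, Pi.neg_apply, Pi.add_apply, stack, Sum.elim_inl, Sum.elim_inr,
        Pi.smul_apply, smul_eq_mul, hlrow, Pi.sub_apply]
      ring
    · simp [mPart, stack]
    · simp [zPart, stack]

end Setup

/-! ### Inexact Krasnosel'skii–Mann iteration. -/

theorem exists_tendsto_of_le_add {V e : ℕ → ℝ} (hV : ∀ k, 0 ≤ V k) (he : ∀ k, 0 ≤ e k)
    (hsum : Summable e) (h : ∀ k, V (k + 1) ≤ V k + e k) :
    (∀ k, V k ≤ V 0 + ∑' j, e j) ∧ ∃ l, Tendsto V atTop (𝓝 l) := by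
  set W : ℕ → ℝ := fun k => V k - ∑ j ∈ Finset.range k, e j with hW
  have hanti : Antitone W := antitone_nat_of_succ_le fun k => by
    simp only [hW, Finset.sum_range_succ]
    linarith [h k]
  have hle : ∀ k, ∑ j ∈ Finset.range k, e j ≤ ∑' j, e j := fun k =>
    hsum.sum_le_tsum _ fun j _ => he j
  constructor
  · intro k
    have h1 := hanti (Nat.zero_le k)
    simp only [hW, Finset.range_zero, Finset.sum_empty, sub_zero] at h1
    linarith [hle k]
  · have hbdd : BddBelow (Set.range W) := by
      refine ⟨-∑' j, e j, ?_⟩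
      rintro _ ⟨k, rfl⟩
      simp only [hW]
      linarith [hle k, hV k]
    have h1 := (tendsto_atTop_ciInf hanti hbdd).add hsum.hasSum.tendsto_sum_nat
    exact ⟨_, h1.congr fun k => by simp [hW]⟩

/-- Convergence of the inexact Krasnosel'skii-Mann iteration of a continuous quasi-nonexpansive map
in finite dimensions. -/
theorem krasnoselskii_mann {V H : Type*} [NormedAddCommGroup V] [NormedSpace ℝ V]
    [FiniteDimensional ℝ V] [NormedAddCommGroup H] [InnerProductSpace ℝ H] (L : V →ₗ[ℝ] H)
    (hL : Function.Injective L) {R : V → V} (hR : Continuous R)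
    (hfix : (Function.fixedPoints R).Nonempty)
    (hq : ∀ p ∈ Function.fixedPoints R, ∀ x, ‖L (R x - p)‖ ≤ ‖L (x - p)‖) {γ : ℕ → ℝ}
    (hγ : ∀ k, γ k ∈ Set.Icc (0 : ℝ) 1)
    (hγsum : Tendsto (fun K : ℕ => ∑ k ∈ Finset.range K, γ k * (1 - γ k)) atTop atTop)
    {x : ℕ → V} {e : ℕ → ℝ} (he : ∀ k, 0 ≤ e k) (hsum : Summable e)
    (hstep : ∀ k, ‖L (x (k + 1) - (x k + γ k • (R (x k) - x k)))‖ ≤ e k) :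
    ∃ p ∈ Function.fixedPoints R, Tendsto x atTop (𝓝 p) := by
  have := FiniteDimensional.proper ℝ V
  obtain ⟨c, C, hc, hC, hb⟩ := L.exists_norm_bounds hL
  have hLc : Continuous L := L.continuous_of_finiteDimensional
  have hz : ∀ p ∈ Function.fixedPoints R, ∀ k, ‖L (x k + γ k • (R (x k) - x k) - p)‖ ^ 2 ≤
      ‖L (x k - p)‖ ^ 2 - γ k * (1 - γ k) * ‖L (R (x k) - x k)‖ ^ 2 := by
    intro p hp k
    have h1 := hq p hp (x k)
    obtain ⟨h2, h3⟩ := hγ k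
    set a := L (x k - p) with ha
    set b := L (R (x k) - p) with hb
    have e1 : L (R (x k) - x k) = b - a := by
      rw [ha, hb, ← map_sub]; congr 1; abel
    have e2 : L (x k + γ k • (R (x k) - x k) - p) = a + γ k • (b - a) := by
      rw [← e1, ha, ← map_smul, ← map_add]; congr 1; abel
    rw [e1, e2, norm_add_sq_real, norm_smul, mul_pow, inner_smul_right, norm_sub_sq_real,
      inner_sub_right, real_inner_self_eq_norm_sq, Real.norm_eq_abs, sq_abs,
      real_inner_comm a b]
    nlinarith [mul_le_mul_of_nonneg_left (pow_le_pow_left₀ (norm_nonneg b) h1 2) h2]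
  have hstep1 : ∀ p ∈ Function.fixedPoints R, ∀ k,
      ‖L (x (k + 1) - p)‖ ≤ ‖L (x k + γ k • (R (x k) - x k) - p)‖ + e k := by
    intro p hp k
    have h1 : x (k + 1) - p = (x k + γ k • (R (x k) - x k) - p) +
      (x (k + 1) - (x k + γ k • (R (x k) - x k))) := by abel
    rw [h1, map_add]
    exact (norm_add_le _ _).trans (by linarith [hstep k])
  have hγ' : ∀ k, 0 ≤ γ k * (1 - γ k) := fun k =>
    mul_nonneg (hγ k).1 (by linarith [(hγ k).2])
  have hz' : ∀ p ∈ Function.fixedPoints R, ∀ k,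
      ‖L (x k + γ k • (R (x k) - x k) - p)‖ ≤ ‖L (x k - p)‖ := by
    intro p hp k
    refine (pow_le_pow_iff_left₀ (norm_nonneg _) (norm_nonneg _) two_ne_zero).1 ?_
    have := hz p hp k
    have := mul_nonneg (hγ' k) (sq_nonneg ‖L (R (x k) - x k)‖)
    linarith
  have hfejer : ∀ p ∈ Function.fixedPoints R, (∀ k, ‖L (x k - p)‖ ≤ ‖L (x 0 - p)‖ + ∑' j, e j) ∧
      ∃ l, Tendsto (fun k => ‖L (x k - p)‖) atTop (𝓝 l) := by
    intro p hp
    refine exists_tendsto_of_le_add (fun k => norm_nonneg _) he hsum fun k => ?_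
    exact (hstep1 p hp k).trans (by linarith [hz' p hp k])
  obtain ⟨p, hp⟩ := hfix
  set E := ∑' j, e j with hE
  have hE0 : 0 ≤ E := tsum_nonneg he
  have heE : ∀ k, e k ≤ E := fun k => hsum.le_tsum k fun j _ => he j
  set M := ‖L (x 0 - p)‖ + E with hM
  have hMb := (hfejer p hp).1
  -- Squaring the perturbed step: `(z + e)² ≤ z² + (2 M + E) e`, because `z ≤ M` and `e ≤ E`.
  have hsq : ∀ k, γ k * (1 - γ k) * ‖L (R (x k) - x k)‖ ^ 2 ≤
      ‖L (x k - p)‖ ^ 2 - ‖L (x (k + 1) - p)‖ ^ 2 + (2 * M + E) * e k := by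
    intro k
    have h1 := hstep1 p hp k
    have h2 := hz p hp k
    have h3 := (hz' p hp k).trans (hMb k)
    have h4 := pow_le_pow_left₀ (norm_nonneg _) h1 2
    nlinarith [mul_le_mul_of_nonneg_right h3 (he k), mul_le_mul_of_nonneg_right (heE k) (he k)]
  have hpart : ∀ K, ∑ k ∈ Finset.range K, γ k * (1 - γ k) * ‖L (R (x k) - x k)‖ ^ 2 ≤
      ‖L (x 0 - p)‖ ^ 2 + (2 * M + E) * E := by
    intro K
    calc _ ≤ ∑ k ∈ Finset.range K, (‖L (x k - p)‖ ^ 2 - ‖L (x (k + 1) - p)‖ ^ 2 +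
          (2 * M + E) * e k) := Finset.sum_le_sum fun k _ => hsq k
      _ = (‖L (x 0 - p)‖ ^ 2 - ‖L (x K - p)‖ ^ 2) +
          (2 * M + E) * ∑ k ∈ Finset.range K, e k := by
        rw [Finset.sum_add_distrib, ← Finset.mul_sum,
          Finset.sum_range_sub' (fun k => ‖L (x k - p)‖ ^ 2)]
      _ ≤ _ := by
        have h1 : ∑ k ∈ Finset.range K, e k ≤ E := hsum.sum_le_tsum _ fun j _ => he j
        have h2 : 0 ≤ 2 * M + E := by positivity
        nlinarith [mul_le_mul_of_nonneg_left h1 h2, sq_nonneg ‖L (x K - p)‖]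
  -- If the residual stayed above `δ`, the bounded sums `hpart` would bound `∑ γ (1 - γ)`. Residuals
  -- that are small infinitely often are enough: no monotonicity of residuals is available for a
  -- quasi-nonexpansive map.
  have hfreq : ∀ n : ℕ, ∃ᶠ k in atTop, ‖L (R (x k) - x k)‖ < 1 / ((n : ℝ) + 1) := by
    intro n hn
    set δ : ℝ := 1 / ((n : ℝ) + 1)
    have hδ : 0 < δ := by positivity
    obtain ⟨K₀, hK₀⟩ := eventually_atTop.1 hn
    have hbound : ∀ K, (∑ k ∈ Finset.range K, γ k * (1 - γ k)) * δ ^ 2 ≤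
        (‖L (x 0 - p)‖ ^ 2 + (2 * M + E) * E) +
          (∑ k ∈ Finset.range K₀, γ k * (1 - γ k)) * δ ^ 2 := by
      intro K
      rcases le_total K K₀ with hK | hK
      · have h1 : ∑ k ∈ Finset.range K, γ k * (1 - γ k) ≤
            ∑ k ∈ Finset.range K₀, γ k * (1 - γ k) :=
          Finset.sum_le_sum_of_subset_of_nonneg (Finset.range_mono hK) fun k _ _ => hγ' k
        have h2 : (0 : ℝ) ≤ ‖L (x 0 - p)‖ ^ 2 + (2 * M + E) * E := by positivity
        nlinarith [mul_le_mul_of_nonneg_right h1 (sq_nonneg δ)]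
      · rw [← Finset.sum_range_add_sum_Ico _ hK, add_mul, add_comm]
        refine add_le_add_left ?_ _
        refine le_trans ?_ (hpart K)
        rw [Finset.sum_mul, Finset.range_eq_Ico]
        refine (Finset.sum_le_sum fun k hk => ?_).trans
          (Finset.sum_le_sum_of_subset_of_nonneg (Finset.Ico_subset_Ico_left (Nat.zero_le K₀))
            fun k _ _ => mul_nonneg (hγ' k) (sq_nonneg _))
        have h1 := not_lt.1 (hK₀ k (Finset.mem_Ico.1 hk).1)
        exact mul_le_mul_of_nonneg_left (pow_le_pow_left₀ hδ.le h1 2) (hγ' k)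
    have h2 := hγsum.atTop_mul_const (show 0 < δ ^ 2 by positivity)
    obtain ⟨K, hK⟩ := (h2.eventually_gt_atTop _).exists
    exact absurd hK (not_lt.2 (hbound K))
  obtain ⟨φ, hφ, hφ'⟩ := extraction_forall_of_frequently hfreq
  have hbdd : ∀ n, x (φ n) ∈ Metric.closedBall p (c * M) := by
    intro n
    rw [mem_closedBall_iff_norm]
    exact (hb _).1.trans (mul_le_mul_of_nonneg_left (hMb _) hc.le)
  obtain ⟨a, -, θ, hθ, hlim⟩ := tendsto_subseq_of_bounded Metric.isBounded_closedBall hbdd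
  have hres : ‖L (R a - a)‖ = 0 := by
    have h1 : Continuous fun y => ‖L (R y - y)‖ := (hLc.comp (hR.sub continuous_id)).norm
    have h2 := (h1.tendsto a).comp hlim
    have h3 : Tendsto (fun n => 1 / (((θ n : ℕ) : ℝ) + 1)) atTop (𝓝 0) :=
      tendsto_one_div_add_atTop_nhds_zero_nat.comp hθ.tendsto_atTop
    exact le_antisymm (le_of_tendsto_of_tendsto' h2 h3 fun n => (hφ' (θ n)).le) (norm_nonneg _)
  have ha : a ∈ Function.fixedPoints R := by
    rw [norm_eq_zero, map_eq_zero_iff L hL, sub_eq_zero] at hres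
    exact hres
  refine ⟨a, ha, ?_⟩
  -- The distance to the cluster point `a` converges because `a` is a fixed point, and along the
  -- subsequence its limit is zero.
  obtain ⟨l, hl⟩ := (hfejer a ha).2
  have h1 : Tendsto (fun n => ‖L (x (φ (θ n)) - a)‖) atTop (𝓝 l) :=
    hl.comp (hφ.tendsto_atTop.comp hθ.tendsto_atTop)
  have h2 : Tendsto (fun n => ‖L (x (φ (θ n)) - a)‖) atTop (𝓝 0) := by
    have h3 : Continuous fun y => ‖L (y - a)‖ := (hLc.comp (continuous_id.sub continuous_const)).norm
    have h4 := (h3.tendsto a).comp hlim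
    simp only [sub_self, map_zero, norm_zero] at h4
    exact h4
  rw [tendsto_nhds_unique h1 h2] at hl
  rw [tendsto_iff_norm_sub_tendsto_zero]
  refine squeeze_zero (fun _ => norm_nonneg _) (fun k => (hb _).1) ?_
  simpa using hl.const_mul c

/-! ### Fixed points, quasi-nonexpansiveness and continuity of the exact map. -/

namespace Setup

variable {N : ℕ} {G : Game N} {S : Setup G}

theorem continuous_of_normK_le (hS : S.Admissible) {f : (S.PI → ℝ) → S.PI → ℝ}
    (h : ∀ ψ φ, S.normK (f ψ - f φ) ≤ S.normK (ψ - φ)) : Continuous f := by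
  obtain ⟨L, h1, -, h2⟩ := exists_normK_eq hS
  obtain ⟨c, C, hc, hC, hb⟩ := L.exists_norm_bounds h1
  refine (LipschitzWith.of_dist_le_mul (K := ⟨c * C, by positivity⟩) fun ψ φ => ?_).continuous
  rw [dist_eq_norm, dist_eq_norm]
  have h3 := h ψ φ
  rw [h2, h2] at h3
  calc ‖f ψ - f φ‖ ≤ c * ‖L (f ψ - f φ)‖ := (hb _).1
    _ ≤ c * (C * ‖ψ - φ‖) := by gcongr; exact h3.trans (hb _).2
    _ = _ := by rw [← mul_assoc]; rfl

theorem JA_mem (hJ : G.ScenarioObjectives) (hX : G.FeasibleSets) (hS : S.Admissible)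
    (ψ : S.PI → ℝ) : S.JA ψ ∈ resolventSet (S.precond S.opA) ψ :=
  (resolvent_eq_iff (S.existsUnique_resolvent_opA hJ hX hS ψ)).1 rfl

theorem RB_eq (hX : G.FeasibleSets) (hS : S.Admissible) (ψ : S.PI → ℝ) :
    S.RB ψ = (2 : ℝ) • S.barStep ψ - ψ := by
  have := (resolvent_eq_iff (S.existsUnique_resolvent_opB hX hS ψ)).2
    ((S.mem_resolventSet_opB_iff hX hS _ _).2 rfl)
  rw [RB, reflectedResolvent, this]

theorem normK_RB_le (hX : G.FeasibleSets) (hS : S.Admissible) (ψ φ : S.PI → ℝ) :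
    S.normK (S.RB ψ - S.RB φ) ≤ S.normK (ψ - φ) := by
  rw [RB_eq hX hS, RB_eq hX hS]
  exact (normK_resolvent_le hS (opB_monotone hS _ _ _
    ((S.mem_resolventSet_opB_iff hX hS ψ _).2 rfl) _
    ((S.mem_resolventSet_opB_iff hX hS φ _).2 rfl))).2

theorem continuous_RB (hX : G.FeasibleSets) (hS : S.Admissible) : Continuous S.RB :=
  continuous_of_normK_le hS (normK_RB_le hX hS)

/-- From `R_B (R_A ψ) = ψ` follows `J_B (R_A ψ) = J_A ψ`, and the two resolvent residuals at this
common point are opposite. -/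
theorem zero_of_mem_fixedPoints (hJ : G.ScenarioObjectives) (hX : G.FeasibleSets)
    (hS : S.Admissible) {ψ : S.PI → ℝ} (hψ : ψ ∈ Function.fixedPoints S.Rstar) :
    S.Phi *ᵥ (ψ - S.JA ψ) ∈ S.opA (S.JA ψ) ∧ -(S.Phi *ᵥ (ψ - S.JA ψ)) ∈ S.opB (S.JA ψ) := by
  refine ⟨JA_mem hJ hX hS ψ, ?_⟩
  have h1 : S.RB (S.RA ψ) = ψ := hψ
  rw [RB_eq hX hS] at h1
  have hRA : S.RA ψ = (2 : ℝ) • S.JA ψ - ψ := rfl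
  have h2 : S.JA ψ = S.barStep (S.RA ψ) := by
    have h3 : (2 : ℝ) • S.barStep (S.RA ψ) = (2 : ℝ) • S.JA ψ := by
      rw [sub_eq_iff_eq_add, hRA] at h1
      rw [hRA, h1]; abel
    have := congrArg (fun v => (1 / 2 : ℝ) • v) h3
    simpa [smul_smul] using this.symm
  have h3 := (S.mem_resolventSet_opB_iff hX hS (S.RA ψ) (S.JA ψ)).2 h2
  have h4 : S.RA ψ - S.JA ψ = -(ψ - S.JA ψ) := by rw [hRA, two_smul]; abel
  have h5 : S.Phi *ᵥ (S.RA ψ - S.JA ψ) ∈ S.opB (S.JA ψ) := h3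
  rwa [h4, Matrix.mulVec_neg] at h5

/-- If `w ∈ 𝔸p`, `-w ∈ 𝔹p` and `Φu = w`, then `J_A` sends `p + u` to `p`, the reflection is `p - u`,
and `R_B` reflects it back. -/
theorem exists_fixedPoint (hJ : G.ScenarioObjectives) (hX : G.FeasibleSets)
    (hc : S.Communicable) (hS : S.Admissible) (hne : ∃ x, G.IsVSGNE x) :
    (Function.fixedPoints S.Rstar).Nonempty := by
  obtain ⟨x, hx⟩ := hne
  obtain ⟨p, w, hA, hB⟩ := exists_zero_of_isVSGNE hX hc hS hx
  have hdet : IsUnit S.Phi.det := isUnit_iff_ne_zero.2 hS.posDef.det_pos.ne'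
  set u := S.Phi⁻¹ *ᵥ w with hu
  have hPu : S.Phi *ᵥ u = w := by
    rw [hu, Matrix.mulVec_mulVec, Matrix.mul_nonsing_inv _ hdet, Matrix.one_mulVec]
  refine ⟨p + u, ?_⟩
  have h1 : S.JA (p + u) = p := by
    refine (resolvent_eq_iff (S.existsUnique_resolvent_opA hJ hX hS _)).2 ?_
    change S.Phi *ᵥ (p + u - p) ∈ S.opA p
    rwa [add_sub_cancel_left, hPu]
  have h2 : S.RA (p + u) = p - u := by
    change (2 : ℝ) • S.JA (p + u) - (p + u) = _
    rw [h1, two_smul]; abel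
  have h3 : p = S.barStep (p - u) := by
    refine (S.mem_resolventSet_opB_iff hX hS _ _).1 ?_
    change S.Phi *ᵥ (p - u - p) ∈ S.opB p
    rwa [sub_sub_cancel_left, Matrix.mulVec_neg, hPu]
  change S.RB (S.RA (p + u)) = p + u
  rw [h2, RB_eq hX hS, ← h3, two_smul]
  abel

/-- At a fixed point `p` the `y` part of `J_A p` is consensual, so the restricted monotonicity of
`𝔸` is available for the pair `(J_A ψ, J_A p)`. -/
theorem normK_Rstar_le (hJ : G.ScenarioObjectives) (hX : G.FeasibleSets) (hc : S.Communicable)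
    (hS : S.Admissible)
    (hmono : ∀ (y : S.YI → ℝ) (x : Idx G.n → ℝ), S.PairMonotone y fun q => x q.2)
    {p : S.PI → ℝ} (hp : p ∈ Function.fixedPoints S.Rstar) (ψ : S.PI → ℝ) :
    S.normK (S.Rstar ψ - p) ≤ S.normK (ψ - p) := by
  obtain ⟨hA, hB⟩ := zero_of_mem_fixedPoints hJ hX hS hp
  obtain ⟨x, -, hx⟩ := isVSGNE_of_zero hc hS hA hB
  have h1 : S.Rstar p = p := hp
  conv_lhs => rw [← h1]
  refine (normK_RB_le hX hS _ _).trans ?_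
  refine (normK_resolvent_le hS (p := S.JA ψ) (q := S.JA p) ?_).2
  refine opA_pairMonotone hS ?_ (JA_mem hJ hX hS ψ) hA
  rw [hx]
  exact hmono _ x

theorem ConvergenceI.continuous_JA (h : S.ConvergenceI) (hJ : G.ScenarioObjectives)
    (hX : G.FeasibleSets) (hS : S.Admissible) : Continuous S.JA :=
  continuous_of_normK_le hS fun ψ φ => (normK_resolvent_le hS (opA_pairMonotone hS
    (h.pairMonotone _ _) (JA_mem hJ hX hS ψ) (JA_mem hJ hX hS φ))).1

/-- The own decisions computed by the exact first step. -/
noncomputable def decision (S : Setup G) (ψ : S.PI → ℝ) : Idx G.n → ℝ := S.own (S.yPart (S.JA ψ))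

theorem decision_spec (hJ : G.ScenarioObjectives) (hX : G.FeasibleSets) (hS : S.Admissible)
    (ψ : S.PI → ℝ) : S.IsDecision ψ (S.decision ψ) ∧
      S.JA ψ = S.completeStep ψ (S.decision ψ) := by
  obtain ⟨v, hv, h⟩ := (S.mem_resolventSet_opA_iff hS _ _).1 (JA_mem hJ hX hS ψ)
  have : S.decision ψ = v := by
    funext p
    rw [decision, h, own, yPart_completeStep, if_pos rfl]
  rw [this]
  exact ⟨hv, h⟩

theorem continuous_phiTilde (i : Fin N) : Continuous fun ψ => S.phiTilde ψ i := by
  unfold phiTilde nbrDiff edgeFlow block Matrix.mulVec dotProduct lPart mPart yPart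
  fun_prop

theorem continuous_ownDecision (i : Fin N) : Continuous fun ψ => S.ownDecision ψ i := by
  unfold ownDecision block Game.aug yPart
  fun_prop

/-- Restricted monotonicity compares only with consensual points, so it does not make `J_A`
nonexpansive. Instead the solutions of the strongly convex local problems are shown to depend
continuously on `ψ`. -/
theorem ConvergenceII.continuous_JA (h : S.ConvergenceII) (hJ : G.ScenarioObjectives)
    (hX : G.FeasibleSets) (hS : S.Admissible) : Continuous S.JA := by
  obtain ⟨_, _, θ₂, _, _, hθ₂, _, hE, _⟩ := h
  have hblock : ∀ i, Continuous fun ψ => block (S.decision ψ) i := by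
    intro i
    have hτ := hS.τ₁_pos i
    refine continuous_of_norm2_le (g := fun ψ φ => S.τ₁ i *
      (θ₂ * norm2 (S.yPart (S.completeStep ψ (S.decision φ)) -
        S.yPart (S.completeStep φ (S.decision φ))) +
      norm2 (S.phiTilde φ i - S.phiTilde ψ i +
        (S.τ₁ i)⁻¹ • (S.ownDecision ψ i - S.ownDecision φ i)))) (fun φ => ?_) fun ψ φ => ?_
    · have h1 : Continuous fun ψ => S.yPart (S.completeStep ψ (S.decision φ)) := by
        have : Continuous (S.yPart : (S.PI → ℝ) → S.YI → ℝ) := by unfold yPart; fun_prop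
        exact this.comp (S.continuous_completeStep.comp (continuous_id.prodMk continuous_const))
      have h2 := S.continuous_phiTilde i
      have h3 := S.continuous_ownDecision i
      have h4 := continuous_norm2 (ι := S.YI)
      have h5 := continuous_norm2 (ι := Fin (G.n i))
      have h6 : Continuous fun ψ => S.τ₁ i *
          (θ₂ * norm2 (S.yPart (S.completeStep ψ (S.decision φ)) -
            S.yPart (S.completeStep φ (S.decision φ))) +
          norm2 (S.phiTilde φ i - S.phiTilde ψ i +
            (S.τ₁ i)⁻¹ • (S.ownDecision ψ i - S.ownDecision φ i))) := by
        fun_prop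
      simpa [norm2_zero] using h6.tendsto φ
    · obtain ⟨hv, -⟩ := decision_spec hJ hX hS ψ
      obtain ⟨hw, -⟩ := decision_spec hJ hX hS φ
      set v := S.decision ψ
      set w := S.decision φ
      obtain ⟨hv1, g, hg, hg'⟩ := hv i
      choose hw1 g' hg2 hg2' using hw
      -- A hybrid point with the estimates computed from `ψ` and the decisions of `φ`: `k` is
      -- compared with `g` by convexity in the own decision and with `g'` by the Lipschitz bound.
      obtain ⟨k, hk⟩ := Game.extPseudograd_nonempty hJ (S.yPart (S.completeStep ψ w))
      have hk' : (fun p : Idx G.n => g' p.1 p.2) ∈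
          G.extPseudograd (S.yPart (S.completeStep φ w)) := by
        intro j
        rw [aug_completeStep, Game.partialSubdiff_replaceBlock]
        exact hg2 j
      have h1 := hE _ _ k hk _ hk'
      have hki := hk i
      rw [aug_completeStep, Game.partialSubdiff_replaceBlock] at hki
      have h2 := subdiff_monotone hg hki
      have h3 := variational_stability hv1 (hw1 i) hg' (hg2' i)
      have h4 : norm2 (block k i - g' i) ≤ norm2 (k - fun p : Idx G.n => g' p.1 p.2) :=
        norm2_block_le (k - fun p : Idx G.n => g' p.1 p.2) i
      have h5 := neg_norm2_le_dotProduct (block k i - g' i) (block v i - block w i)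
      have h6 := dotProduct_le_norm2 (S.phiTilde φ i - S.phiTilde ψ i +
        (S.τ₁ i)⁻¹ • (S.ownDecision ψ i - S.ownDecision φ i)) (block v i - block w i)
      set r := norm2 (block v i - block w i)
      have hr : 0 ≤ r := norm2_nonneg _
      have h7 : g - g' i = (g - block k i) + (block k i - g' i) := by abel
      rw [h7, add_dotProduct] at h3
      set a := θ₂ * norm2 (S.yPart (S.completeStep ψ w) - S.yPart (S.completeStep φ w))
      set b := norm2 (S.phiTilde φ i - S.phiTilde ψ i +
        (S.τ₁ i)⁻¹ • (S.ownDecision ψ i - S.ownDecision φ i))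
      have h8 : norm2 (block k i - g' i) * r ≤ a * r :=
        mul_le_mul_of_nonneg_right (h4.trans h1) hr
      have h9 : (S.τ₁ i)⁻¹ * r ^ 2 ≤ (a + b) * r := by linarith
      by_contra! hlt
      have h10 : 0 < r := by
        refine lt_of_le_of_lt ?_ hlt
        have : 0 ≤ a := mul_nonneg hθ₂.le (norm2_nonneg _)
        have : 0 ≤ b := norm2_nonneg _
        positivity
      have h11 : (S.τ₁ i)⁻¹ * r ≤ a + b := by
        have : (S.τ₁ i)⁻¹ * r * r ≤ (a + b) * r := by linarith
        exact le_of_mul_le_mul_right this h10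
      rw [inv_mul_le_iff₀ hτ] at h11
      linarith
  have hdec : Continuous S.decision := continuous_pi fun p =>
    (continuous_apply p.2).comp (hblock p.1)
  have : S.JA = fun ψ => S.completeStep ψ (S.decision ψ) :=
    funext fun ψ => (decision_spec hJ hX hS ψ).2
  rw [this]
  exact S.continuous_completeStep.comp (continuous_id.prodMk hdec)

theorem continuous_decision (h : Continuous S.JA) : Continuous S.decision :=
  continuous_pi fun p => (continuous_apply (Sum.inl (Sum.inl (p.1, p)) : S.PI)).comp h

theorem continuous_Rstar (hX : G.FeasibleSets) (hS : S.Admissible) (h : Continuous S.JA) :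
    Continuous S.Rstar :=
  (continuous_RB hX hS).comp ((h.const_smul (2 : ℝ)).sub continuous_id)

end Setup

/-! ### Conditional expectations and random summability. -/

section CondExp

variable {Ω ι : Type*} [Fintype ι] {m m₀ : MeasurableSpace Ω} {P : Measure Ω}

theorem condExp_dotProduct {g w : Ω → ι → ℝ} (hw : StronglyMeasurable[m] w)
    (hgw : Integrable (fun ω => g ω ⬝ᵥ w ω) P) (hg : Integrable g P) :
    P[fun ω => g ω ⬝ᵥ w ω | m] =ᵐ[P] fun ω => (P[g | m]) ω ⬝ᵥ w ω := by
  let B : (ι → ℝ) →L[ℝ] (ι → ℝ) →L[ℝ] ℝ := ∑ a, (ContinuousLinearMap.mul ℝ ℝ).bilinearComp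
    (ContinuousLinearMap.proj a) (ContinuousLinearMap.proj a)
  have hB : ∀ v w, B v w = v ⬝ᵥ w := by
    intro v w
    simp [B, dotProduct]
  have := condExp_bilin_of_stronglyMeasurable_right B hw (by simpa only [hB] using hgw) hg
  simpa only [hB] using this

/-- The conditional variance is nonnegative. -/
theorem sq_condExp_le [IsFiniteMeasure P] (hm : m ≤ m₀) {X : Ω → ℝ} (hX : MemLp X 2 P) :
    ∀ᵐ ω ∂P, (P[X | m]) ω ^ 2 ≤ (P[fun ω => X ω ^ 2 | m]) ω := by
  have h1 : 0 ≤ᵐ[P] Var[X; P | m] :=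
    condExp_nonneg (Eventually.of_forall fun ω => sq_nonneg _)
  filter_upwards [h1, condVar_ae_eq_condExp_sq_sub_sq_condExp hm hX] with ω h2 h3
  rw [h3] at h2
  simp only [Pi.zero_apply, Pi.sub_apply, Pi.pow_apply] at h2
  have : (X ^ 2 : Ω → ℝ) = fun ω => X ω ^ 2 := rfl
  rw [this] at h2
  linarith

/-- Summability of random errors that are conditionally controlled by a process they drive. -/
theorem ae_restrict_summable [IsProbabilityMeasure P] {F : ℕ → MeasurableSpace Ω}
    (hF : ∀ k, F k ≤ m₀) {A : Set Ω} (hA : ∀ k, MeasurableSet[F k] A) {V ε : ℕ → Ω → ℝ}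
    {γ s : ℕ → ℝ} {C : ℝ} (hC : 0 ≤ C) (hγ : ∀ k, 0 ≤ γ k) (hs : ∀ k, 0 ≤ s k)
    (hV : ∀ k ω, 0 ≤ V k ω) (hVint : ∀ k, IntegrableOn (V k) A P)
    (hε : ∀ k ω, 0 ≤ ε k ω) (hεint : ∀ k, Integrable (ε k) P)
    (hstep : ∀ k ω, V (k + 1) ω ≤ V k ω + γ k * ε k ω)
    (hcond : ∀ k, ∀ᵐ ω ∂P, (P[ε k | F k]) ω ≤ C * (V k ω + 1) * s k)
    (hsum : Summable fun k => γ k * s k) :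
    ∀ᵐ ω ∂P.restrict A, Summable fun k => γ k * ε k ω := by
  set a : ℕ → ℝ := fun k => ∫ ω in A, V k ω ∂P with ha
  set b : ℕ → ℝ := fun k => ∫ ω in A, ε k ω ∂P with hb
  have ha0 : ∀ k, 0 ≤ a k := fun k => integral_nonneg (hV k)
  have hb0 : ∀ k, 0 ≤ b k := fun k => integral_nonneg (hε k)
  have hb1 : ∀ k, b k ≤ C * (a k + 1) * s k := by
    intro k
    -- `A` belongs to every `F k`, so over `A` the error may be replaced by its conditional mean.
    have h1 : b k = ∫ ω in A, (P[ε k | F k]) ω ∂P := (setIntegral_condExp (hF k) (hεint k) (hA k)).symm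
    rw [h1]
    have hint : IntegrableOn (fun ω => C * (V k ω + 1) * s k) A P :=
      (((hVint k).add (integrable_const (1 : ℝ)).integrableOn).const_mul C).mul_const _
    calc ∫ ω in A, (P[ε k | F k]) ω ∂P ≤ ∫ ω in A, C * (V k ω + 1) * s k ∂P :=
          integral_mono_ae integrable_condExp.integrableOn hint (ae_restrict_of_ae (hcond k))
      _ = C * (a k + P.real A) * s k := by
          rw [integral_mul_const, integral_const_mul, integral_add (hVint k)
            (integrable_const (1 : ℝ)).integrableOn, setIntegral_const, smul_eq_mul, mul_one]
      _ ≤ _ := by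
          have := hs k
          gcongr
          exact measureReal_le_one
  -- Discrete Grönwall: `a + 1` grows by at most `1 + C γ s ≤ exp (C γ s)`, and these exponents are
  -- summable.
  have ha1 : ∀ k, a (k + 1) + 1 ≤ (a k + 1) * Real.exp (C * (γ k * s k)) := by
    intro k
    have h1 : a (k + 1) ≤ a k + γ k * b k := by
      calc a (k + 1) ≤ ∫ ω in A, (V k ω + γ k * ε k ω) ∂P :=
            integral_mono (hVint _) ((hVint k).add ((hεint k).integrableOn.const_mul _)) (hstep k)
        _ = _ := by
            rw [integral_add (hVint k) ((hεint k).integrableOn.const_mul _), integral_const_mul]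
    have h2 := mul_le_mul_of_nonneg_left (hb1 k) (hγ k)
    have h3 := Real.add_one_le_exp (C * (γ k * s k))
    have h4 := mul_le_mul_of_nonneg_left h3 (by linarith [ha0 k] : 0 ≤ a k + 1)
    nlinarith
  set t := ∑' k, γ k * s k with ht
  have hγs : ∀ k, 0 ≤ γ k * s k := fun k => mul_nonneg (hγ k) (hs k)
  have hpart : ∀ K, ∑ k ∈ Finset.range K, γ k * s k ≤ t := fun K =>
    hsum.sum_le_tsum _ fun k _ => hγs k
  have ha2 : ∀ k, a k + 1 ≤ (a 0 + 1) * Real.exp (C * ∑ j ∈ Finset.range k, γ j * s j) := by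
    intro k
    induction k with
    | zero => simp
    | succ k ih =>
      rw [Finset.sum_range_succ, mul_add, Real.exp_add, ← mul_assoc]
      exact (ha1 k).trans (mul_le_mul_of_nonneg_right ih (Real.exp_pos _).le)
  set Q := (a 0 + 1) * Real.exp (C * t) with hQ
  have ha3 : ∀ k, a k + 1 ≤ Q := by
    intro k
    refine (ha2 k).trans ?_
    have := ha0 0
    rw [hQ]
    gcongr
    exact hpart k
  have hb2 : ∀ k, γ k * b k ≤ C * Q * (γ k * s k) := by
    intro k
    have h1 : C * (a k + 1) * s k ≤ C * Q * s k := by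
      have := hs k
      gcongr
      exact ha3 k
    have := mul_le_mul_of_nonneg_left ((hb1 k).trans h1) (hγ k)
    linarith
  have hbsum : Summable fun k => γ k * b k :=
    Summable.of_nonneg_of_le (fun k => mul_nonneg (hγ k) (hb0 k)) hb2 (hsum.mul_left _)
  have hlint : ∀ k, ∫⁻ ω in A, ENNReal.ofReal (γ k * ε k ω) ∂P = ENNReal.ofReal (γ k * b k) := by
    intro k
    rw [hb, ← integral_const_mul, ofReal_integral_eq_lintegral_ofReal
      ((hεint k).integrableOn.const_mul _)
      (Eventually.of_forall fun ω => mul_nonneg (hγ k) (hε k ω))]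
  have hmeas : ∀ k, AEMeasurable (fun ω => ENNReal.ofReal (γ k * ε k ω)) (P.restrict A) := fun k =>
    ((hεint k).integrableOn.const_mul (γ k)).aestronglyMeasurable.aemeasurable.ennreal_ofReal
  -- The sum has finite integral, hence is finite almost everywhere on `A`.
  have hfin : ∫⁻ ω in A, ∑' k, ENNReal.ofReal (γ k * ε k ω) ∂P ≠ ⊤ := by
    rw [lintegral_tsum hmeas]
    simp only [hlint]
    exact hbsum.tsum_ofReal_ne_top
  filter_upwards [ae_lt_top' (AEMeasurable.tsum hmeas) hfin] with ω hω
  have h1 := ENNReal.summable_toReal hω.ne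
  refine h1.congr fun k => ?_
  rw [ENNReal.toReal_ofReal (mul_nonneg (hγ k) (hε k ω))]

end CondExp

/-! ### Filtrations and measurability of the iterates. -/

namespace Run

variable {N : ℕ} {G : Game N} {S : Setup G} {Ω : Type*} {r : Run S Ω}

theorem F_mono {k l : ℕ} (h : k ≤ l) : r.F k ≤ r.F l :=
  sup_le le_sup_left (iSup_le fun j => iSup_le fun hj =>
    le_sup_of_le_right (le_iSup_of_le j (le_iSup_of_le (hj.trans_le h) le_rfl)))

theorem F_le_Fminor (k : ℕ) (i : Fin N) (t : ℕ) : r.F k ≤ r.Fminor k i t := le_sup_left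

theorem Fminor_mono (k : ℕ) (i : Fin N) {t u : ℕ} (h : t ≤ u) : r.Fminor k i t ≤ r.Fminor k i u :=
  sup_le le_sup_left (iSup_le fun s => iSup_le fun hs =>
    le_sup_of_le_right (le_iSup_of_le s (le_iSup_of_le (hs.trans_le h) le_rfl)))

theorem Fminor_le_F {k : ℕ} {i : Fin N} {t : ℕ} (h : t ≤ r.T k i) :
    r.Fminor k i t ≤ r.F (k + 1) :=
  sup_le (F_mono k.le_succ) (iSup₂_le fun s hs => le_sup_of_le_right
    (le_iSup_of_le k (le_iSup_of_le k.lt_succ_self (le_iSup_of_le i (le_iSup_of_le s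
      (le_iSup_of_le (hs.trans_le h) le_rfl))))))

theorem minorIter_succ (k : ℕ) (i : Fin N) (t : ℕ) (ω : Ω) :
    r.minorIter k i (t + 1) ω = proj (S.box i)
      (r.minorIter k i t ω - (2 * S.τ₁ i / ((t : ℝ) + 2)) • r.g k i t ω) := rfl

/-- The own decisions after the minor iterations. -/
noncomputable def finalDecision (r : Run S Ω) (k : ℕ) (ω : Ω) : Idx G.n → ℝ :=
  fun p => r.minorIter k p.1 (r.T k p.1) ω p.2

theorem approxJA_eq_completeStep (k : ℕ) (ω : Ω) :
    S.approxJA (r.iter ω k) (r.T k) (fun i t => r.g k i t ω) =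
      S.completeStep (r.iter ω k) (r.finalDecision k ω) := rfl

theorem iter_succ (k : ℕ) (ω : Ω) : r.iter ω (k + 1) = r.iter ω k + (2 * r.γ k) •
    (S.barStep (r.approxRA k ω) -
      S.approxJA (r.iter ω k) (r.T k) (fun i t => r.g k i t ω)) := rfl

/-- As `ψ̂ = 2ψ - ψ̃` and `R_B ψ̂ = 2ψ̄ - ψ̂`, the update `2γ(ψ̄ - ψ)` equals `γ(R_B ψ̂ - ψ̃)`: a
relaxed fixed point step. -/
theorem iter_succ_eq (hX : G.FeasibleSets) (hS : S.Admissible) (k : ℕ) (ω : Ω) :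
    r.iter ω (k + 1) = r.iter ω k + r.γ k • (S.RB (r.approxRA k ω) - r.iter ω k) := by
  rw [iter_succ, Setup.RB_eq hX hS]
  have : (2 : ℝ) • S.barStep (r.approxRA k ω) - r.approxRA k ω - r.iter ω k =
      (2 : ℝ) • (S.barStep (r.approxRA k ω) -
        S.approxJA (r.iter ω k) (r.T k) (fun i t => r.g k i t ω)) := by
    conv_lhs => rw [sub_sub]; rhs; rw [approxRA, sub_add_cancel]
    rw [smul_sub]
  rw [this, smul_smul, mul_comm]

section

variable [MeasurableSpace Ω]

theorem F_le (hr : r.WellFormed) (k : ℕ) : r.F k ≤ ‹MeasurableSpace Ω› :=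
  sup_le hr.meas_ψ₀.comap_le (iSup_le fun j => iSup_le fun _ => iSup_le fun i => iSup_le fun t =>
    iSup_le fun ht => (hr.meas_ξ j i t ht).comap_le)

theorem Fminor_le (hr : r.WellFormed) {k : ℕ} {i : Fin N} {t : ℕ} (h : t ≤ r.T k i) :
    r.Fminor k i t ≤ ‹MeasurableSpace Ω› :=
  (Fminor_le_F h).trans (F_le hr _)

/-- The `t`-th iterate uses only the subgradients with index below `t`; this lets it be pulled out
of the conditional mean of the next subgradient. -/
theorem measurable_minorIter (hX : G.FeasibleSets) (hS : S.Admissible) (hr : r.WellFormed)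
    {k : ℕ} (hk : Measurable[r.F k] fun ω => r.iter ω k) (i : Fin N) {t : ℕ} (ht : t ≤ r.T k i) :
    Measurable[r.Fminor k i t] (r.minorIter k i t) := by
  induction t with
  | zero =>
    exact ((S.continuous_ownDecision i).measurable.comp hk).mono (F_le_Fminor k i 0) le_rfl
  | succ t ih =>
    have h1 : Measurable[r.Fminor k i (t + 1)] (r.minorIter k i t) :=
      (ih (Nat.le_of_succ_le ht)).mono (Fminor_mono k i t.le_succ) le_rfl
    have h2 := hr.meas_g k i t ht
    exact (continuous_proj (S.box_convex i) (S.box_compact i).isClosed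
      (S.box_nonempty hX hS i)).measurable.comp (h1.sub (h2.const_smul (2 * S.τ₁ i / ((t : ℝ) + 2))))

theorem measurable_approxJA (hX : G.FeasibleSets) (hS : S.Admissible) (hr : r.WellFormed)
    {k : ℕ} (hk : Measurable[r.F k] fun ω => r.iter ω k) :
    Measurable[r.F (k + 1)] fun ω =>
      S.approxJA (r.iter ω k) (r.T k) (fun i t => r.g k i t ω) := by
  have h1 : Measurable[r.F (k + 1)] fun ω => r.iter ω k := hk.mono (F_mono k.le_succ) le_rfl
  have h2 : Measurable[r.F (k + 1)] (r.finalDecision k) := by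
    refine @measurable_pi_lambda _ _ _ (r.F (k + 1)) _ _ fun p => ?_
    exact (measurable_pi_apply p.2).comp
      ((measurable_minorIter hX hS hr hk p.1 le_rfl).mono (Fminor_le_F le_rfl) le_rfl)
  exact S.continuous_completeStep.measurable.comp (h1.prodMk h2)

theorem measurable_iter (hX : G.FeasibleSets) (hS : S.Admissible) (hr : r.WellFormed) (k : ℕ) :
    Measurable[r.F k] fun ω => r.iter ω k := by
  induction k with
  | zero =>
    have h1 : Measurable[MeasurableSpace.comap r.ψ₀ inferInstance] r.ψ₀ :=
      comap_measurable r.ψ₀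
    exact h1.mono le_sup_left le_rfl
  | succ k ih =>
    have h1 : Measurable[r.F (k + 1)] fun ω => r.iter ω k := ih.mono (F_mono k.le_succ) le_rfl
    have h2 := measurable_approxJA hX hS hr ih
    have h3 : Measurable[r.F (k + 1)] (r.approxRA k) := (h2.const_smul (2 : ℝ)).sub h1
    have h4 : (fun ω => r.iter ω (k + 1)) = fun ω => r.iter ω k + r.γ k •
        (S.RB (r.approxRA k ω) - r.iter ω k) := funext fun ω => iter_succ_eq hX hS k ω
    rw [h4]
    exact h1.add ((((Setup.continuous_RB hX hS).measurable.comp h3).sub h1).const_smul (r.γ k))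

theorem measurable_approxRA (hX : G.FeasibleSets) (hS : S.Admissible) (hr : r.WellFormed) (k : ℕ) :
    Measurable[r.F (k + 1)] (r.approxRA k) :=
  ((measurable_approxJA hX hS hr (measurable_iter hX hS hr k)).const_smul (2 : ℝ)).sub
    ((measurable_iter hX hS hr k).mono (F_mono k.le_succ) le_rfl)

end

end Run

/-! ### One stochastic subgradient step in conditional mean. -/

section CondExp

variable {Ω ι : Type*} [Fintype ι] {m m' m₀ : MeasurableSpace Ω} {P : Measure Ω}

theorem integrable_norm2_sq_of_memLp {g : Ω → ι → ℝ} (hg : MemLp g 2 P) :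
    Integrable (fun ω => norm2 (g ω) ^ 2) P :=
  ((PiLp.continuousLinearEquiv 2 ℝ (fun _ : ι => ℝ)).symm.toContinuousLinearMap.comp_memLp'
    hg).norm.integrable_sq

theorem integrable_norm2_sq_of_le [IsFiniteMeasure P] {D : Ω → ι → ℝ} (hD : Measurable D) {b : ℝ}
    (hb : ∀ ω, norm2 (D ω) ≤ b) : Integrable (fun ω => norm2 (D ω) ^ 2) P := by
  refine Integrable.of_bound ((continuous_norm2.pow 2).measurable.comp hD).aestronglyMeasurable
    (b ^ 2) (Eventually.of_forall fun ω => ?_)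
  rw [Real.norm_of_nonneg (sq_nonneg _)]
  exact pow_le_pow_left₀ (norm2_nonneg _) (hb ω) 2

/-- One step of a stochastic subgradient method: conditional decrease of the squared distance. -/
theorem condExp_norm2_sq_le [IsFiniteMeasure P] (hm : m ≤ m') (hm' : m' ≤ m₀)
    {D D' g : Ω → ι → ℝ} {b α κ : ℝ} {M : Ω → ℝ} (hD : Measurable[m'] D)
    (hDb : ∀ ω, norm2 (D ω) ≤ b) (hD' : Measurable D') (hDb' : ∀ ω, norm2 (D' ω) ≤ b)
    (hg : MemLp g 2 P) (hα : 0 ≤ α)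
    (hstep : ∀ ω, norm2 (D' ω) ^ 2 ≤ norm2 (D ω - α • g ω) ^ 2)
    (hcoer : ∀ᵐ ω ∂P, κ * norm2 (D ω) ^ 2 ≤ (P[g | m']) ω ⬝ᵥ D ω)
    (hvar : ∀ᵐ ω ∂P, (P[fun ω => norm2 (g ω) ^ 2 | m]) ω ≤ M ω) :
    ∀ᵐ ω ∂P, (P[fun ω => norm2 (D' ω) ^ 2 | m]) ω ≤
      (1 - 2 * α * κ) * (P[fun ω => norm2 (D ω) ^ 2 | m]) ω + α ^ 2 * M ω := by
  have hD0 : Measurable D := hD.mono hm' le_rfl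
  have hgint : Integrable g P := hg.integrable one_le_two
  have hi1 := integrable_norm2_sq_of_le (P := P) hD0 hDb
  have hi1' := integrable_norm2_sq_of_le (P := P) hD' hDb'
  have hi2 := integrable_norm2_sq_of_memLp hg
  have hi3 : Integrable (fun ω => g ω ⬝ᵥ D ω) P := by
    have hm3 : AEStronglyMeasurable (fun ω => g ω ⬝ᵥ D ω) P :=
      ((Continuous.dotProduct continuous_fst continuous_snd).measurable.comp_aemeasurable
        (hg.aestronglyMeasurable.aemeasurable.prodMk hD0.aemeasurable)).aestronglyMeasurable
    refine (hi1.add hi2).mono' hm3 (Eventually.of_forall fun ω => ?_)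
    have := abs_dotProduct_le (g ω) (D ω)
    rw [Real.norm_eq_abs, Pi.add_apply]
    nlinarith [sq_nonneg (norm2 (g ω) - norm2 (D ω)), sq_nonneg (norm2 (g ω)),
      sq_nonneg (norm2 (D ω))]
  have h1 := condExp_mono (m := m) hi1' ((hi1.sub (hi3.smul (2 * α))).add (hi2.smul (α ^ 2)))
    (Eventually.of_forall fun ω => by
      have := hstep ω
      rw [norm2_sub_sq, dotProduct_smul, norm2_smul, mul_pow, sq_abs, dotProduct_comm,
        smul_eq_mul] at this
      simp only [Pi.add_apply, Pi.sub_apply, Pi.smul_apply, smul_eq_mul]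
      linarith)
  have h2 := condExp_add (hi1.sub (hi3.smul (2 * α))) (hi2.smul (α ^ 2)) m
  have h3 := condExp_sub hi1 (hi3.smul (2 * α)) m
  have h4 := condExp_smul (μ := P) (2 * α) (fun ω => g ω ⬝ᵥ D ω) m
  have h5 := condExp_smul (μ := P) (α ^ 2) (fun ω => norm2 (g ω) ^ 2) m
  have h6 := condExp_dotProduct (P := P) hD.stronglyMeasurable hi3 hgint
  -- Coercivity holds conditionally on the finer field `m'`, where `D` is known; the tower property
  -- averages it down to `m`, where the second moment bound is given.
  have h7 : P[κ • (fun ω => norm2 (D ω) ^ 2) | m] ≤ᵐ[P] P[P[fun ω => g ω ⬝ᵥ D ω | m'] | m] := by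
    refine condExp_mono (hi1.smul κ) integrable_condExp ?_
    filter_upwards [h6, hcoer] with ω h8 h9
    rw [h8]
    exact h9
  have h8 := condExp_condExp_of_le (μ := P) (f := fun ω => g ω ⬝ᵥ D ω) hm hm'
  have h9 := condExp_smul (μ := P) κ (fun ω => norm2 (D ω) ^ 2) m
  filter_upwards [h1, h2, h3, h4, h5, h7, h8, h9, hvar] with ω h1 h2 h3 h4 h5 h7 h8 h9 hv
  rw [h8, h9] at h7
  rw [h2, Pi.add_apply, h3, Pi.sub_apply, h4, h5] at h1
  simp only [Pi.smul_apply, smul_eq_mul] at h1 h7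
  have h10 := mul_le_mul_of_nonneg_left h7 (by positivity : 0 ≤ 2 * α)
  have h11 := mul_le_mul_of_nonneg_left hv (sq_nonneg α)
  linarith

end CondExp

/-! ### Strong convexity of the local problems. -/

namespace Setup

variable {N : ℕ} {G : Game N} {S : Setup G}

theorem exists_norm2_sub_le_of_mem_box (S : Setup G) (i : Fin N) :
    ∃ b : ℝ, 0 ≤ b ∧ ∀ v ∈ S.box i, ∀ w ∈ S.box i, norm2 (v - w) ≤ b := by
  obtain ⟨b, hb⟩ := ((S.box_compact i).prod (S.box_compact i)).exists_bound_of_continuousOn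
    (f := fun p => norm2 (p.1 - p.2))
    (continuous_norm2.comp (continuous_fst.sub continuous_snd)).continuousOn
  exact ⟨|b|, abs_nonneg b, fun v hv w hw =>
    (le_abs_self _).trans ((hb (v, w) ⟨hv, hw⟩).trans (le_abs_self b))⟩

/-- Quadratic growth of the augmented objective at its minimizer over the box. -/
theorem IsDecision.quadratic_growth (hS : S.Admissible) {ψ : S.PI → ℝ} {d : Idx G.n → ℝ}
    (hd : S.IsDecision ψ d) {i : Fin N} {v : Fin (G.n i) → ℝ} (hv : v ∈ S.box i) :
    S.augExpected ψ i (block d i) + 1 / (2 * S.τ₁ i) * norm2 (v - block d i) ^ 2 ≤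
      S.augExpected ψ i v := by
  obtain ⟨-, g, hg, hvi⟩ := hd i
  have h1 := hg v
  have h2 := hvi v hv
  have h3 : norm2 (v - S.ownDecision ψ i) ^ 2 = norm2 (v - block d i) ^ 2 +
      2 * ((block d i - S.ownDecision ψ i) ⬝ᵥ (v - block d i)) +
        norm2 (block d i - S.ownDecision ψ i) ^ 2 := by
    rw [dotProduct_comm, ← norm2_add_sq, sub_add_sub_cancel]
  have hτ := hS.τ₁_pos i
  simp only [augExpected, augmented]
  rw [h3]
  simp only [add_dotProduct, smul_dotProduct, smul_eq_mul, dotProduct_sub (S.phiTilde ψ i)] at h2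
  have h4 : 1 / (2 * S.τ₁ i) * (2 * ((block d i - S.ownDecision ψ i) ⬝ᵥ (v - block d i))) =
      (S.τ₁ i)⁻¹ * ((block d i - S.ownDecision ψ i) ⬝ᵥ (v - block d i)) := by
    field_simp
  rw [mul_add, mul_add, h4]
  linarith

/-- The subgradient inequality bounds `h ⬝ᵥ (v - d)` below by the objective gap, and the gap grows
quadratically. -/
theorem IsDecision.le_dotProduct (hS : S.Admissible) {ψ : S.PI → ℝ} {d : Idx G.n → ℝ}
    (hd : S.IsDecision ψ d) {i : Fin N} {v h : Fin (G.n i) → ℝ} (hv : v ∈ S.box i)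
    (hh : h ∈ subdiff (S.augExpected ψ i) v) :
    1 / (2 * S.τ₁ i) * norm2 (v - block d i) ^ 2 ≤ h ⬝ᵥ (v - block d i) := by
  have h1 := hd.quadratic_growth hS hv
  have h2 := hh (block d i)
  rw [← neg_sub v, dotProduct_neg] at h2
  linarith

theorem IsDecision.proj_step (hX : G.FeasibleSets) (hS : S.Admissible) {ψ : S.PI → ℝ}
    {d : Idx G.n → ℝ} (hd : S.IsDecision ψ d) (i : Fin N) (v : Fin (G.n i) → ℝ) :
    norm2 (proj (S.box i) v - block d i) ≤ norm2 (v - block d i) := by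
  have h := norm2_proj_sub_proj_le (S.box_convex i) (S.box_compact i).isClosed
    (S.box_nonempty hX hS i) v (block d i)
  rwa [proj_of_mem (S.box_convex i) (S.box_compact i).isClosed (hd i).1] at h

end Setup

/-! ### Rate of the minor iterations and conditional error bounds. -/

namespace Run

variable {N : ℕ} {G : Game N} {S : Setup G} {Ω : Type*} {r : Run S Ω}

theorem minorIter_mem_box (hX : G.FeasibleSets) (hS : S.Admissible) (k : ℕ) (i : Fin N) {t : ℕ}
    (ht : 1 ≤ t) (ω : Ω) : r.minorIter k i t ω ∈ S.box i := by
  obtain ⟨t, rfl⟩ := Nat.exists_eq_add_of_le' ht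
  rw [minorIter_succ]
  exact (proj_spec (S.box_convex i) (S.box_compact i).isClosed (S.box_nonempty hX hS i) _).1

/-- Deviation of a minor iterate from the exact decision. -/
noncomputable def deviation (r : Run S Ω) (k : ℕ) (i : Fin N) (t : ℕ) (ω : Ω) : Fin (G.n i) → ℝ :=
  r.minorIter k i t ω - block (S.decision (r.iter ω k)) i

/-- `R_B` is nonexpansive, and the exact and inexact first steps are the same affine function
evaluated at different decisions. -/
theorem exists_err_le (hJ : G.ScenarioObjectives) (hX : G.FeasibleSets) (hS : S.Admissible) :
    ∃ C : ℝ, 0 ≤ C ∧ ∀ (k : ℕ) (ω : Ω), r.err k ω ≤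
      C * norm2 (r.finalDecision k ω - S.decision (r.iter ω k)) := by
  obtain ⟨L, -, -, hL⟩ := Setup.exists_normK_eq hS
  set T : (Idx G.n → ℝ) →ₗ[ℝ] EuclideanSpace ℝ S.PI :=
    (2 : ℝ) • (L ∘ₗ S.completeLin ∘ₗ LinearMap.inr ℝ _ _) with hT
  refine ⟨‖LinearMap.toContinuousLinearMap T‖, norm_nonneg _, fun k ω => ?_⟩
  have h1 : r.err k ω ≤ S.normK (r.approxRA k ω - S.RA (r.iter ω k)) :=
    Setup.normK_RB_le hX hS _ _
  have h2 : r.approxRA k ω - S.RA (r.iter ω k) =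
      (2 : ℝ) • S.completeLin (0, r.finalDecision k ω - S.decision (r.iter ω k)) := by
    have h3 : S.RA (r.iter ω k) = (2 : ℝ) • S.JA (r.iter ω k) - r.iter ω k := rfl
    rw [h3, (Setup.decision_spec hJ hX hS _).2, approxRA, approxJA_eq_completeStep,
      sub_sub_sub_cancel_right, ← smul_sub, Setup.completeStep_sub, sub_self]
  rw [h2, hL, map_smul] at h1
  exact h1.trans (((LinearMap.toContinuousLinearMap T).le_opNorm _).trans
    (mul_le_mul_of_nonneg_left (norm_le_norm2 _) (norm_nonneg _)))

theorem norm2_finalDecision_sub_sq (k : ℕ) (ω : Ω) :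
    norm2 (r.finalDecision k ω - S.decision (r.iter ω k)) ^ 2 =
      ∑ i, norm2 (r.deviation k i (r.T k i) ω) ^ 2 := by
  rw [norm2_sq, dotProduct_eq_sum_block]
  refine Finset.sum_congr rfl fun i _ => ?_
  rw [norm2_sq]
  rfl

theorem err_nonneg (k : ℕ) (ω : Ω) : 0 ≤ r.err k ω := Real.sqrt_nonneg _

variable [MeasurableSpace Ω] {P : Measure Ω} [IsProbabilityMeasure P]

/-- Continuity of `J_A` is what makes the exact decision a measurable function of the iterate. -/
theorem measurable_deviation (hX : G.FeasibleSets) (hS : S.Admissible) (hr : r.WellFormed)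
    (hcont : Continuous S.JA) {k : ℕ} {i : Fin N} {t : ℕ} (ht : t ≤ r.T k i) :
    Measurable[r.Fminor k i t] (r.deviation k i t) := by
  have h1 := measurable_iter hX hS hr k
  have h2 : Continuous fun ψ => block (S.decision ψ) i :=
    continuous_pi fun a => (continuous_apply _).comp (Setup.continuous_decision hcont)
  exact (measurable_minorIter hX hS hr h1 i ht).sub
    ((h2.measurable.comp h1).mono (F_le_Fminor k i t) le_rfl)

theorem condExp_deviation_le (hJ : G.ScenarioObjectives) (hX : G.FeasibleSets)
    (hS : S.Admissible) (hr : r.WellFormed) (hg : r.StochasticSubgradients P)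
    (hcont : Continuous S.JA) {i : Fin N} {b α β : ℝ}
    (hb : ∀ v ∈ S.box i, ∀ w ∈ S.box i, norm2 (v - w) ≤ b)
    (hvar : ∀ k t, t < r.T k i → ∀ᵐ ω ∂P,
      (P[fun ω' => norm2 (r.g k i t ω') ^ 2 | r.F k]) ω ≤
        α ^ 2 * norm2 (r.iter ω k) ^ 2 + β ^ 2) (k : ℕ) {t : ℕ} (ht1 : 1 ≤ t) (ht : t ≤ r.T k i) :
    ∀ᵐ ω ∂P, (P[fun ω => norm2 (r.deviation k i t ω) ^ 2 | r.F k]) ω ≤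
      (b ^ 2 + 4 * S.τ₁ i ^ 2 * (α ^ 2 * norm2 (r.iter ω k) ^ 2 + β ^ 2)) / t := by
  have hdec : ∀ ψ, S.IsDecision ψ (S.decision ψ) := fun ψ =>
    (Setup.decision_spec hJ hX hS ψ).1
  have hDb : ∀ u, 1 ≤ u → ∀ ω, norm2 (r.deviation k i u ω) ≤ b := fun u hu ω =>
    hb _ (minorIter_mem_box hX hS k i hu ω) _ (hdec _ i).1
  have hmeas : ∀ u, u ≤ r.T k i → Measurable (r.deviation k i u) := fun u hu =>
    (measurable_deviation hX hS hr hcont hu).mono (Fminor_le hr hu) le_rfl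
  have hτ := hS.τ₁_pos i
  induction t, ht1 using Nat.le_induction with
  -- The starting decision may lie outside the box, so the bound begins at `t = 1`, after the first
  -- projection, and uses only the diameter `b` of the box.
  | base =>
    have h1 := condExp_mono (m := r.F k) (μ := P)
      (integrable_norm2_sq_of_le (hmeas 1 ht) (hDb 1 le_rfl)) (integrable_const (b ^ 2))
      (Eventually.of_forall fun ω => pow_le_pow_left₀ (norm2_nonneg _) (hDb 1 le_rfl ω) 2)
    rw [condExp_const (F_le hr k)] at h1
    filter_upwards [h1] with ω hω
    rw [Nat.cast_one, div_one]
    have : 0 ≤ 4 * S.τ₁ i ^ 2 * (α ^ 2 * norm2 (r.iter ω k) ^ 2 + β ^ 2) := by positivity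
    linarith
  | succ t ht1 ih =>
    have hlt : t < r.T k i := ht
    have h1 := condExp_norm2_sq_le (m := r.F k) (F_le_Fminor k i t) (Fminor_le hr hlt.le)
      (κ := 1 / (2 * S.τ₁ i)) (α := 2 * S.τ₁ i / ((t : ℝ) + 2))
      (measurable_deviation hX hS hr hcont hlt.le) (hDb t ht1) (hmeas _ ht)
      (hDb (t + 1) (by omega)) (hg.memLp k i t hlt) (by positivity)
      (fun ω => by
        refine pow_le_pow_left₀ (norm2_nonneg _) ?_ 2
        exact ((hdec _).proj_step hX hS i _).trans_eq (congrArg norm2 (sub_right_comm _ _ _)))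
      (by
        filter_upwards [hg.unbiased k i t hlt] with ω hω
        exact (hdec _).le_dotProduct hS (minorIter_mem_box hX hS k i ht1 ω) hω)
      (hvar k t hlt)
    filter_upwards [h1, ih hlt.le] with ω h2 h3
    refine h2.trans ?_
    set M := α ^ 2 * norm2 (r.iter ω k) ^ 2 + β ^ 2 with hM
    have hM0 : 0 ≤ M := by positivity
    have ht0 : (0 : ℝ) < t := by exact_mod_cast ht1
    -- The step size `2 τ₁ / (t + 2)` against the modulus `1 / (2 τ₁)` gives the contraction factor
    -- `t / (t + 2)`, which cancels the `t` in the inductive bound `K / t`.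
    have h4 : 1 - 2 * (2 * S.τ₁ i / ((t : ℝ) + 2)) * (1 / (2 * S.τ₁ i)) = t / (t + 2) := by
      field_simp
      ring
    rw [h4]
    set K := b ^ 2 + 4 * S.τ₁ i ^ 2 * M with hK
    have hK0 : 0 ≤ K := by positivity
    calc _ ≤ (t : ℝ) / (t + 2) * (K / t) + K / (t + 2) ^ 2 := by
          refine add_le_add (mul_le_mul_of_nonneg_left h3 (by positivity)) ?_
          rw [div_pow, div_mul_eq_mul_div]
          refine div_le_div_of_nonneg_right ?_ (by positivity)
          nlinarith [sq_nonneg b]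
      _ = K * ((t + 3) / (t + 2) ^ 2) := by field_simp; ring
      -- `(t + 1)(t + 3) ≤ (t + 2)²`.
      _ ≤ K * (1 / ((t : ℝ) + 1)) := by
          refine mul_le_mul_of_nonneg_left ?_ hK0
          rw [div_le_div_iff₀ (by positivity) (by positivity)]
          nlinarith
      _ = _ := by push_cast; ring

theorem exists_norm2_finalDecision_sub_le (hJ : G.ScenarioObjectives) (hX : G.FeasibleSets)
    (hS : S.Admissible) (hr : r.WellFormed) :
    ∃ b : ℝ, 0 ≤ b ∧ ∀ (k : ℕ) (ω : Ω),
      norm2 (r.finalDecision k ω - S.decision (r.iter ω k)) ≤ b := by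
  choose b hb0 hb using S.exists_norm2_sub_le_of_mem_box
  refine ⟨√(∑ i, b i ^ 2), Real.sqrt_nonneg _, fun k ω => Real.le_sqrt_of_sq_le ?_⟩
  rw [norm2_finalDecision_sub_sq]
  exact Finset.sum_le_sum fun i _ => pow_le_pow_left₀ (norm2_nonneg _)
    (hb i _ (minorIter_mem_box hX hS k i (hr.T_pos k i) ω) _
      ((Setup.decision_spec hJ hX hS _).1 i).1) 2

theorem exists_err_le_const (hJ : G.ScenarioObjectives) (hX : G.FeasibleSets)
    (hS : S.Admissible) (hr : r.WellFormed) :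
    ∃ b : ℝ, 0 ≤ b ∧ ∀ (k : ℕ) (ω : Ω), r.err k ω ≤ b := by
  obtain ⟨C, hC, h⟩ := exists_err_le (r := r) hJ hX hS
  obtain ⟨b, hb, h'⟩ := exists_norm2_finalDecision_sub_le hJ hX hS hr
  exact ⟨C * b, by positivity, fun k ω =>
    (h k ω).trans (mul_le_mul_of_nonneg_left (h' k ω) hC)⟩

theorem measurable_err (hX : G.FeasibleSets) (hS : S.Admissible) (hr : r.WellFormed)
    (hcont : Continuous S.JA) (k : ℕ) : Measurable (r.err k) := by
  obtain ⟨L, -, -, hL⟩ := Setup.exists_normK_eq hS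
  have h1 : Continuous S.normK := by
    rw [show S.normK = fun v => ‖L v‖ from funext hL]
    exact (LinearMap.continuous_of_finiteDimensional L).norm
  exact h1.measurable.comp (((Setup.continuous_RB hX hS).measurable.comp
    ((measurable_approxRA hX hS hr k).mono (F_le hr _) le_rfl)).sub
      ((Setup.continuous_Rstar hX hS hcont).measurable.comp
        ((measurable_iter hX hS hr k).mono (F_le hr _) le_rfl)))

theorem memLp_err (hJ : G.ScenarioObjectives) (hX : G.FeasibleSets) (hS : S.Admissible)
    (hr : r.WellFormed) (hcont : Continuous S.JA) (k : ℕ) : MemLp (r.err k) 2 P := by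
  obtain ⟨b, -, hb⟩ := exists_err_le_const hJ hX hS hr
  refine MemLp.of_bound (measurable_err hX hS hr hcont k).aestronglyMeasurable b
    (Eventually.of_forall fun ω => ?_)
  rw [Real.norm_of_nonneg (err_nonneg k ω)]
  exact hb k ω

/-- The conditional mean of the error decays like the inverse square root of the number of minor
steps. -/
theorem exists_condExp_err_le (hJ : G.ScenarioObjectives) (hX : G.FeasibleSets)
    (hc : S.Communicable) (hS : S.Admissible) (hr : r.WellFormed)
    (hg : r.StochasticSubgradients P) (hcont : Continuous S.JA) :
    ∃ C : ℝ, 0 ≤ C ∧ ∀ k, ∀ᵐ ω ∂P, (P[r.err k | r.F k]) ω ≤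
      C * (norm2 (r.iter ω k) + 1) * ((⨅ i, r.T k i : ℕ) : ℝ) ^ (-(1 / 2) : ℝ) := by
  obtain ⟨C, hC, hCerr⟩ := exists_err_le (r := r) hJ hX hS
  choose b hb0 hb using S.exists_norm2_sub_le_of_mem_box
  choose α β hα hβ hvar using hg.variance
  have : Nonempty (Fin N) := hc.connected.nonempty
  set K : ℝ := ∑ i, (b i ^ 2 + 4 * S.τ₁ i ^ 2 * (α i ^ 2 + β i ^ 2)) with hK
  have hK0 : 0 ≤ K := Finset.sum_nonneg fun i _ => by positivity
  refine ⟨C * √K, by positivity, fun k => ?_⟩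
  have hT : 1 ≤ ⨅ i, r.T k i := le_ciInf (hr.T_pos k)
  have hTi : ∀ i, ⨅ i, r.T k i ≤ r.T k i := fun i => ciInf_le (OrderBot.bddBelow _) i
  set τ : ℕ := ⨅ i, r.T k i
  have hτ : (0 : ℝ) < τ := by exact_mod_cast hT
  have hmeas : ∀ i, Measurable (r.deviation k i (r.T k i)) := fun i =>
    (measurable_deviation hX hS hr hcont le_rfl).mono (Fminor_le hr le_rfl) le_rfl
  have hint : ∀ i, Integrable (fun ω => norm2 (r.deviation k i (r.T k i) ω) ^ 2) P := fun i =>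
    integrable_norm2_sq_of_le (hmeas i) fun ω =>
      hb i _ (minorIter_mem_box hX hS k i (hr.T_pos k i) ω) _
        ((Setup.decision_spec hJ hX hS _).1 i).1
  have h1 := condExp_mono (m := r.F k) (memLp_err (P := P) hJ hX hS hr hcont k).integrable_sq
    ((integrable_finsetSum' Finset.univ fun i _ => hint i).smul (C ^ 2))
    (Eventually.of_forall fun ω => by
      have := pow_le_pow_left₀ (err_nonneg k ω) (hCerr k ω) 2
      rwa [mul_pow, norm2_finalDecision_sub_sq, ← Finset.sum_apply ω Finset.univ
        fun i ω => norm2 (r.deviation k i (r.T k i) ω) ^ 2] at this)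
  have h2 := condExp_smul (μ := P) (C ^ 2)
    (∑ i, fun ω => norm2 (r.deviation k i (r.T k i) ω) ^ 2) (r.F k)
  have h3 := condExp_finsetSum (μ := P) (s := Finset.univ) (fun i _ => hint i) (r.F k)
  have h4 : ∀ᵐ ω ∂P, ∀ i, _ := ae_all_iff.2 fun i =>
    condExp_deviation_le hJ hX hS hr hg hcont (hb i) (hvar i) k (hr.T_pos k i) le_rfl
  filter_upwards [h1, h2, h3, h4, sq_condExp_le (F_le hr k)
    (memLp_err (P := P) hJ hX hS hr hcont k)] with ω h1 h2 h3 h4 h5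
  -- Conditional Jensen reduces the mean error to the mean square error, a sum of the `O(1 / T_i)`
  -- terms of the players; the root yields the exponent `-1/2`.
  refine le_of_sq_le_sq (h5.trans (h1.trans ?_))
    (by have := norm2_nonneg (r.iter ω k); positivity)
  rw [h2, Pi.smul_apply, h3, Finset.sum_apply, smul_eq_mul]
  set n := norm2 (r.iter ω k) with hn
  have hn0 : 0 ≤ n := norm2_nonneg _
  have h6 : ∀ i, (P[fun ω => norm2 (r.deviation k i (r.T k i) ω) ^ 2 | r.F k]) ω ≤
      (b i ^ 2 + 4 * S.τ₁ i ^ 2 * (α i ^ 2 + β i ^ 2)) * ((n + 1) ^ 2 / τ) := by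
    intro i
    refine (h4 i).trans ?_
    rw [← mul_div_assoc]
    refine div_le_div₀ (by positivity) ?_ hτ (by exact_mod_cast hTi i)
    have e1 : n ^ 2 ≤ (n + 1) ^ 2 := by nlinarith
    have e2 : 1 ≤ (n + 1) ^ 2 := by nlinarith
    have e3 := mul_le_mul_of_nonneg_left e2 (sq_nonneg (b i))
    have e4 := mul_le_mul_of_nonneg_left e2 (by positivity : 0 ≤ 4 * S.τ₁ i ^ 2 * β i ^ 2)
    have e5 := mul_le_mul_of_nonneg_left e1 (by positivity : 0 ≤ 4 * S.τ₁ i ^ 2 * α i ^ 2)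
    linarith
  have h7 : ((τ : ℝ) ^ (-(1 / 2) : ℝ)) ^ 2 = (τ : ℝ)⁻¹ := by
    rw [← Real.rpow_natCast, ← Real.rpow_mul hτ.le, ← Real.rpow_neg_one]
    norm_num
  calc _ ≤ C ^ 2 * (K * ((n + 1) ^ 2 / τ)) := by
        refine mul_le_mul_of_nonneg_left ?_ (sq_nonneg C)
        rw [hK, Finset.sum_mul]
        exact Finset.sum_le_sum fun i _ => h6 i
    _ = _ := by
        rw [mul_pow, mul_pow, mul_pow, Real.sq_sqrt hK0, h7]
        ring

end Run

/-! ### Almost sure summability of the weighted errors. -/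

namespace Run

variable {N : ℕ} {G : Game N} {S : Setup G} {Ω : Type*} {r : Run S Ω}

theorem normK_iter_succ_sub_le (hX : G.FeasibleSets) (hS : S.Admissible)
    (hγ : ∀ k, r.γ k ∈ Set.Icc (0 : ℝ) 1) {p : S.PI → ℝ}
    (hp : ∀ ψ, S.normK (S.Rstar ψ - p) ≤ S.normK (ψ - p)) (k : ℕ) (ω : Ω) :
    S.normK (r.iter ω (k + 1) - p) ≤ S.normK (r.iter ω k - p) + r.γ k * r.err k ω := by
  obtain ⟨L, -, -, hL⟩ := Setup.exists_normK_eq hS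
  obtain ⟨h0, h1⟩ := hγ k
  have h2 : r.iter ω (k + 1) - p = (1 - r.γ k) • (r.iter ω k - p) +
      r.γ k • (S.Rstar (r.iter ω k) - p) +
        r.γ k • (S.RB (r.approxRA k ω) - S.Rstar (r.iter ω k)) := by
    rw [iter_succ_eq hX hS]
    module
  have h3 := hp (r.iter ω k)
  rw [h2, err, hL, hL, hL] at *
  rw [map_add, map_add, map_smul, map_smul, map_smul]
  refine (norm_add₃_le).trans ?_
  rw [norm_smul, norm_smul, norm_smul, Real.norm_of_nonneg h0,
    Real.norm_of_nonneg (sub_nonneg.2 h1)]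
  have := mul_le_mul_of_nonneg_left h3 h0
  linarith

variable [MeasurableSpace Ω] {P : Measure Ω} [IsProbabilityMeasure P]

/-- `ae_restrict_summable` with `V` the distance of the iterate to a fixed point, applied on each
event where the initial distance is at most `M`. -/
theorem ae_summable_err (hJ : G.ScenarioObjectives) (hX : G.FeasibleSets)
    (hc : S.Communicable) (hS : S.Admissible) (hr : r.WellFormed)
    (hg : r.StochasticSubgradients P) (hcont : Continuous S.JA)
    (hγ : ∀ k, r.γ k ∈ Set.Icc (0 : ℝ) 1) (hγT : Summable r.γT) {p : S.PI → ℝ}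
    (hp : ∀ ψ, S.normK (S.Rstar ψ - p) ≤ S.normK (ψ - p)) :
    ∀ᵐ ω ∂P, Summable fun k => r.γ k * r.err k ω := by
  obtain ⟨L, hLinj, -, hL⟩ := Setup.exists_normK_eq hS
  obtain ⟨c, C', hc0, hC', hbound⟩ := L.exists_norm_bounds hLinj
  obtain ⟨a, ha, hnorm2⟩ := exists_norm2_le_mul_norm S.PI
  obtain ⟨C, hC, hcond⟩ := exists_condExp_err_le hJ hX hc hS hr hg hcont
  obtain ⟨b, hb, herr⟩ := exists_err_le_const hJ hX hS hr
  have hstep := normK_iter_succ_sub_le (r := r) hX hS hγ hp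
  have hmeasV : ∀ k, Measurable fun ω => S.normK (r.iter ω k - p) := by
    intro k
    have h1 : Continuous fun ψ => S.normK (ψ - p) := by
      simp only [hL]
      exact (LinearMap.continuous_of_finiteDimensional L).norm.comp (continuous_id.sub continuous_const)
    exact h1.measurable.comp ((measurable_iter hX hS hr k).mono (F_le hr _) le_rfl)
  have hgrow : ∀ (ψ : S.PI → ℝ), norm2 ψ + 1 ≤ (a * c + norm2 p + 1) * (S.normK (ψ - p) + 1) := by
    intro ψ
    have h1 := norm2_add_le (ψ - p) p
    rw [sub_add_cancel] at h1
    have h2 : norm2 (ψ - p) ≤ a * (c * S.normK (ψ - p)) := by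
      rw [hL]
      exact (hnorm2 _).trans (mul_le_mul_of_nonneg_left (hbound _).1 ha.le)
    have h3 : 0 ≤ S.normK (ψ - p) := Real.sqrt_nonneg _
    have h4 := norm2_nonneg p
    have h5 := mul_nonneg h4 h3
    have h6 : 0 ≤ a * c := by positivity
    nlinarith
  have key : ∀ M : ℕ, ∀ᵐ ω ∂P.restrict {ω | S.normK (r.ψ₀ ω - p) ≤ M},
      Summable fun k => r.γ k * r.err k ω := by
    intro M
    have hA : ∀ k, MeasurableSet[r.F k] {ω | S.normK (r.ψ₀ ω - p) ≤ M} := by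
      intro k
      have h1 : Measurable[r.F k] r.ψ₀ := (measurable_iter hX hS hr 0).mono (F_mono k.zero_le) le_rfl
      have h2 : Continuous fun ψ => S.normK (ψ - p) := by
        simp only [hL]
        exact (LinearMap.continuous_of_finiteDimensional L).norm.comp
          (continuous_id.sub continuous_const)
      exact (h2.measurable.comp h1) measurableSet_Iic
    refine ae_restrict_summable (F_le hr) hA
      (V := fun k ω => S.normK (r.iter ω k - p)) (ε := r.err) (γ := r.γ)
      (s := fun k => ((⨅ i, r.T k i : ℕ) : ℝ) ^ (-(1 / 2) : ℝ))
      (C := C * (a * c + norm2 p + 1)) (by have := norm2_nonneg p; positivity)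
      (fun k => (hγ k).1) (fun k => by positivity) (fun k ω => Real.sqrt_nonneg _) ?_ err_nonneg
      (fun k => (memLp_err (P := P) hJ hX hS hr hcont k).integrable one_le_two) hstep ?_ hγT
    · intro k
      -- On the event the distance grows by at most `b` per iteration, as `γ ≤ 1` and the boxes
      -- bound the error; this crude bound serves only for integrability.
      have h1 : ∀ k : ℕ, ∀ ω, S.normK (r.ψ₀ ω - p) ≤ M → S.normK (r.iter ω k - p) ≤ M + k * b := by
        intro k ω hω
        induction k with
        | zero => simpa [iter] using hω
        | succ k ih =>
          have h2 := hstep k ω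
          have h3 : r.γ k * r.err k ω ≤ 1 * b :=
            mul_le_mul (hγ k).2 (herr k ω) (err_nonneg k ω) zero_le_one
          push_cast
          linarith
      refine Integrable.of_bound (hmeasV k).aestronglyMeasurable (M + k * b) ?_
      refine (ae_restrict_iff' (F_le hr 0 _ (hA 0))).2 (Eventually.of_forall fun ω hω => ?_)
      exact (Real.norm_of_nonneg (Real.sqrt_nonneg _)).trans_le (h1 k ω hω)
    · intro k
      filter_upwards [hcond k] with ω hω
      refine hω.trans (mul_le_mul_of_nonneg_right ?_ (by positivity))
      rw [mul_assoc]
      exact mul_le_mul_of_nonneg_left (hgrow _) hC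
  -- Countably many events `M = 0, 1, 2, ...` cover the whole space.
  have hall := ae_all_iff.2 fun M : ℕ => (ae_restrict_iff'
    ((measurableSet_le (hmeasV 0) measurable_const : MeasurableSet
      {ω | S.normK (r.ψ₀ ω - p) ≤ (M : ℝ)}))).1 (key M)
  filter_upwards [hall] with ω hω
  obtain ⟨M, hM⟩ := exists_nat_ge (S.normK (r.ψ₀ ω - p))
  exact hω M hM

end Run

end SGNE

/-! ### The convergence theorem. -/

theorem theorem3 {N : ℕ} (G : SGNE.Game N) (S : SGNE.Setup G)
    {Ω : Type*} [MeasurableSpace Ω] (P : MeasureTheory.Measure Ω)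
    [MeasureTheory.IsProbabilityMeasure P] (r : SGNE.Run S Ω)
    (hJ : G.ScenarioObjectives)
    (hX : G.FeasibleSets)
    (hne : ∃ x, G.IsVSGNE x)
    (hgraph : S.Communicable)
    (hconv : S.ConvergenceI ∨ S.ConvergenceII)
    (hS : S.Admissible)
    (hr : r.WellFormed)
    (hg : r.StochasticSubgradients P)
    (hγ : ∀ k, r.γ k ∈ Set.Icc (0 : ℝ) 1)
    (hγsum : Filter.Tendsto (fun K : ℕ => ∑ k ∈ Finset.range K, r.γ k * (1 - r.γ k))
      Filter.atTop Filter.atTop)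
    (hγT : Summable r.γT) :
    -- the resolvents of the two preconditioned operators are single-valued with full domain
    (∀ ψ, ∃! p, p ∈ SGNE.resolventSet (S.precond S.opA) ψ) ∧
    (∀ ψ, ∃! p, p ∈ SGNE.resolventSet (S.precond S.opB) ψ) ∧
    -- the iterates are bounded almost surely
    (∀ᵐ ω ∂P, ∃ C : ℝ, ∀ k, S.normK (r.iter ω k) ≤ C) ∧
    -- the weighted conditional errors are summable almost surely
    (∀ k, MeasureTheory.Integrable (r.err k) P) ∧
    (∀ᵐ ω ∂P, Summable fun k => r.γ k * (P[r.err k | r.F k]) ω) ∧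
    -- convergence to a fixed point, and of the decisions to a v-SGNE
    (∀ᵐ ω ∂P,
      (∃ ψ ∈ Function.fixedPoints S.Rstar,
        Filter.Tendsto (fun k => r.iter ω k) Filter.atTop (nhds ψ)) ∧
      ∃ x, G.IsVSGNE x ∧
        Filter.Tendsto (fun k => S.yPart (S.JA (r.iter ω k))) Filter.atTop
          (nhds fun q => x q.2)) := by
  have hmono : ∀ (y : S.YI → ℝ) (x : SGNE.Idx G.n → ℝ), S.PairMonotone y fun q => x q.2 :=
    fun y x => hconv.elim (fun h => h.pairMonotone y _) fun h =>
      SGNE.Setup.ConvergenceII.pairMonotone hJ hgraph hS h y x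
  have hcont : Continuous S.JA :=
    hconv.elim (fun h => h.continuous_JA hJ hX hS) fun h => h.continuous_JA hJ hX hS
  have hq : ∀ p ∈ Function.fixedPoints S.Rstar, ∀ ψ,
      S.normK (S.Rstar ψ - p) ≤ S.normK (ψ - p) := fun p hp ψ =>
    SGNE.Setup.normK_Rstar_le hJ hX hgraph hS hmono hp ψ
  have hfix := SGNE.Setup.exists_fixedPoint hJ hX hgraph hS hne
  obtain ⟨p₀, hp₀⟩ := hfix
  obtain ⟨L, hLinj, -, hL⟩ := SGNE.Setup.exists_normK_eq hS
  have hconvae : ∀ᵐ ω ∂P, ∃ ψ ∈ Function.fixedPoints S.Rstar,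
      Tendsto (fun k => r.iter ω k) atTop (𝓝 ψ) := by
    filter_upwards [SGNE.Run.ae_summable_err hJ hX hgraph hS hr hg hcont hγ hγT (hq p₀ hp₀)]
      with ω hω
    refine SGNE.krasnoselskii_mann L hLinj (SGNE.Setup.continuous_Rstar hX hS hcont) ⟨p₀, hp₀⟩
      (fun p hp ψ => by simpa only [hL] using hq p hp ψ) hγ hγsum
      (fun k => mul_nonneg (hγ k).1 (SGNE.Run.err_nonneg k ω)) hω fun k => ?_
    -- The perturbation of the exact Krasnosel'skii–Mann step is exactly `γ` times the resolvent
    -- error.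
    have h1 : r.iter ω (k + 1) - (r.iter ω k + r.γ k • (S.Rstar (r.iter ω k) - r.iter ω k)) =
        r.γ k • (S.RB (r.approxRA k ω) - S.Rstar (r.iter ω k)) := by
      rw [SGNE.Run.iter_succ_eq hX hS]
      module
    rw [h1, map_smul, norm_smul, Real.norm_of_nonneg (hγ k).1, SGNE.Run.err, hL]
  have herr : ∀ k, Integrable (r.err k) P := fun k =>
    (SGNE.Run.memLp_err hJ hX hS hr hcont k).integrable one_le_two
  refine ⟨S.existsUnique_resolvent_opA hJ hX hS,
    S.existsUnique_resolvent_opB hX hS, ?_, herr, ?_, ?_⟩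
  · filter_upwards [hconvae] with ω ⟨ψ, _, hω⟩
    have h1 := ((LinearMap.continuous_of_finiteDimensional L).norm.tendsto ψ).comp hω
    obtain ⟨C, hC⟩ := h1.bddAbove_range
    exact ⟨C, fun k => (hL _).trans_le (hC ⟨k, rfl⟩)⟩
  · obtain ⟨C, hC, hcond⟩ := SGNE.Run.exists_condExp_err_le hJ hX hgraph hS hr hg hcont
    have h0 : ∀ᵐ ω ∂P, ∀ k, 0 ≤ (P[r.err k | r.F k]) ω := ae_all_iff.2 fun k =>
      condExp_nonneg (Eventually.of_forall fun ω => SGNE.Run.err_nonneg k ω)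
    -- Along a convergent path the factor `‖ψ̃‖ + 1` is bounded, so the conditional errors are
    -- dominated by a multiple of `γT`.
    filter_upwards [hconvae, ae_all_iff.2 hcond, h0] with ω ⟨ψ, _, hω⟩ h1 h2
    obtain ⟨K, hK⟩ := ((SGNE.continuous_norm2.tendsto ψ).comp hω).bddAbove_range
    refine Summable.of_nonneg_of_le (fun k => mul_nonneg (hγ k).1 (h2 k)) (fun k => ?_)
      (hγT.mul_left (C * (K + 1)))
    have h3 : SGNE.norm2 (r.iter ω k) ≤ K := hK ⟨k, rfl⟩
    have h4 : (P[r.err k | r.F k]) ω ≤ C * (K + 1) * ((⨅ i, r.T k i : ℕ) : ℝ) ^ (-(1 / 2) : ℝ) := by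
      refine (h1 k).trans ?_
      gcongr
    have h5 := mul_le_mul_of_nonneg_left h4 (hγ k).1
    rw [SGNE.Run.γT]
    linarith
  · filter_upwards [hconvae] with ω ⟨ψ, hψ, hω⟩
    refine ⟨⟨ψ, hψ, hω⟩, ?_⟩
    obtain ⟨hA, hB⟩ := SGNE.Setup.zero_of_mem_fixedPoints hJ hX hS hψ
    obtain ⟨x, hx, hxy⟩ := SGNE.Setup.isVSGNE_of_zero hgraph hS hA hB
    refine ⟨x, hx, ?_⟩
    -- The limit is `J_A` at the limiting fixed point, whose `y` part is consensual; continuity of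
    -- `J_A` transfers the convergence.
    rw [← hxy]
    have h1 : Continuous fun φ => S.yPart (S.JA φ) :=
      continuous_pi fun q => (continuous_apply _).comp hcont
    exact (h1.tendsto ψ).comp hω
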